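/- Let $n\ge 1$ and let $W:\mathbb R\to[0,\infty)$ be a double-well potential: $W=0$ outside $[-1,1]$, and on $[-1,1]$ the function $W$ is of class $C^2$ with $W(\pm1)=W'(\pm1)=0$, $W''(\pm1)>0$, $W'>0$ in $(-1,0)$, $W'<0$ in $(0,1)$ and $W''(0)<0$ (derivatives at $\pm1$ are one-sided). Put $c_0=\int_{-1}^1\sqrt{2W(s)}\,ds$. Let $\Omega\subset\mathbb R^n$ be open. Let $\mathcal A(\Omega)$ be the set of pairs $(v,\mathcal E)$ with $v,\mathcal E\in H^1(\Omega)$, $v\ge0$, $-1\le\mathcal E\le1$ and $\{v>0\}\subset\{\mathcal E=1\}$ (a.e. in $\Omega$), and for $\epsilon>0$ and $(v,\mathcal E)\in\mathcal A(\Omega)$ let $$J_\epsilon(v,\mathcal E,\Omega)=\int_\Omega \frac{|\nabla v|^2}{2}+\epsilon\,\frac{|\nabla\mathcal E|^2}{2}+\frac1\epsilon W(\mathcal E)\,dx\in[0,\infty].$$ Let $\mathrm{Per}_\Omega(E)=\sup\{\int_E \operatorname{div} g\,dx : g\in C_c^\infty(\Omega;\mathbb R^n),\ |g|\le1\}$.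 Let $\mathcal A_0(\Omega)$ be the set of pairs $(v,E)$ where $v\in H^1(\Omega)$, $v\ge0$ a.e. in $\Omega$, $E\subset\Omega$ is a Caccioppoli set (measurable, with locally finite perimeter in $\Omega$), and $v=0$ a.e. in $E$. For $v\in L^2(\Omega)$ and measurable $E\subset\Omega$ let $$I(v,E,\Omega)=\int_\Omega\frac{|\nabla v|^2}{2}\,dx+c_0\,\mathrm{Per}_\Omega(E)\in[0,\infty],$$ where the Dirichlet integral is $+\infty$ if $v\notin H^1(\Omega)$. As $\epsilon\to0$ the functionals $J_\epsilon$ $\Gamma$-converge to $I$ in the following sense. Let $\epsilon_k>0$, $\epsilon_k\to0$. a) (lower semicontinuity) If $(v_k,\mathcal E_k)\in\mathcal A(\Omega)$, $v\in L^2(\Omega)$, $E\subset\Omega$ is measurable and $$v_k\to v\ \text{ in } L^2(\Omega),\qquad \mathcal E_k\to\chi_{E^c}-\chi_E\ \text{ in } L^1(\Omega),\tag{1}$$ then $$\liminf_{k\to\infty} J_{\epsilon_k}(v_k,\mathcal E_k,\Omega)\ge I(v,E,\Omega),$$ and if this liminf is finite then $(v,E)\in\mathcal A_0(\Omega)$.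 b) (approximation) Suppose in addition that $\Omega$ is bounded with Lipschitz boundary. For every $(v,E)\in\mathcal A_0(\Omega)$ with $v$ continuous in $\overline\Omega$ there is a sequence $(v_k,\mathcal E_k)\in\mathcal A(\Omega)$ such that (1) holds and $$J_{\epsilon_k}(v_k,\mathcal E_k,\Omega)\to I(v,E,\Omega).$$ -/

import Mathlib

open MeasureTheory Set Filter Topology
open scoped ContDiff ENNReal

noncomputable section

namespace ACKS

/-- The space `ℝⁿ` with its Euclidean norm. -/
abbrev Rn (n : ℕ) := EuclideanSpace ℝ (Fin n)

/-- The double-well potentials: `W : ℝ → [0, ∞)` vanishes outside `[-1, 1]`, and in `[-1, 1]` it is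
`C²` (derivatives are taken from within `[-1, 1]`) with the stated sign conditions. -/
structure IsDoubleWell (W : ℝ → ℝ) : Prop where
  nonneg : ∀ s, 0 ≤ W s
  eq_zero_outside : ∀ s, s ∉ Icc (-1 : ℝ) 1 → W s = 0
  contDiffOn : ContDiffOn ℝ 2 W (Icc (-1) 1)
  left_zero : W (-1) = 0
  right_zero : W 1 = 0
  deriv_left : derivWithin W (Icc (-1) 1) (-1) = 0
  deriv_right : derivWithin W (Icc (-1) 1) 1 = 0
  second_left : 0 < iteratedDerivWithin 2 W (Icc (-1) 1) (-1)
  second_right : 0 < iteratedDerivWithin 2 W (Icc (-1) 1) 1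
  deriv_pos : ∀ s ∈ Ioo (-1 : ℝ) 0, 0 < derivWithin W (Icc (-1) 1) s
  deriv_neg : ∀ s ∈ Ioo (0 : ℝ) 1, derivWithin W (Icc (-1) 1) s < 0
  second_zero : iteratedDerivWithin 2 W (Icc (-1) 1) 0 < 0

/-- `c₀ = ∫_{-1}^1 √(2 W(s)) ds`. -/
def c₀ (W : ℝ → ℝ) : ℝ := ∫ s in (-1 : ℝ)..1, √(2 * W s)

/-- `f ∈ C_c^∞(Ω; F)`. -/
structure IsTest {n : ℕ} {F : Type*} [NormedAddCommGroup F] [NormedSpace ℝ F]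
    (Ω : Set (Rn n)) (f : Rn n → F) : Prop where
  contDiff : ContDiff ℝ ∞ f
  hasCompactSupport : HasCompactSupport f
  tsupport_subset : tsupport f ⊆ Ω

/-- The partial derivative `∂ᵢ φ`. -/
def pderiv {n : ℕ} (i : Fin n) (φ : Rn n → ℝ) (x : Rn n) : ℝ :=
  fderiv ℝ φ x (EuclideanSpace.single i 1)

/-- The divergence of a vector field. -/
def divergence {n : ℕ} (g : Rn n → Rn n) (x : Rn n) : ℝ :=
  ∑ i, pderiv i (fun y => g y i) x

/-- `G` is a weak (distributional) gradient of `v` in `Ω`. -/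
structure HasWeakGradient {n : ℕ} (Ω : Set (Rn n)) (v : Rn n → ℝ) (G : Rn n → Rn n) : Prop where
  locallyIntegrable : LocallyIntegrableOn v Ω
  locallyIntegrable_grad : LocallyIntegrableOn G Ω
  integral_eq : ∀ φ : Rn n → ℝ, IsTest Ω φ → ∀ i,
    ∫ x in Ω, v x * pderiv i φ x = -∫ x in Ω, G x i * φ x

/-- `v ∈ H¹(Ω)`: `v ∈ L²(Ω)` and `v` has a weak gradient in `L²(Ω)`. -/
def MemH1 {n : ℕ} (Ω : Set (Rn n)) (v : Rn n → ℝ) : Prop :=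
  MemLp v 2 (volume.restrict Ω) ∧ ∃ G, HasWeakGradient Ω v G ∧ MemLp G 2 (volume.restrict Ω)

open Classical in
/-- The weak gradient `∇v` in `Ω` (unique up to null sets in `Ω`), and `0` if there is none. -/
def weakGradient {n : ℕ} (Ω : Set (Rn n)) (v : Rn n → ℝ) : Rn n → Rn n :=
  if h : ∃ G, HasWeakGradient Ω v G then h.choose else 0

/-- The pairs `(v, 𝓔) ∈ 𝒜(Ω)`; as for all statements on `H¹` functions, the pointwise conditions are
understood almost everywhere. -/
structure Admissible {n : ℕ} (Ω : Set (Rn n)) (v 𝓔 : Rn n → ℝ) : Prop where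
  memH1_left : MemH1 Ω v
  memH1_right : MemH1 Ω 𝓔
  nonneg : ∀ᵐ x ∂(volume.restrict Ω), 0 ≤ v x
  mem_Icc : ∀ᵐ x ∂(volume.restrict Ω), 𝓔 x ∈ Icc (-1 : ℝ) 1
  eq_one : ∀ᵐ x ∂(volume.restrict Ω), 0 < v x → 𝓔 x = 1

/-- `J_ε(v, 𝓔, Ω) = ∫_Ω |∇v|²/2 + ε |∇𝓔|²/2 + W(𝓔)/ε dx ∈ [0, ∞]`. -/
def J {n : ℕ} (W : ℝ → ℝ) (ε : ℝ) (Ω : Set (Rn n)) (v 𝓔 : Rn n → ℝ) : ℝ≥0∞ :=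
  ∫⁻ x in Ω, ENNReal.ofReal
    (‖weakGradient Ω v x‖ ^ 2 / 2 + ε * (‖weakGradient Ω 𝓔 x‖ ^ 2 / 2) + 1 / ε * W (𝓔 x))

/-- `Per_Ω(E)`, the supremum of `∫_E div g` over `g ∈ C_c^∞(Ω; ℝⁿ)` with `|g| ≤ 1`. -/
def perimeter {n : ℕ} (Ω E : Set (Rn n)) : ℝ≥0∞ :=
  ⨆ (g : Rn n → Rn n) (_ : IsTest Ω g ∧ ∀ x, ‖g x‖ ≤ 1),
    ENNReal.ofReal (∫ x in E, divergence g x)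

/-- `E ⊆ Ω` is a Caccioppoli set in `Ω`: measurable, with locally finite perimeter in `Ω`. -/
structure IsCaccioppoli {n : ℕ} (Ω E : Set (Rn n)) : Prop where
  subset : E ⊆ Ω
  measurable : NullMeasurableSet E
  perimeter_lt_top : ∀ U, IsOpen U → IsCompact (closure U) → closure U ⊆ Ω → perimeter U E < ⊤

/-- The pairs `(v, E) ∈ 𝒜₀(Ω)`. -/
structure Admissible₀ {n : ℕ} (Ω : Set (Rn n)) (v : Rn n → ℝ) (E : Set (Rn n)) : Prop where
  memH1 : MemH1 Ω v
  caccioppoli : IsCaccioppoli Ω E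
  nonneg : ∀ᵐ x ∂(volume.restrict Ω), 0 ≤ v x
  eq_zero : ∀ᵐ x ∂(volume.restrict Ω), x ∈ E → v x = 0

open Classical in
/-- `∫_Ω |∇v|²/2 dx ∈ [0, ∞]`, which is `∞` if `v ∉ H¹(Ω)`. -/
def dirichletEnergy {n : ℕ} (Ω : Set (Rn n)) (v : Rn n → ℝ) : ℝ≥0∞ :=
  if MemH1 Ω v then ∫⁻ x in Ω, ENNReal.ofReal (‖weakGradient Ω v x‖ ^ 2 / 2) else ⊤

/-- `I(v, E, Ω) = ∫_Ω |∇v|²/2 dx + c₀ Per_Ω(E) ∈ [0, ∞]`. -/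
def I {n : ℕ} (W : ℝ → ℝ) (Ω : Set (Rn n)) (v : Rn n → ℝ) (E : Set (Rn n)) : ℝ≥0∞ :=
  dirichletEnergy Ω v + ENNReal.ofReal (c₀ W) * perimeter Ω E

/-- The phase function `χ_{Eᶜ} - χ_E`. -/
def phase {n : ℕ} (E : Set (Rn n)) (x : Rn n) : ℝ :=
  Eᶜ.indicator (fun _ => (1 : ℝ)) x - E.indicator (fun _ => (1 : ℝ)) x

/-- `v_k → v` in `L²(Ω)` and `𝓔_k → χ_{Eᶜ} - χ_E` in `L¹(Ω)`. -/
def ConvergesTo {n : ℕ} (Ω : Set (Rn n)) (v𝓔 : ℕ → (Rn n → ℝ) × (Rn n → ℝ))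
    (v : Rn n → ℝ) (E : Set (Rn n)) : Prop :=
  Tendsto (fun k => eLpNorm ((v𝓔 k).1 - v) 2 (volume.restrict Ω)) atTop (𝓝 0) ∧
  Tendsto (fun k => eLpNorm ((v𝓔 k).2 - phase E) 1 (volume.restrict Ω)) atTop (𝓝 0)

/-- `Ω` has Lipschitz boundary: near each boundary point, in the direction of some unit vector `e`,
`Ω` is the region strictly above the graph of a Lipschitz function of the component orthogonal
to `e`. -/
def HasLipschitzBoundary {n : ℕ} (Ω : Set (Rn n)) : Prop :=
  ∀ x ∈ frontier Ω, ∃ e : Rn n, ‖e‖ = 1 ∧ ∃ r > 0, ∃ K, ∃ γ : Rn n → ℝ, LipschitzWith K γ ∧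
    ∀ y ∈ Metric.ball x r, y ∈ Ω ↔ γ (y - inner ℝ e y • e) < inner ℝ e y

end ACKS

end

/-! Lower semicontinuity separates into two independent statements, since `J` is the Dirichlet
energy of $v$ plus an interfacial energy of $\mathcal E$. The Dirichlet part is weak lower
semicontinuity of the norm in a Hilbert space (`dirichletEnergy_le_of_frequently`). For the
interfacial part, let $\Phi$ be the primitive of $\sqrt{2W}$ vanishing at $-1$. By the inequality of
Modica and Mortola, $\epsilon|\nabla\mathcal E|^2/2+W(\mathcal E)/\epsilon\ge\sqrt{2W(\mathcal
E)}\,|\nabla\mathcal E|=|\nabla\Phi(\mathcal E)|$. Testing against vector fields with $|g|\le1$ and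
passing to the $L^1$ limit $\Phi(\chi_{E^c}-\chi_E)=c_0\chi_{E^c}$ gives
$c_0\,\mathrm{Per}_\Omega(E)$. Along an a.e. convergent subsequence $\mathcal E_k\to-1$ on $E$, so
eventually $\mathcal E_k<1$ there, which forces $v_k=0$ and hence $v=0$.

For the approximation, the set is first replaced by a function $u$, smooth up to the boundary, close
to $\chi_E$ in $L^1(\Omega)$ and with $\int_\Omega|\nabla u|$ at most slightly above
$\mathrm{Per}_\Omega(E)$ (`exists_smooth_approx`). The interior cones of a Lipschitz domain and a
partition of unity allow each piece to be mollified with values taken from inside $\Omega$; the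
total variation is then bounded by duality.

No regularity of level sets and no signed distance is needed. With $\rho=\sqrt{|\nabla u|^2+z^2}$
and an almost optimal one-dimensional profile $Q$ (`exists_profile`), put $\mathcal
E=Q((t-u)/(\epsilon\rho))$. Dividing by $\rho$ makes the argument of $Q$ change at a rate of about
$1/\epsilon$ or less. Integrating the energy density over all levels $t$ gives $\rho$ times the
profile energy at each point, so some $t\in[a,1-a]$ is at least as good as the average
(`exists_good_level`); this takes the place of the coarea formula.

The constraint $\{v>0\}\subset\{\mathcal E=1\}$ is met by truncating $v$ to $\beta(v)$, which
vanishes where $v\le\delta$. By uniform continuity, a point with $v>\delta$ has a ball of fixed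
radius that meets $E$ in a null set; $u$ vanishes at such a point and $\mathcal E=1$ there. Almost
minimising the total error over admissible pairs for each $k$ yields the sequence
(`exists_recovery_sequence`). -/

namespace ACKS

/-! ### Mollification in $L^1$ -/

open ContinuousLinearMap Metric
open scoped Convolution Pointwise

variable {n : ℕ} {F : Type*} [NormedAddCommGroup F] [NormedSpace ℝ F]

/-- The convolution of a scalar kernel with a vector-valued function. -/
noncomputable def moll (k : Rn n → ℝ) (f : Rn n → F) : Rn n → F :=
  k ⋆[lsmul ℝ ℝ, volume] f

/-- A smooth probability density supported in the closed ball of centre `c` and radius `r`. -/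
structure IsKernel (k : Rn n → ℝ) (c : Rn n) (r : ℝ) : Prop where
  contDiff : ContDiff ℝ ∞ k
  nonneg : ∀ x, 0 ≤ k x
  integral_eq_one : ∫ x, k x = 1
  support_subset : Function.support k ⊆ closedBall c r

lemma exists_isKernel (c : Rn n) {r : ℝ} (hr : 0 < r) : ∃ k, IsKernel k c r := by
  let φ : ContDiffBump c := ⟨r / 2, r, by positivity, by linarith⟩
  exact ⟨φ.normed volume, φ.contDiff_normed, φ.nonneg_normed, φ.integral_normed,
    φ.support_normed_eq.subset.trans ball_subset_closedBall⟩

namespace IsKernel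

variable {k : Rn n → ℝ} {c : Rn n} {r : ℝ}

lemma hasCompactSupport (h : IsKernel k c r) : HasCompactSupport k :=
  HasCompactSupport.of_support_subset_isCompact (isCompact_closedBall c r) h.support_subset

lemma integrable (h : IsKernel k c r) : Integrable k :=
  h.contDiff.continuous.integrable_of_hasCompactSupport h.hasCompactSupport

lemma lintegral_eq_one (h : IsKernel k c r) : ∫⁻ x, ‖k x‖ₑ = 1 := by
  rw [← ofReal_integral_norm_eq_lintegral_enorm h.integrable]
  simp [Real.norm_of_nonneg (h.nonneg _), h.integral_eq_one]

lemma neg (h : IsKernel k c r) : IsKernel (fun x => k (-x)) (-c) r where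
  contDiff := h.contDiff.comp contDiff_neg
  nonneg x := h.nonneg _
  integral_eq_one := by rw [integral_neg_eq_self, h.integral_eq_one]
  support_subset x hx := by
    have := h.support_subset (show -x ∈ Function.support k from hx)
    rw [mem_closedBall, dist_eq_norm] at this ⊢
    rwa [← norm_neg, show -(x - -c) = -x - c by abel]

lemma mono (h : IsKernel k c r) {c' : Rn n} {r' : ℝ} (hs : closedBall c r ⊆ closedBall c' r') :
    IsKernel k c' r' := ⟨h.contDiff, h.nonneg, h.integral_eq_one, h.support_subset.trans hs⟩

end IsKernel

lemma moll_apply (k : Rn n → ℝ) (f : Rn n → F) (x : Rn n) :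
    moll k f x = ∫ t, k t • f (x - t) := rfl

lemma IsKernel.sub_moll {k : Rn n → ℝ} {c : Rn n} {r : ℝ} (h : IsKernel k c r)
    {f : Rn n → ℝ} (hf : LocallyIntegrable f) (x : Rn n) :
    moll k f x - f x = ∫ t, k t * (f (x - t) - f x) := by
  have h1 : Integrable (fun t => k t * f (x - t)) :=
    h.hasCompactSupport.convolutionExists_left (lsmul ℝ ℝ) h.contDiff.continuous hf x
  simp_rw [mul_sub]
  rw [integral_sub h1 (h.integrable.mul_const _), integral_mul_const, h.integral_eq_one, one_mul]
  rfl

/-- Translations are continuous in `L¹`. -/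
lemma exists_lintegral_translate_sub_le {f : Rn n → ℝ} (hf : Integrable f) {τ : ℝ≥0∞}
    (hτ : τ ≠ 0) : ∃ δ > 0, ∀ z : Rn n, ‖z‖ ≤ δ → ∫⁻ x, ‖f (x - z) - f x‖ₑ ≤ τ := by
  wlog hτt : τ ≠ ⊤ generalizing τ
  · exact ⟨1, one_pos, fun z _ => by push Not at hτt; simp [hτt]⟩
  have h3 : τ / 3 ≠ 0 := by simp [hτ]
  obtain ⟨g, hgc, hfg, hg, hgi⟩ := hf.exists_hasCompactSupport_lintegral_sub_le h3
  -- For shifts of length at most one, $g$ and its translate both vanish off $K$, so uniform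
  -- smallness of their difference becomes smallness in $L^1$ because $K$ has finite measure.
  set K := cthickening 1 (tsupport g)
  have hK : IsCompact K := hgc.isCompact.cthickening
  have hKm : volume K ≠ ⊤ := hK.measure_ne_top
  obtain ⟨η, hη, hηK⟩ : ∃ η : ℝ, 0 < η ∧ ENNReal.ofReal η * volume K ≤ τ / 3 := by
    refine ⟨(τ / 3).toReal / ((volume K).toReal + 1), by
      have : 0 < (τ / 3).toReal := ENNReal.toReal_pos h3 (by finiteness)
      positivity, ?_⟩
    rw [← ENNReal.ofReal_toReal hKm, ← ENNReal.ofReal_mul (by positivity)]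
    refine ENNReal.ofReal_le_of_le_toReal ?_
    have : 0 ≤ (τ / 3).toReal := ENNReal.toReal_nonneg
    simp only [ENNReal.toReal_ofReal ENNReal.toReal_nonneg]
    rw [div_mul_eq_mul_div, div_le_iff₀ (by positivity)]
    gcongr; linarith
  have huc := hgc.uniformContinuous_of_continuous hg
  obtain ⟨δ, hδ, hδg⟩ := Metric.uniformContinuous_iff.1 huc η hη
  refine ⟨min (δ / 2) 1, by positivity, fun z hz => ?_⟩
  have hz1 : ‖z‖ ≤ 1 := hz.trans (min_le_right _ _)
  have hz2 : ‖z‖ < δ := by have := hz.trans (min_le_left _ _); linarith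
  have hb : ∀ x, ‖g (x - z) - g x‖ₑ ≤ K.indicator (fun _ => ENNReal.ofReal η) x := by
    intro x
    by_cases hx : x ∈ K
    · rw [indicator_of_mem hx, ← ofReal_norm]
      refine ENNReal.ofReal_le_ofReal ?_
      rw [← dist_eq_norm]
      exact (hδg (by simpa [dist_eq_norm] using hz2)).le
    · have h1 : g x = 0 := image_eq_zero_of_notMem_tsupport fun h =>
        hx (self_subset_cthickening _ h)
      have h2 : g (x - z) = 0 := image_eq_zero_of_notMem_tsupport fun h =>
        hx (mem_cthickening_of_dist_le _ _ _ _ h (by simpa [dist_eq_norm] using hz1))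
      simp [h1, h2]
  have hm : AEMeasurable (fun x => ‖f x - g x‖ₑ) :=
    (hf.sub hgi).aestronglyMeasurable.enorm
  calc ∫⁻ x, ‖f (x - z) - f x‖ₑ
      ≤ ∫⁻ x, (‖f (x - z) - g (x - z)‖ₑ + ‖g (x - z) - g x‖ₑ + ‖f x - g x‖ₑ) := by
        refine lintegral_mono fun x => ?_
        calc ‖f (x - z) - f x‖ₑ = ‖(f (x - z) - g (x - z)) + (g (x - z) - g x) - (f x - g x)‖ₑ := by
              congr 1; ring
          _ ≤ _ := (enorm_sub_le).trans (by gcongr; exact enorm_add_le _ _)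
    _ = (∫⁻ x, ‖f (x - z) - g (x - z)‖ₑ) + (∫⁻ x, ‖g (x - z) - g x‖ₑ) + ∫⁻ x, ‖f x - g x‖ₑ := by
        have hc : Continuous fun x => g (x - z) - g x := by fun_prop
        rw [lintegral_add_right' _ hm, lintegral_add_right _ hc.measurable.enorm]
    _ ≤ τ / 3 + τ / 3 + τ / 3 := by
        gcongr
        · rw [lintegral_sub_right_eq_self (fun x => ‖f x - g x‖ₑ)]; exact hfg
        · refine (lintegral_mono hb).trans ?_
          rw [lintegral_indicator_const hK.measurableSet]; exact hηK
    _ = τ := ENNReal.add_thirds τ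

/-- Convolution with kernels concentrated near the origin approximates in `L¹`. -/
lemma exists_lintegral_moll_sub_le {f : Rn n → ℝ} (hf : Integrable f) {τ : ℝ≥0∞}
    (hτ : τ ≠ 0) : ∃ δ > 0, ∀ k : Rn n → ℝ, IsKernel k 0 δ → ∫⁻ x, ‖moll k f x - f x‖ₑ ≤ τ := by
  obtain ⟨δ, hδ, h⟩ := exists_lintegral_translate_sub_le hf hτ
  refine ⟨δ, hδ, fun k hk => ?_⟩
  have hm : AEMeasurable (Function.uncurry fun x t : Rn n => ‖k t * (f (x - t) - f x)‖ₑ)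
      (volume.prod volume) := by
    have h1 : AEStronglyMeasurable (fun p : Rn n × Rn n => k p.2 * f (p.1 - p.2))
        (volume.prod volume) :=
      (hk.integrable.convolution_integrand (lsmul ℝ ℝ) hf).aestronglyMeasurable
    have h2 : AEStronglyMeasurable (fun p : Rn n × Rn n => k p.2 * f p.1)
        (volume.prod volume) :=
      hk.integrable.aestronglyMeasurable.comp_snd.mul hf.aestronglyMeasurable.comp_fst
    refine ((h1.sub h2).enorm).congr (.of_forall fun p => ?_)
    simp [Function.uncurry, mul_sub]
  -- By Tonelli the error is an average over $t$ of translation errors, and only $|t|\le\delta$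
  -- carries weight.
  calc ∫⁻ x, ‖moll k f x - f x‖ₑ = ∫⁻ x, ‖∫ t, k t * (f (x - t) - f x)‖ₑ := by
        simp_rw [hk.sub_moll hf.locallyIntegrable]
    _ ≤ ∫⁻ x, ∫⁻ t, ‖k t * (f (x - t) - f x)‖ₑ := by
        gcongr; exact enorm_integral_le_lintegral_enorm _
    _ = ∫⁻ t, ∫⁻ x, ‖k t * (f (x - t) - f x)‖ₑ := lintegral_lintegral_swap hm
    _ = ∫⁻ t, ‖k t‖ₑ * ∫⁻ x, ‖f (x - t) - f x‖ₑ := by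
        simp_rw [enorm_mul]
        congr 1; ext t
        rw [lintegral_const_mul' _ _ (by finiteness)]
    _ ≤ ∫⁻ t, ‖k t‖ₑ * τ := by
        refine lintegral_mono fun t => ?_
        by_cases ht : t ∈ Function.support k
        · gcongr
          exact h t (by simpa using hk.support_subset ht)
        · simp [Function.notMem_support.1 ht]
    _ = τ := by
        rw [lintegral_mul_const _ hk.contDiff.continuous.measurable.enorm, hk.lintegral_eq_one,
          one_mul]

lemma IsKernel.contDiff_moll {k : Rn n → ℝ} {c : Rn n} {r : ℝ} (h : IsKernel k c r)
    {f : Rn n → ℝ} (hf : LocallyIntegrable f) : ContDiff ℝ ∞ (moll k f) :=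
  h.hasCompactSupport.contDiff_convolution_left (lsmul ℝ ℝ) h.contDiff hf

lemma IsTest.locallyIntegrable {Ω : Set (Rn n)} {g : Rn n → F} (h : IsTest Ω g) :
    LocallyIntegrable g :=
  h.contDiff.continuous.locallyIntegrable

lemma IsTest.integrable {Ω : Set (Rn n)} {g : Rn n → F} (h : IsTest Ω g) : Integrable g :=
  h.contDiff.continuous.integrable_of_hasCompactSupport h.hasCompactSupport

lemma IsTest.pderiv {Ω : Set (Rn n)} {φ : Rn n → ℝ} (h : IsTest Ω φ) (i : Fin n) :
    IsTest Ω (pderiv i φ) where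
  contDiff := (h.contDiff.fderiv_right (m := ∞) (by simp)).clm_apply contDiff_const
  hasCompactSupport := h.hasCompactSupport.fderiv_apply ℝ _
  tsupport_subset := (tsupport_fderiv_apply_subset ℝ _).trans h.tsupport_subset

lemma tsupport_pderiv_subset {φ : Rn n → ℝ} (i : Fin n) :
    tsupport (pderiv i φ) ⊆ tsupport φ := tsupport_fderiv_apply_subset ℝ _

/-- Differentiating a convolution on the first factor. -/
lemma IsKernel.pderiv_moll_left {k : Rn n → ℝ} {c : Rn n} {r : ℝ} (h : IsKernel k c r)
    {f : Rn n → ℝ} (hf : LocallyIntegrable f) (i : Fin n) (x : Rn n) :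
    pderiv i (moll k f) x = ∫ y, pderiv i k (x - y) * f y := by
  have h1 : moll k f = f ⋆[lsmul ℝ ℝ, volume] k := by
    ext x
    rw [moll, convolution_eq_swap, convolution]
    congr 1; ext t; simp [mul_comm]
  have := h.hasCompactSupport.hasFDerivAt_convolution_right (lsmul ℝ ℝ) hf
    (h.contDiff.of_le (by simp)) x
  rw [pderiv, h1, this.fderiv, convolution_precompR_apply _ hf (h.hasCompactSupport.fderiv ℝ)
    (h.contDiff.continuous_fderiv (by simp))]
  rw [convolution]
  congr 1; ext t; simp [mul_comm, pderiv]

/-- Differentiating a convolution on the second factor. -/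
lemma IsKernel.pderiv_moll_right {k : Rn n → ℝ} {c : Rn n} {r : ℝ} (h : IsKernel k c r)
    {Ω : Set (Rn n)} {f : Rn n → ℝ} (hf : IsTest Ω f) (i : Fin n) (x : Rn n) :
    pderiv i (moll k f) x = moll k (pderiv i f) x := by
  have := hf.hasCompactSupport.hasFDerivAt_convolution_right (lsmul ℝ ℝ)
    h.integrable.locallyIntegrable (hf.contDiff.of_le (by simp)) x
  rw [pderiv, moll, this.fderiv, convolution_precompR_apply _ h.integrable.locallyIntegrable
    (hf.hasCompactSupport.fderiv ℝ) (hf.contDiff.continuous_fderiv (by simp))]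
  rfl

end ACKS

/-! ### Weak gradients and integration by parts -/

namespace ACKS

open ContinuousLinearMap Metric

variable {n : ℕ} {F : Type*} [NormedAddCommGroup F] [NormedSpace ℝ F]

/-- A locally integrable function times a continuous function compactly supported in `Ω`. -/
lemma integrable_mul_of_tsupport_subset {Ω : Set (Rn n)} {f φ : Rn n → ℝ}
    (hf : LocallyIntegrableOn f Ω) (hφ : Continuous φ) (hc : HasCompactSupport φ)
    (hs : tsupport φ ⊆ Ω) : Integrable fun x => f x * φ x := by
  have h1 : IntegrableOn f (tsupport φ) := hf.integrableOn_compact_subset hs hc.isCompact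
  have h2 : IntegrableOn (fun x => f x * φ x) (tsupport φ) :=
    h1.mul_continuousOn hφ.continuousOn hc.isCompact
  refine (integrableOn_iff_integrable_of_support_subset fun x hx => ?_).1 h2
  exact subset_tsupport _ fun h => hx (by simp [h])

lemma setIntegral_eq_of_tsupport_subset {Ω : Set (Rn n)} {f φ : Rn n → ℝ}
    (hs : tsupport φ ⊆ Ω) : ∫ x in Ω, f x * φ x = ∫ x, f x * φ x :=
  setIntegral_eq_integral_of_forall_compl_eq_zero fun x hx => by
    rw [image_eq_zero_of_notMem_tsupport fun h => hx (hs h), mul_zero]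

/-- Integration by parts for smooth functions. -/
lemma integral_mul_pderiv {f φ : Rn n → ℝ} {Ω : Set (Rn n)} (hf : ContDiff ℝ 1 f)
    (hφ : IsTest Ω φ) (i : Fin n) :
    ∫ x, f x * pderiv i φ x = -∫ x, pderiv i f x * φ x := by
  have hφ' := hφ.pderiv i
  have hf' : Continuous (pderiv i f) :=
    (hf.continuous_fderiv one_ne_zero).clm_apply continuous_const
  have key : ∀ {a b : Rn n → ℝ}, Continuous a → IsTest Ω b → Integrable fun x => a x * b x :=
    fun ha hb => integrable_mul_of_tsupport_subset (ha.locallyIntegrable.locallyIntegrableOn _)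
      hb.contDiff.continuous hb.hasCompactSupport hb.tsupport_subset
  exact integral_mul_fderiv_eq_neg_fderiv_mul_of_integrable (key hf' hφ)
    (key hf.continuous hφ') (key hf.continuous hφ)
    (fun x _ => hf.differentiable one_ne_zero x)
    (fun x _ => hφ.contDiff.differentiable (by simp) x)

/-- The classical gradient. -/
noncomputable def grad (f : Rn n → ℝ) (x : Rn n) : Rn n := WithLp.toLp 2 fun i => pderiv i f x

lemma grad_apply (f : Rn n → ℝ) (x : Rn n) (i : Fin n) : grad f x i = pderiv i f x := rfl

lemma inner_eq_sum (x y : Rn n) : inner ℝ x y = ∑ i, x i * y i := by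
  simp [PiLp.inner_apply, mul_comm]

lemma inner_grad (f : Rn n → ℝ) (x z : Rn n) : inner ℝ (grad f x) z = fderiv ℝ f x z := by
  have hz : z = ∑ i, z i • EuclideanSpace.single i (1 : ℝ) := by
    ext j; simp [Finset.sum_apply, Pi.single_apply]
  conv_rhs => rw [hz, map_sum]
  simp_rw [map_smul, inner_eq_sum, smul_eq_mul, mul_comm (z _)]
  rfl

lemma continuous_grad {f : Rn n → ℝ} (hf : ContDiff ℝ 1 f) : Continuous (grad f) :=
  (PiLp.continuous_toLp 2 _).comp <| continuous_pi fun _ =>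
    (hf.continuous_fderiv one_ne_zero).clm_apply continuous_const

lemma hasWeakGradient_grad {f : Rn n → ℝ} (hf : ContDiff ℝ 1 f) (Ω : Set (Rn n)) :
    HasWeakGradient Ω f (grad f) where
  locallyIntegrable := hf.continuous.locallyIntegrable.locallyIntegrableOn _
  locallyIntegrable_grad := (continuous_grad hf).locallyIntegrable.locallyIntegrableOn _
  integral_eq φ hφ i := by
    rw [setIntegral_eq_of_tsupport_subset (hφ.pderiv i).tsupport_subset,
      setIntegral_eq_of_tsupport_subset hφ.tsupport_subset, integral_mul_pderiv hf hφ]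
    rfl

lemma locallyIntegrableOn_apply {Ω : Set (Rn n)} {G : Rn n → Rn n}
    (hG : LocallyIntegrableOn G Ω) (i : Fin n) : LocallyIntegrableOn (fun x => G x i) Ω := by
  intro x hx
  obtain ⟨s, hs, h⟩ := hG x hx
  exact ⟨s, hs, Integrable.eval_piLp h i⟩

lemma isTest_apply {Ω : Set (Rn n)} {g : Rn n → Rn n} (hg : IsTest Ω g) (i : Fin n) :
    IsTest Ω fun x => g x i where
  contDiff := (contDiff_piLp 2).1 hg.contDiff i
  hasCompactSupport := hg.hasCompactSupport.comp_left (g := fun z : Rn n => z i) rfl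
  tsupport_subset := by
    refine (closure_mono fun x hx => ?_).trans hg.tsupport_subset
    exact fun h => hx (by simp [h])

lemma isTest_of_apply {Ω : Set (Rn n)} {g : Rn n → Rn n} (hg : ContDiff ℝ ∞ g)
    {K : Set (Rn n)} (hK : IsCompact K) (hKΩ : K ⊆ Ω) (h : Function.support g ⊆ K) :
    IsTest Ω g :=
  ⟨hg, HasCompactSupport.of_support_subset_isCompact hK h,
    (closure_minimal h hK.isClosed).trans hKΩ⟩

namespace HasWeakGradient

variable {Ω : Set (Rn n)} {v : Rn n → ℝ} {G : Rn n → Rn n}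

/-- Integration by parts against test vector fields. -/
lemma integral_divergence (h : HasWeakGradient Ω v G) {g : Rn n → Rn n} (hg : IsTest Ω g) :
    ∫ x in Ω, v x * divergence g x = -∫ x in Ω, inner ℝ (G x) (g x) := by
  simp_rw [divergence, inner_eq_sum, Finset.mul_sum]
  rw [integral_finsetSum, integral_finsetSum, ← Finset.sum_neg_distrib]
  · exact Finset.sum_congr rfl fun i _ => h.integral_eq _ (isTest_apply hg i) i
  · intro i _
    have ht := isTest_apply hg i
    exact (integrable_mul_of_tsupport_subset (locallyIntegrableOn_apply h.locallyIntegrable_grad i)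
      ht.contDiff.continuous ht.hasCompactSupport ht.tsupport_subset).integrableOn
  · intro i _
    have ht := (isTest_apply hg i).pderiv i
    exact (integrable_mul_of_tsupport_subset h.locallyIntegrable
      ht.contDiff.continuous ht.hasCompactSupport ht.tsupport_subset).integrableOn

/-- The fundamental lemma of the calculus of variations, applied to each component. It makes the
arbitrary choice in `weakGradient` harmless. -/
lemma ae_eq (hΩ : IsOpen Ω) {v' : Rn n → ℝ} {G' : Rn n → Rn n} (h : HasWeakGradient Ω v G)
    (h' : HasWeakGradient Ω v' G') (hv : v =ᵐ[volume.restrict Ω] v') :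
    G =ᵐ[volume.restrict Ω] G' := by
  have hi : ∀ i, ∀ᵐ x, x ∈ Ω → (G x i - G' x i) = 0 := by
    intro i
    refine hΩ.ae_eq_zero_of_integral_contDiff_smul_eq_zero
      ((locallyIntegrableOn_apply h.locallyIntegrable_grad i).sub
        (locallyIntegrableOn_apply h'.locallyIntegrable_grad i)) fun φ h1 h2 h3 => ?_
    have ht : IsTest Ω φ := ⟨h1, h2, h3⟩
    have e1 := h.integral_eq φ ht i
    have e2 := h'.integral_eq φ ht i
    have e3 : ∫ x in Ω, v x * pderiv i φ x = ∫ x in Ω, v' x * pderiv i φ x :=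
      integral_congr_ae (hv.mono fun x hx => by simp [hx])
    rw [setIntegral_eq_of_tsupport_subset h3] at e1 e2
    have j1 := integrable_mul_of_tsupport_subset
      (locallyIntegrableOn_apply h.locallyIntegrable_grad i) h1.continuous h2 h3
    have j2 := integrable_mul_of_tsupport_subset
      (locallyIntegrableOn_apply h'.locallyIntegrable_grad i) h1.continuous h2 h3
    simp only [smul_eq_mul, mul_comm (φ _), sub_mul]
    rw [integral_sub j1 j2]
    linarith
  refine (ae_restrict_iff' hΩ.measurableSet).2 ?_
  filter_upwards [ae_all_iff.2 hi] with x hx hxΩ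
  ext i
  exact sub_eq_zero.1 (hx i hxΩ)

lemma spec (h : HasWeakGradient Ω v G) : HasWeakGradient Ω v (weakGradient Ω v) := by
  have : ∃ G, HasWeakGradient Ω v G := ⟨G, h⟩
  rw [weakGradient, dif_pos this]
  exact this.choose_spec

lemma weakGradient_ae_eq (hΩ : IsOpen Ω) (h : HasWeakGradient Ω v G) :
    weakGradient Ω v =ᵐ[volume.restrict Ω] G := h.spec.ae_eq hΩ h (ae_eq_refl _)

/-- Locally, mollification commutes with weak differentiation. -/
lemma pderiv_moll (h : HasWeakGradient Ω v G) {K : Set (Rn n)} (hK : IsCompact K) (hKΩ : K ⊆ Ω)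
    {k : Rn n → ℝ} {δ : ℝ} (hk : IsKernel k 0 δ) {x : Rn n} (hx : closedBall x δ ⊆ K)
    (i : Fin n) :
    pderiv i (moll k (K.indicator v)) x = moll k (K.indicator fun y => G y i) x := by
  have hv : Integrable (K.indicator v) :=
    (integrable_indicator_iff hK.measurableSet).2 (h.locallyIntegrable.integrableOn_compact_subset
      hKΩ hK)
  -- The reflected kernel is itself a test function, because its support lies in the ball of radius
  -- $\delta$ about $x$, hence in $K$. For the same reason the cut to $K$, made for global
  -- integrability, does not affect the values at $x$.
  set φ : Rn n → ℝ := fun y => k (x - y)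
  have hsub : Function.support φ ⊆ closedBall x δ := by
    intro y hy
    have := hk.support_subset (show x - y ∈ Function.support k from hy)
    rwa [mem_closedBall, dist_zero_right, ← dist_eq_norm, dist_comm] at this
  have hφc : ContDiff ℝ ∞ φ := hk.contDiff.comp (contDiff_const.sub contDiff_id)
  have hsub' : tsupport φ ⊆ closedBall x δ := closure_minimal hsub isClosed_closedBall
  have hφ : IsTest Ω φ := ⟨hφc, HasCompactSupport.of_support_subset_isCompact
    (isCompact_closedBall x δ) hsub, hsub'.trans (hx.trans hKΩ)⟩
  have hd : ∀ y, pderiv i φ y = -pderiv i k (x - y) := by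
    intro y
    have h1 : HasFDerivAt φ ((fderiv ℝ k (x - y)).comp (-ContinuousLinearMap.id ℝ _)) y := by
      refine HasFDerivAt.comp y (hk.contDiff.differentiable (by simp) _).hasFDerivAt ?_
      exact (hasFDerivAt_id y).const_sub x
    simp [pderiv, h1.fderiv]
  have e := h.integral_eq φ hφ i
  rw [setIntegral_eq_of_tsupport_subset (hφ.pderiv i).tsupport_subset,
    setIntegral_eq_of_tsupport_subset hφ.tsupport_subset] at e
  rw [hk.pderiv_moll_left hv.locallyIntegrable]
  have e1 : ∫ y, pderiv i k (x - y) * K.indicator v y = -∫ y, v y * pderiv i φ y := by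
    rw [← integral_neg]
    congr 1; ext y
    by_cases hy : y ∈ K
    · rw [indicator_of_mem hy, hd]; ring
    · have : pderiv i φ y = 0 := image_eq_zero_of_notMem_tsupport fun h' =>
        hy (hx (hsub' (tsupport_pderiv_subset i h')))
      rw [indicator_of_notMem hy, this]; ring
  have e2 : moll k (K.indicator fun y => G y i) x = ∫ y, G y i * φ y := by
    rw [moll, MeasureTheory.convolution_eq_swap]
    congr 1; ext y
    by_cases hy : y ∈ K
    · simp [indicator_of_mem hy, φ, mul_comm]
    · have : φ y = 0 := image_eq_zero_of_notMem_tsupport fun h' => hy (hx (hsub' h'))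
      simp [indicator_of_notMem hy, this]
  rw [e1, e2, e, neg_neg]

end HasWeakGradient

end ACKS

/-! ### The chain rule for weak gradients -/

namespace ACKS

open ContinuousLinearMap Metric

variable {n : ℕ}

lemma abs_sub_le_of_hasDerivAt {h h' : ℝ → ℝ} {C : ℝ} (hd : ∀ s, HasDerivAt h (h' s) s)
    (hC : ∀ s, |h' s| ≤ C) (a b : ℝ) : |h a - h b| ≤ C * |a - b| := by
  have := convex_univ.norm_image_sub_le_of_norm_hasDerivWithin_le (f := h) (f' := h') (C := C)
    (fun x _ => (hd x).hasDerivWithinAt) (fun x _ => hC x) (mem_univ b) (mem_univ a)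
  simpa [Real.norm_eq_abs] using this

/-- Multiplication by bounded functions preserves convergence to zero in `L¹`. -/
lemma tendsto_lintegral_mul_of_bounded {α : Type*} [MeasurableSpace α] {μ : Measure α}
    {f : ℕ → α → ℝ} {g : ℕ → α → ℝ} {M : ℝ}
    (hg : ∀ j x, |g j x| ≤ M) (hf : Tendsto (fun j => ∫⁻ x, ‖f j x‖ₑ ∂μ) atTop (𝓝 0)) :
    Tendsto (fun j => ∫⁻ x, ‖g j x * f j x‖ₑ ∂μ) atTop (𝓝 0) := by
  have h1 : Tendsto (fun j => ENNReal.ofReal M * ∫⁻ x, ‖f j x‖ₑ ∂μ) atTop (𝓝 0) := by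
    simpa using ENNReal.Tendsto.const_mul hf (.inr ENNReal.ofReal_ne_top)
  refine tendsto_of_tendsto_of_tendsto_of_le_of_le tendsto_const_nhds h1 (fun _ => zero_le) ?_
  intro j
  simp only
  rw [← lintegral_const_mul' _ _ ENNReal.ofReal_ne_top]
  refine lintegral_mono fun x => ?_
  rw [enorm_mul]
  gcongr
  rw [← ofReal_norm]
  exact ENNReal.ofReal_le_ofReal (hg j x)

/-- Write $a_jg_j=a_j(g_j-g')+a_jg'$: the first term is small in $L^1$ since $a_j$ is uniformly
bounded, the second converges by domination. -/
lemma tendsto_integral_mul_of_bounded {α : Type*} [MeasurableSpace α] {μ : Measure α}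
    {a : ℕ → α → ℝ} {a' : α → ℝ} {g : ℕ → α → ℝ} {g' : α → ℝ} {M : ℝ}
    (ha : ∀ j, AEStronglyMeasurable (a j) μ) (hM : ∀ j x, |a j x| ≤ M)
    (hlim : ∀ᵐ x ∂μ, Tendsto (fun j => a j x) atTop (𝓝 (a' x)))
    (hg : ∀ j, Integrable (g j) μ) (hg' : Integrable g' μ)
    (hgg : Tendsto (fun j => ∫⁻ x, ‖g j x - g' x‖ₑ ∂μ) atTop (𝓝 0)) :
    Tendsto (fun j => ∫ x, a j x * g j x ∂μ) atTop (𝓝 (∫ x, a' x * g' x ∂μ)) := by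
  have hi : ∀ {f : α → ℝ}, Integrable f μ → ∀ j, Integrable (fun x => a j x * f x) μ :=
    fun hf j => hf.bdd_mul (ha j) (.of_forall (hM j))
  have d1 : Tendsto (fun j => ∫ x, a j x * (g j x - g' x) ∂μ) atTop (𝓝 (∫ _, (0 : ℝ) ∂μ)) := by
    refine tendsto_integral_of_L1 _ aestronglyMeasurable_zero
      (.of_forall fun j => hi ((hg j).sub hg') j) ?_
    simpa only [Pi.zero_apply, sub_zero] using tendsto_lintegral_mul_of_bounded hM hgg
  have d2 : Tendsto (fun j => ∫ x, a j x * g' x ∂μ) atTop (𝓝 (∫ x, a' x * g' x ∂μ)) := by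
    refine tendsto_integral_of_dominated_convergence (fun x => M * |g' x|)
      (fun j => (ha j).mul hg'.aestronglyMeasurable) (hg'.abs.const_mul _)
      (fun j => .of_forall fun x => ?_) ?_
    · rw [norm_mul]
      exact mul_le_mul_of_nonneg_right (hM j x) (abs_nonneg _)
    · filter_upwards [hlim] with x hx using hx.mul_const _
  have d3 := d1.add d2
  simp only [integral_zero, zero_add] at d3
  refine d3.congr fun j => ?_
  have hs : Integrable (fun x => a j x * (g j x - g' x)) μ := hi ((hg j).sub hg') j
  rw [← integral_add hs (hi hg' j)]
  congr 1; ext x; ring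

lemma locallyIntegrableOn_of_norm_le {Ω : Set (Rn n)} (hΩ : IsOpen Ω) {F F' : Type*}
    [NormedAddCommGroup F] [NormedAddCommGroup F'] {f : Rn n → F} {g : Rn n → F'}
    (hg : LocallyIntegrableOn g Ω) (hf : AEStronglyMeasurable f (volume.restrict Ω))
    (h : ∀ x, ‖f x‖ ≤ ‖g x‖) : LocallyIntegrableOn f Ω := by
  rw [locallyIntegrableOn_iff hΩ.isLocallyClosed] at hg ⊢
  exact fun k hk hkc => Integrable.mono (hg k hk hkc) (hf.mono_measure (Measure.restrict_mono hk le_rfl))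
    (.of_forall h)

/-- The chain rule for weak gradients. -/
theorem HasWeakGradient.comp {Ω : Set (Rn n)} (hΩ : IsOpen Ω) {v : Rn n → ℝ} {G : Rn n → Rn n}
    (hv : HasWeakGradient Ω v G) {h h' : ℝ → ℝ} {C : ℝ} (hd : ∀ s, HasDerivAt h (h' s) s)
    (hc : Continuous h') (hC : ∀ s, |h' s| ≤ C) :
    HasWeakGradient Ω (fun x => h (v x)) (fun x => h' (v x) • G x) := by
  have hC0 : 0 ≤ C := (abs_nonneg _).trans (hC 0)
  have hhc : Continuous h := continuous_iff_continuousAt.2 fun s => (hd s).continuousAt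
  have hLip := abs_sub_le_of_hasDerivAt hd hC
  have hloc : LocallyIntegrableOn (fun x => h (v x)) Ω := by
    refine locallyIntegrableOn_of_norm_le hΩ ((locallyIntegrableOn_const (|h 0|)).add
      (hv.locallyIntegrable.norm.smul C))
      (hhc.comp_aestronglyMeasurable hv.locallyIntegrable.aestronglyMeasurable)
      fun x => ?_
    have h1 := hLip (v x) 0
    have h2 := abs_sub_abs_le_abs_sub (h (v x)) (h 0)
    simp only [Real.norm_eq_abs, Pi.add_apply, Pi.smul_apply, smul_eq_mul]
    rw [sub_zero] at h1
    exact le_trans (by linarith) (le_abs_self _)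
  have hlocG : LocallyIntegrableOn (fun x => h' (v x) • G x) Ω := by
    refine locallyIntegrableOn_of_norm_le hΩ (hv.locallyIntegrable_grad.norm.smul C)
      ((hc.comp_aestronglyMeasurable hv.locallyIntegrable.aestronglyMeasurable).smul
        hv.locallyIntegrable_grad.aestronglyMeasurable) fun x => ?_
    simp only [norm_smul, Real.norm_eq_abs, Pi.smul_apply, smul_eq_mul, abs_mul, abs_norm]
    exact mul_le_mul_of_nonneg_right ((hC _).trans (le_abs_self _)) (norm_nonneg _)
  refine ⟨hloc, hlocG, fun φ hφ i => ?_⟩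
  -- The formula is classical for mollifications, and only the support of $\varphi$ matters. A
  -- thickening of it that stays in $\Omega$ leaves room for the kernels.
  obtain ⟨δ, hδ, hδΩ⟩ := hφ.hasCompactSupport.isCompact.exists_cthickening_subset_open hΩ
    hφ.tsupport_subset
  set K := cthickening δ (tsupport φ)
  have hK : IsCompact K := hφ.hasCompactSupport.isCompact.cthickening
  have hφK : tsupport φ ⊆ K := self_subset_cthickening _
  set V := K.indicator v
  set Γ := K.indicator fun y => G y i
  have hV : Integrable V := (integrable_indicator_iff hK.measurableSet).2
    (hv.locallyIntegrable.integrableOn_compact_subset hδΩ hK)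
  have hΓ : Integrable Γ := (integrable_indicator_iff hK.measurableSet).2
    ((locallyIntegrableOn_apply hv.locallyIntegrable_grad i).integrableOn_compact_subset hδΩ hK)
  -- The outer radius is twice the inner one because almost everywhere convergence of the
  -- convolutions (Lebesgue differentiation) needs a bounded ratio of the radii. It never exceeds
  -- $\delta$, so kernels placed at points of the support of $\varphi$ stay in $K$.
  let b : ℕ → ContDiffBump (0 : Rn n) := fun j =>
    ⟨δ / (j + 1) / 2, δ / (j + 1), by positivity, half_lt_self (by positivity)⟩
  let k : ℕ → Rn n → ℝ := fun j => (b j).normed volume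
  have hb0 : Tendsto (fun j => (b j).rOut) atTop (𝓝 0) :=
    tendsto_const_div_atTop_nhds_zero_nat δ |>.comp (tendsto_add_atTop_nat 1) |>.congr
      fun j => by simp [b]
  have hk : ∀ j, IsKernel (k j) 0 (δ / (j + 1)) := fun j =>
    ⟨(b j).contDiff_normed, (b j).nonneg_normed, (b j).integral_normed,
      (b j).support_normed_eq.subset.trans ball_subset_closedBall⟩
  have hkδ : ∀ j : ℕ, δ / ((j : ℝ) + 1) ≤ δ := fun j => div_le_self hδ.le (by linarith [j.cast_nonneg (α := ℝ)])
  have hL1 : ∀ {f : Rn n → ℝ}, Integrable f →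
      Tendsto (fun j => ∫⁻ x, ‖moll (k j) f x - f x‖ₑ) atTop (𝓝 0) := by
    intro f hf
    rw [ENNReal.tendsto_atTop_zero]
    intro τ hτ
    obtain ⟨r, hr, H⟩ := exists_lintegral_moll_sub_le hf hτ.ne'
    obtain ⟨N, hN⟩ := (hb0.eventually (ge_mem_nhds hr)).exists_forall_of_atTop
    exact ⟨N, fun j hj => H _ ((hk j).mono (closedBall_subset_closedBall (hN j hj)))⟩
  have hae : ∀ᵐ x, Tendsto (fun j => moll (k j) V x) atTop (𝓝 (V x)) :=
    ContDiffBump.ae_convolution_tendsto_right_of_locallyIntegrable (K := 2) hb0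
      (.of_forall fun j => by simp only [b]; linarith) hV.locallyIntegrable
  have hsm : ∀ {f : Rn n → ℝ}, Integrable f → ∀ j, ContDiff ℝ ∞ (moll (k j) f) :=
    fun hf j => (hk j).contDiff_moll hf.locallyIntegrable
  have hh1 : ContDiff ℝ 1 h := by
    rw [contDiff_one_iff_deriv]
    exact ⟨fun s => (hd s).differentiableAt, by rwa [show deriv h = h' from funext fun s => (hd s).deriv]⟩
  obtain ⟨M, hM⟩ : ∃ M, ∀ x, |φ x| ≤ M :=
    hφ.hasCompactSupport.exists_bound_of_continuous hφ.contDiff.continuous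
  obtain ⟨M', hM'⟩ : ∃ M, ∀ x, |pderiv i φ x| ≤ M :=
    (hφ.pderiv i).hasCompactSupport.exists_bound_of_continuous (hφ.pderiv i).contDiff.continuous
  have hint : ∀ {a c : Rn n → ℝ}, Continuous a → IsTest Ω c → Integrable fun x => c x * a x :=
    fun ha hb => by
      simpa [mul_comm] using integrable_mul_of_tsupport_subset (ha.locallyIntegrable.locallyIntegrableOn _)
        hb.contDiff.continuous hb.hasCompactSupport hb.tsupport_subset
  -- the identity for the mollified functions
  have hj : ∀ j, ∫ x, pderiv i φ x * h (moll (k j) V x) =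
      -∫ x, φ x * (h' (moll (k j) V x) * moll (k j) Γ x) := by
    intro j
    have h1 := integral_mul_pderiv (hh1.comp ((hsm hV j).of_le (by simp))) hφ i
    simp only [Function.comp_apply] at h1
    simp_rw [mul_comm (pderiv i φ _), h1]
    congr 2; ext x
    by_cases hx : x ∈ tsupport φ
    · have h2 : HasFDerivAt (h ∘ moll (k j) V)
          (h' (moll (k j) V x) • fderiv ℝ (moll (k j) V) x) x :=
        (hd _).comp_hasFDerivAt x ((hsm hV j).differentiable (by simp) x).hasFDerivAt
      have h3 := hv.pderiv_moll hK hδΩ (hk j) (x := x)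
        ((closedBall_subset_closedBall (hkδ j)).trans (closedBall_subset_cthickening hx δ)) i
      simp only [pderiv] at h3 ⊢
      rw [h2.fderiv, smul_apply, h3, smul_eq_mul]
      ring
    · rw [image_eq_zero_of_notMem_tsupport hx]; ring
  have hcompm : ∀ {f : Rn n → ℝ}, AEStronglyMeasurable f volume →
      AEStronglyMeasurable (fun x => h (f x)) volume := fun hf => hhc.comp_aestronglyMeasurable hf
  -- limits of both sides
  have lim1 : Tendsto (fun j => ∫ x, pderiv i φ x * h (moll (k j) V x)) atTop
      (𝓝 (∫ x, pderiv i φ x * h (V x))) := by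
    refine tendsto_integral_of_L1 _ ?_ (.of_forall fun j =>
      hint (hhc.comp (hsm hV j).continuous) (hφ.pderiv i)) ?_
    · exact (hφ.pderiv i).contDiff.continuous.aestronglyMeasurable.mul
        (hcompm hV.aestronglyMeasurable)
    · have h1 : Tendsto (fun j => ∫⁻ x, ‖h (moll (k j) V x) - h (V x)‖ₑ) atTop (𝓝 0) := by
        have h2 := tendsto_lintegral_mul_of_bounded (μ := volume) (M := C)
          (g := fun _ _ => C) (fun _ _ => (abs_of_nonneg hC0).le) (hL1 hV)
        refine tendsto_of_tendsto_of_tendsto_of_le_of_le tendsto_const_nhds h2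
          (fun _ => zero_le) fun j => lintegral_mono fun x => ?_
        rw [← ofReal_norm, ← ofReal_norm, norm_mul, Real.norm_of_nonneg hC0]
        exact ENNReal.ofReal_le_ofReal (hLip _ _)
      simp_rw [← mul_sub]
      exact tendsto_lintegral_mul_of_bounded (fun _ => hM') h1
  -- Since $h'$ is merely continuous, the factor $h'(V_j)$ converges only almost everywhere; it is
  -- bounded by $C$, and the gradient factor converges in $L^1$.
  have lim2 : Tendsto (fun j => ∫ x, φ x * (h' (moll (k j) V x) * moll (k j) Γ x)) atTop
      (𝓝 (∫ x, φ x * (h' (V x) * Γ x))) := by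
    have hMC : ∀ (f : Rn n → ℝ) x, |φ x * h' (f x)| ≤ M * C := fun f x => by
      rw [abs_mul]
      exact mul_le_mul (hM x) (hC _) (abs_nonneg _) ((abs_nonneg _).trans (hM x))
    simp_rw [← mul_assoc]
    refine tendsto_integral_mul_of_bounded (fun j => ?_) (fun j => hMC _) ?_ (fun j => ?_) hΓ
      (hL1 hΓ)
    · exact (hφ.contDiff.continuous.mul (hc.comp (hsm hV j).continuous)).aestronglyMeasurable
    · filter_upwards [hae] with x hx using ((hc.tendsto _).comp hx).const_mul _
    · exact (hk j).integrable.integrable_convolution (lsmul ℝ ℝ) hΓ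
  have hlim := tendsto_nhds_unique (lim1.congr hj) lim2.neg
  rw [setIntegral_eq_of_tsupport_subset (hφ.pderiv i).tsupport_subset,
    setIntegral_eq_of_tsupport_subset hφ.tsupport_subset]
  convert hlim using 1
  · congr 1; ext x
    by_cases hx : x ∈ tsupport φ
    · simp [V, indicator_of_mem (hφK hx), mul_comm]
    · rw [image_eq_zero_of_notMem_tsupport fun h => hx (tsupport_pderiv_subset i h)]; ring
  · congr 2; ext x
    by_cases hx : x ∈ tsupport φ
    · simp [V, Γ, indicator_of_mem (hφK hx), mul_comm]
    · rw [image_eq_zero_of_notMem_tsupport hx]; ring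

end ACKS

/-! ### Lower semicontinuity of the Dirichlet energy -/

namespace ACKS

open ContinuousLinearMap Metric

variable {n : ℕ}

/-- Bounded sequences in a Hilbert space converge weakly along ultrafilters. -/
lemma exists_weak_limit {H : Type*} [NormedAddCommGroup H] [InnerProductSpace ℝ H]
    [CompleteSpace H] (x : ℕ → H) (l : Ultrafilter ℕ) {M : ℝ} (hx : ∀ᶠ k in (l : Filter ℕ), ‖x k‖ ≤ M) :
    ∃ y : H, ‖y‖ ≤ M ∧ ∀ z, Tendsto (fun k => inner ℝ (x k) z) l (𝓝 (inner ℝ y z)) := by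
  have hM : 0 ≤ M := by
    obtain ⟨k, hk⟩ := hx.exists
    exact (norm_nonneg _).trans hk
  -- The inner products with $z$ lie in a compact interval, so the ultrafilter converges there
  -- without any extraction of subsequences. The limits form a functional of norm at most $M$, which
  -- the Riesz theorem represents.
  have hex : ∀ z, ∃ b, |b| ≤ M * ‖z‖ ∧ Tendsto (fun k => inner ℝ (x k) z) l (𝓝 b) := by
    intro z
    have hc : IsCompact (closedBall (0 : ℝ) (M * ‖z‖)) := isCompact_closedBall _ _
    obtain ⟨b, hb, hlim⟩ := hc.ultrafilter_le_nhds (l.map fun k => inner ℝ (x k) z) (by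
      rw [Ultrafilter.coe_map, le_principal_iff, mem_map]
      filter_upwards [hx] with k hk
      rw [mem_preimage, mem_closedBall, dist_zero_right]
      exact (norm_inner_le_norm _ _).trans (by gcongr))
    exact ⟨b, by simpa using hb, hlim⟩
  choose B hB hlim using hex
  let L : H →ₗ[ℝ] ℝ :=
    { toFun := B
      map_add' := fun a b => tendsto_nhds_unique (hlim (a + b)) <|
        ((hlim a).add (hlim b)).congr fun k => (inner_add_right _ _ _).symm
      map_smul' := fun c a => tendsto_nhds_unique (hlim (c • a)) <|
        ((hlim a).const_mul c).congr fun k => (real_inner_smul_right _ _ _).symm }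
  let L' := L.mkContinuous M hB
  refine ⟨(InnerProductSpace.toDual ℝ H).symm L', ?_, fun z => ?_⟩
  · rw [LinearIsometryEquiv.norm_map]
    exact L.mkContinuous_norm_le hM hB
  · rw [InnerProductSpace.toDual_symm_apply]
    exact hlim z

lemma MemLp.locallyIntegrableOn {F : Type*} [NormedAddCommGroup F] {Ω : Set (Rn n)}
    (hΩ : IsOpen Ω) {f : Rn n → F} (hf : MemLp f 2 (volume.restrict Ω)) :
    LocallyIntegrableOn f Ω := by
  rw [locallyIntegrableOn_iff hΩ.isLocallyClosed]
  intro k hk hkc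
  have : IsFiniteMeasure (volume.restrict k) := ⟨by
    rw [Measure.restrict_apply_univ]; exact hkc.measure_lt_top⟩
  exact (hf.mono_measure (Measure.restrict_mono hk le_rfl)).integrable (by norm_num)

/-- Turns a Dirichlet integral into half a squared Hilbert space norm, to which the bound on weak
limits applies. -/
lemma lintegral_sq_div_two {α F : Type*} [MeasurableSpace α] {μ : Measure α}
    [NormedAddCommGroup F] [InnerProductSpace ℝ F] {G : α → F} (hG : MemLp G 2 μ) :
    ∫⁻ x, ENNReal.ofReal (‖G x‖ ^ 2 / 2) ∂μ = ENNReal.ofReal (‖hG.toLp G‖ ^ 2 / 2) := by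
  have h1 : Integrable (fun x => ‖G x‖ ^ 2) μ := hG.integrable_norm_pow two_ne_zero
  rw [← ofReal_integral_eq_lintegral_ofReal (h1.div_const 2) (.of_forall fun x => by positivity),
    integral_div, ← real_inner_self_eq_norm_sq, L2.inner_def]
  congr 2
  refine integral_congr_ae ?_
  filter_upwards [hG.coeFn_toLp] with x hx
  rw [hx, real_inner_self_eq_norm_sq]

lemma IsTest.memLp {Ω : Set (Rn n)} {F : Type*} [NormedAddCommGroup F] [NormedSpace ℝ F]
    {g : Rn n → F} (hg : IsTest Ω g) (p : ℝ≥0∞) (μ : Measure (Rn n))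
    [IsFiniteMeasureOnCompacts μ] : MemLp g p μ :=
  hg.contDiff.continuous.memLp_of_hasCompactSupport hg.hasCompactSupport

lemma MemH1.memLp_weakGradient {Ω : Set (Rn n)} (hΩ : IsOpen Ω) {v : Rn n → ℝ}
    (hv : MemH1 Ω v) : HasWeakGradient Ω v (weakGradient Ω v) ∧
      MemLp (weakGradient Ω v) 2 (volume.restrict Ω) := by
  obtain ⟨-, G, hG, hG2⟩ := hv
  exact ⟨hG.spec, hG2.ae_eq (hG.weakGradient_ae_eq hΩ).symm⟩

lemma isTest_smul_single {Ω : Set (Rn n)} {φ : Rn n → ℝ} (hφ : IsTest Ω φ) (i : Fin n) :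
    IsTest Ω fun x => φ x • (EuclideanSpace.single i 1 : Rn n) where
  contDiff := hφ.contDiff.smul contDiff_const
  hasCompactSupport := hφ.hasCompactSupport.smul_right
  tsupport_subset := (tsupport_smul_subset_left φ _).trans hφ.tsupport_subset

/-- Lower semicontinuity of the Dirichlet energy in `L²`. -/
theorem dirichletEnergy_le_of_frequently {Ω : Set (Rn n)} (hΩ : IsOpen Ω) {u : ℕ → Rn n → ℝ}
    {v : Rn n → ℝ} (hu : ∀ k, MemH1 Ω (u k)) (hv : MemLp v 2 (volume.restrict Ω))
    (hlim : Tendsto (fun k => eLpNorm (u k - v) 2 (volume.restrict Ω)) atTop (𝓝 0))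
    {c : ℝ≥0∞} (hc : c ≠ ⊤) (hfr : ∃ᶠ k in atTop, dirichletEnergy Ω (u k) ≤ c) :
    MemH1 Ω v ∧ dirichletEnergy Ω v ≤ c := by
  set μ := volume.restrict Ω
  have hG := fun k => ((hu k).memLp_weakGradient hΩ)
  let G : ℕ → Lp (Rn n) 2 μ := fun k => (hG k).2.toLp _
  have : NeBot (atTop ⊓ 𝓟 {k | dirichletEnergy Ω (u k) ≤ c}) := frequently_mem_iff_neBot.1 hfr
  -- The ultrafilter refines `atTop`, so the given $L^2$ convergence is inherited, and it
  -- concentrates on the indices where the energy is at most $c$.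
  let l := Ultrafilter.of (atTop ⊓ 𝓟 {k | dirichletEnergy Ω (u k) ≤ c})
  have hl : (l : Filter ℕ) ≤ atTop ⊓ 𝓟 {k | dirichletEnergy Ω (u k) ≤ c} := Ultrafilter.of_le _
  have hbd : ∀ᶠ k in (l : Filter ℕ), ‖G k‖ ≤ √(2 * c.toReal) := by
    have h1 : ∀ᶠ k in (l : Filter ℕ), dirichletEnergy Ω (u k) ≤ c :=
      (hl.trans inf_le_right) (mem_principal_self _)
    filter_upwards [h1] with k hk
    rw [dirichletEnergy, if_pos (hu k), lintegral_sq_div_two (hG k).2,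
      ENNReal.ofReal_le_iff_le_toReal hc] at hk
    exact Real.le_sqrt_of_sq_le (by simp only [G]; linarith)
  obtain ⟨Y, hY, hYlim⟩ := exists_weak_limit G l hbd
  have hYG : HasWeakGradient Ω v Y := by
    refine ⟨MemLp.locallyIntegrableOn hΩ hv, MemLp.locallyIntegrableOn hΩ (Lp.memLp Y), fun φ hφ i => ?_⟩
    have hT := isTest_smul_single hφ i
    have l1 := hYlim ((hT.memLp 2 μ).toLp _)
    have hin : ∀ (Z : Rn n → Rn n) (hZ : MemLp Z 2 μ),
        inner ℝ (hZ.toLp Z) ((hT.memLp 2 μ).toLp _) = ∫ x in Ω, Z x i * φ x := by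
      intro Z hZ
      rw [L2.inner_def]
      refine integral_congr_ae ?_
      filter_upwards [hZ.coeFn_toLp, (hT.memLp 2 μ).coeFn_toLp] with x hx1 hx2
      rw [hx1, hx2, real_inner_smul_right, EuclideanSpace.inner_single_right]
      simp [mul_comm]
    have hinY : inner ℝ Y ((hT.memLp 2 μ).toLp _) = ∫ x in Ω, Y x i * φ x := by
      rw [← hin _ (Lp.memLp Y), Lp.toLp_coeFn]
    rw [hinY] at l1
    have hφ2 := (hφ.pderiv i).memLp 2 μ
    have l2 : Tendsto (fun k => ∫ x in Ω, u k x * pderiv i φ x) atTop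
        (𝓝 (∫ x in Ω, v x * pderiv i φ x)) := by
      have h2 : Tendsto (fun k => (hu k).1.toLp (u k)) atTop (𝓝 (hv.toLp v)) :=
        (Lp.tendsto_Lp_iff_tendsto_eLpNorm'' _ (fun k => (hu k).1) _ hv).2 hlim
      have h3 : Tendsto (fun k => inner ℝ ((hu k).1.toLp (u k)) (hφ2.toLp _)) atTop
        (𝓝 (inner ℝ (hv.toLp v) (hφ2.toLp _))) := h2.inner tendsto_const_nhds
      have hin' : ∀ (w : Rn n → ℝ) (hw : MemLp w 2 μ),
          inner ℝ (hw.toLp w) (hφ2.toLp _) = ∫ x in Ω, w x * pderiv i φ x := by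
        intro w hw
        rw [L2.inner_def]
        refine integral_congr_ae ?_
        filter_upwards [hw.coeFn_toLp, hφ2.coeFn_toLp] with x hx1 hx2
        rw [hx1, hx2]; simp [mul_comm]
      simp_rw [hin'] at h3
      exact h3
    -- The same integrals also converge to what the weak limit $Y$ predicts, and uniqueness of
    -- limits identifies $Y$ as the weak gradient of $v$.
    have l3 : Tendsto (fun k => ∫ x in Ω, u k x * pderiv i φ x) l
        (𝓝 (-∫ x in Ω, Y x i * φ x)) := by
      refine l1.neg.congr fun k => ?_
      rw [(hG k).1.integral_eq φ hφ i, hin]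
    exact tendsto_nhds_unique (l2.mono_left (hl.trans inf_le_left)) l3
  have hH : MemH1 Ω v := ⟨hv, Y, hYG, Lp.memLp Y⟩
  refine ⟨hH, ?_⟩
  rw [dirichletEnergy, if_pos hH]
  have e1 : ∫⁻ x in Ω, ENNReal.ofReal (‖weakGradient Ω v x‖ ^ 2 / 2) =
      ∫⁻ x in Ω, ENNReal.ofReal (‖Y x‖ ^ 2 / 2) :=
    lintegral_congr_ae ((hYG.weakGradient_ae_eq hΩ).mono fun x hx => by simp only [hx])
  rw [e1, lintegral_sq_div_two (Lp.memLp Y), Lp.toLp_coeFn]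
  refine ENNReal.ofReal_le_of_le_toReal ?_
  have := (Real.le_sqrt (norm_nonneg _) (by positivity)).1 hY
  linarith

/-! ### The double-well potential -/

namespace IsDoubleWell

variable {W : ℝ → ℝ}


/-- The endpoint values vanish, so $W$ is the constant extension of its restriction to $[-1,1]$. -/
lemma continuous (hW : IsDoubleWell W) : Continuous W := by
  have h1 : W = IccExtend (show (-1 : ℝ) ≤ 1 by norm_num) (fun x : Icc (-1 : ℝ) 1 => W x) := by
    ext s
    rcases lt_or_ge s (-1) with h | h
    · rw [hW.eq_zero_outside s fun h' => absurd h'.1 (by linarith), IccExtend_of_le_left _ _ h.le,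
        hW.left_zero]
    rcases lt_or_ge 1 s with h' | h'
    · rw [hW.eq_zero_outside s fun h'' => absurd h''.2 (by linarith),
        IccExtend_of_right_le _ _ h'.le, hW.right_zero]
    · rw [IccExtend_of_mem _ _ ⟨h, h'⟩]
  rw [h1]
  exact (continuousOn_iff_continuous_domRestrict.1 hW.contDiffOn.continuousOn).Icc_extend'

lemma exists_bound (hW : IsDoubleWell W) : ∃ M, 0 ≤ M ∧ ∀ s, √(2 * W s) ≤ M := by
  have hc : Continuous fun s => √(2 * W s) := (continuous_const.mul hW.continuous).sqrt
  have hs : HasCompactSupport fun s => √(2 * W s) :=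
    HasCompactSupport.intro (K := Icc (-1 : ℝ) 1) isCompact_Icc fun s hs => by
      simp [hW.eq_zero_outside s hs]
  obtain ⟨M, hM⟩ := hs.exists_bound_of_continuous hc
  exact ⟨M, (norm_nonneg _).trans (hM 0), fun s => (le_abs_self _).trans (hM s)⟩

/-- $W$ increases strictly from $W(-1)=0$ up to the origin, so the integrand is positive at $0$.
Positivity is what makes a finite limit energy imply finite perimeter. -/
lemma c₀_pos (hW : IsDoubleWell W) : 0 < c₀ W := by
  refine intervalIntegral.integral_pos (by norm_num)
    (continuous_const.mul hW.continuous).sqrt.continuousOn (fun x _ => Real.sqrt_nonneg _)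
    ⟨0, by norm_num, ?_⟩
  have hmono : StrictMonoOn W (Icc (-1) 0) := by
    refine strictMonoOn_of_deriv_pos (convex_Icc _ _) hW.continuous.continuousOn fun x hx => ?_
    rw [interior_Icc] at hx
    have := hW.deriv_pos x hx
    rwa [derivWithin_of_mem_nhds (Icc_mem_nhds hx.1 (hx.2.trans one_pos))] at this
  have := hmono (left_mem_Icc.2 (by norm_num)) (right_mem_Icc.2 (by norm_num)) (by norm_num)
  rw [hW.left_zero] at this
  exact Real.sqrt_pos.2 (by linarith)

end IsDoubleWell

end ACKS

/-! ### The Modica–Mortola lower bound -/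

namespace ACKS

open ContinuousLinearMap Metric

variable {n : ℕ}

lemma IsTest.divergence_integrable {Ω : Set (Rn n)} {g : Rn n → Rn n} (hg : IsTest Ω g) :
    Integrable (divergence g) :=
  integrable_finsetSum _ fun i _ => ((isTest_apply hg i).pderiv i).integrable

lemma IsTest.divergence_continuous {Ω : Set (Rn n)} {g : Rn n → Rn n} (hg : IsTest Ω g) :
    Continuous (divergence g) :=
  continuous_finsetSum _ fun i _ => ((isTest_apply hg i).pderiv i).contDiff.continuous

lemma IsTest.divergence_bound {Ω : Set (Rn n)} {g : Rn n → Rn n} (hg : IsTest Ω g) :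
    ∃ M, ∀ x, |divergence g x| ≤ M := by
  have : HasCompactSupport (divergence g) := by
    refine HasCompactSupport.intro hg.hasCompactSupport.isCompact fun x hx => ?_
    refine Finset.sum_eq_zero fun i _ => image_eq_zero_of_notMem_tsupport fun h => hx ?_
    have hsub : Function.support (fun y => g y i) ⊆ Function.support g :=
      fun y hy h => hy (by simp [h])
    exact closure_mono hsub (tsupport_pderiv_subset i h)
  exact this.exists_bound_of_continuous hg.divergence_continuous

/-- The constant function one has zero gradient. -/
lemma setIntegral_divergence {Ω : Set (Rn n)} {g : Rn n → Rn n} (hg : IsTest Ω g) :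
    ∫ x in Ω, divergence g x = 0 := by
  have h := (hasWeakGradient_grad (f := fun _ : Rn n => (1 : ℝ)) contDiff_const
    Ω).integral_divergence hg
  have h0 : grad (fun _ : Rn n => (1 : ℝ)) = 0 := by
    ext x i; simp [grad, pderiv]
  simpa [h0] using h

lemma phase_of_mem {E : Set (Rn n)} {x : Rn n} (hx : x ∈ E) : phase E x = -1 := by
  simp [phase, hx]

lemma phase_of_notMem {E : Set (Rn n)} {x : Rn n} (hx : x ∉ E) : phase E x = 1 := by
  simp [phase, hx]

/-- A primitive of `√(2W)`. -/
noncomputable def wellPrimitive (W : ℝ → ℝ) (t : ℝ) : ℝ := ∫ s in (-1 : ℝ)..t, √(2 * W s)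

lemma IsDoubleWell.continuous_sqrt {W : ℝ → ℝ} (hW : IsDoubleWell W) :
    Continuous fun s => √(2 * W s) := (continuous_const.mul hW.continuous).sqrt

lemma IsDoubleWell.hasDerivAt_wellPrimitive {W : ℝ → ℝ} (hW : IsDoubleWell W) (t : ℝ) :
    HasDerivAt (wellPrimitive W) (√(2 * W t)) t :=
  hW.continuous_sqrt.integral_hasStrictDerivAt _ _ |>.hasDerivAt

/-- The interfacial part of the energy. -/
noncomputable def interfaceEnergy (W : ℝ → ℝ) (ε : ℝ) (Ω : Set (Rn n)) (𝓔 : Rn n → ℝ) : ℝ≥0∞ :=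
  ∫⁻ x in Ω, ENNReal.ofReal (ε * (‖weakGradient Ω 𝓔 x‖ ^ 2 / 2) + 1 / ε * W (𝓔 x))

lemma J_eq_add {W : ℝ → ℝ} (hW : IsDoubleWell W) {ε : ℝ} (hε : 0 < ε) {Ω : Set (Rn n)}
    (hΩ : IsOpen Ω) {v 𝓔 : Rn n → ℝ} (hv : MemH1 Ω v) :
    J W ε Ω v 𝓔 = dirichletEnergy Ω v + interfaceEnergy W ε Ω 𝓔 := by
  rw [J, dirichletEnergy, if_pos hv, interfaceEnergy, ← lintegral_add_left']
  · refine lintegral_congr fun x => ?_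
    have := hW.nonneg (𝓔 x)
    rw [← ENNReal.ofReal_add (by positivity) (by positivity), add_assoc]
  · exact (((hv.memLp_weakGradient hΩ).2.1.norm.aemeasurable.pow_const 2).div_const 2).ennreal_ofReal

/-- The Modica–Mortola inequality, tested with a vector field. -/
lemma ofReal_neg_integral_le_interfaceEnergy {W : ℝ → ℝ} (hW : IsDoubleWell W) {ε : ℝ}
    (hε : 0 < ε) {Ω : Set (Rn n)} (hΩ : IsOpen Ω) {𝓔 : Rn n → ℝ} (h𝓔 : MemH1 Ω 𝓔)
    {g : Rn n → Rn n} (hg : IsTest Ω g) (hg1 : ∀ x, ‖g x‖ ≤ 1) :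
    ENNReal.ofReal (-∫ x in Ω, wellPrimitive W (𝓔 x) * divergence g x) ≤
      interfaceEnergy W ε Ω 𝓔 := by
  obtain ⟨hG, -⟩ := h𝓔.memLp_weakGradient hΩ
  obtain ⟨M, -, hM⟩ := hW.exists_bound
  have hc := hG.comp hΩ hW.hasDerivAt_wellPrimitive hW.continuous_sqrt (C := M)
    fun s => by rw [abs_of_nonneg (Real.sqrt_nonneg _)]; exact hM s
  rw [hc.integral_divergence hg, neg_neg]
  refine (ENNReal.ofReal_le_ofReal (le_abs_self _)).trans ?_
  rw [← Real.norm_eq_abs, ofReal_norm]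
  refine (enorm_integral_le_lintegral_enorm _).trans (lintegral_mono fun x => ?_)
  rw [← ofReal_norm]
  refine ENNReal.ofReal_le_ofReal ?_
  have hWx := hW.nonneg (𝓔 x)
  set a := √(2 * W (𝓔 x))
  set b := ‖weakGradient Ω 𝓔 x‖
  have ha : a ^ 2 = 2 * W (𝓔 x) := Real.sq_sqrt (by positivity)
  have h1 : ‖inner ℝ (a • weakGradient Ω 𝓔 x) (g x)‖ ≤ a * b := by
    refine (norm_inner_le_norm _ _).trans ?_
    rw [norm_smul, Real.norm_of_nonneg (Real.sqrt_nonneg _)]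
    exact mul_le_of_le_one_right (by positivity) (hg1 x)
  -- Completing the square: equality would mean $\epsilon|\nabla\mathcal E|=\sqrt{2W(\mathcal E)}$,
  -- the equipartition that the recovery profile imitates.
  have h2 : ε * (b ^ 2 / 2) + 1 / ε * W (𝓔 x) - a * b = (ε * b - a) ^ 2 / (2 * ε) := by
    rw [show W (𝓔 x) = a ^ 2 / 2 by linarith]; field_simp; ring
  have h3 : 0 ≤ (ε * b - a) ^ 2 / (2 * ε) := by positivity
  linarith

/-- Lower semicontinuity of the interfacial energy. -/
lemma perimeter_le_liminf_interfaceEnergy {W : ℝ → ℝ} (hW : IsDoubleWell W) {Ω : Set (Rn n)}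
    (hΩ : IsOpen Ω) {ε : ℕ → ℝ} (hε : ∀ k, 0 < ε k) {𝓔 : ℕ → Rn n → ℝ}
    (h𝓔 : ∀ k, MemH1 Ω (𝓔 k)) {E : Set (Rn n)} (hE : NullMeasurableSet E) (hEΩ : E ⊆ Ω)
    (hlim : Tendsto (fun k => eLpNorm (𝓔 k - phase E) 1 (volume.restrict Ω)) atTop (𝓝 0)) :
    ENNReal.ofReal (c₀ W) * perimeter Ω E ≤
      liminf (fun k => interfaceEnergy W (ε k) Ω (𝓔 k)) atTop := by
  rw [perimeter]
  simp_rw [ENNReal.mul_iSup]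
  refine iSup₂_le fun g hg => ?_
  obtain ⟨hg, hg1⟩ := hg
  rw [← ENNReal.ofReal_mul hW.c₀_pos.le]
  obtain ⟨M, hM0, hM⟩ := hW.exists_bound
  obtain ⟨M', hM'⟩ := hg.divergence_bound
  have hLip := abs_sub_le_of_hasDerivAt hW.hasDerivAt_wellPrimitive (C := M)
    fun s => by rw [abs_of_nonneg (Real.sqrt_nonneg _)]; exact hM s
  have hcont : Continuous (wellPrimitive W) :=
    continuous_iff_continuousAt.2 fun s => (hW.hasDerivAt_wellPrimitive s).continuousAt
  have hphase : AEStronglyMeasurable (phase E) volume :=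
    (aestronglyMeasurable_const.indicator₀ hE.compl).sub (aestronglyMeasurable_const.indicator₀ hE)
  -- The primitive is $0$ at $-1$ and $c_0$ at $1$, so the integrand is
  -- $c_0(1-\chi_E)\operatorname{div}g$, and the constant part integrates to zero.
  have e1 : ∫ x in Ω, divergence g x * wellPrimitive W (phase E x) =
      -(c₀ W * ∫ x in E, divergence g x) := by
    have h1 : ∀ x, divergence g x * wellPrimitive W (phase E x) =
        c₀ W * divergence g x - c₀ W * E.indicator (divergence g) x := by
      intro x
      by_cases hx : x ∈ E
      · rw [phase_of_mem hx, indicator_of_mem hx, wellPrimitive]; simp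
      · rw [phase_of_notMem hx, indicator_of_notMem hx, wellPrimitive, ← c₀]; ring
    simp_rw [h1]
    rw [integral_sub, integral_const_mul, integral_const_mul, setIntegral_divergence hg,
      integral_indicator₀ (hE.mono_ac Measure.restrict_le_self.absolutelyContinuous),
      Measure.restrict_restrict₀ (hE.mono_ac Measure.restrict_le_self.absolutelyContinuous),
      inter_eq_left.2 hEΩ]
    · ring
    · exact (hg.divergence_integrable.integrableOn).const_mul _
    · exact ((hg.divergence_integrable.indicator₀ hE).integrableOn).const_mul _
  have hint : ∀ k, Integrable (fun x => divergence g x * wellPrimitive W (𝓔 k x))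
      (volume.restrict Ω) := by
    intro k
    obtain ⟨hG, -⟩ := (h𝓔 k).memLp_weakGradient hΩ
    have hc := hG.comp hΩ hW.hasDerivAt_wellPrimitive hW.continuous_sqrt (C := M)
      fun s => by rw [abs_of_nonneg (Real.sqrt_nonneg _)]; exact hM s
    simp_rw [mul_comm (divergence g _), divergence, Finset.mul_sum]
    refine integrable_finsetSum _ fun i _ => ?_
    have ht := (isTest_apply hg i).pderiv i
    exact (integrable_mul_of_tsupport_subset hc.locallyIntegrable
      ht.contDiff.continuous ht.hasCompactSupport ht.tsupport_subset).integrableOn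
  have hl : Tendsto (fun k => ∫ x in Ω, divergence g x * wellPrimitive W (𝓔 k x)) atTop
      (𝓝 (-(c₀ W * ∫ x in E, divergence g x))) := by
    rw [← e1]
    refine tendsto_integral_of_L1 _ ?_ (.of_forall hint) ?_
    · exact (hg.divergence_continuous.aestronglyMeasurable.mul
        (hcont.comp_aestronglyMeasurable hphase)).restrict
    · simp_rw [← mul_sub]
      -- The primitive is Lipschitz with constant $M$, so $L^1$ convergence of the phase fields
      -- passes to their compositions with it.
      refine tendsto_lintegral_mul_of_bounded (fun _ => hM') ?_
      simp_rw [eLpNorm_one_eq_lintegral_enorm] at hlim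
      have h2 := tendsto_lintegral_mul_of_bounded (g := fun _ _ => M)
        (fun _ _ => (abs_of_nonneg hM0).le) hlim
      refine tendsto_of_tendsto_of_tendsto_of_le_of_le tendsto_const_nhds h2
        (fun _ => zero_le) fun k => lintegral_mono fun x => ?_
      rw [← ofReal_norm, ← ofReal_norm, norm_mul, Real.norm_of_nonneg hM0]
      exact ENNReal.ofReal_le_ofReal (hLip _ _)
  have hl2 := (ENNReal.continuous_ofReal.tendsto _).comp hl.neg
  rw [neg_neg] at hl2
  rw [← hl2.liminf_eq]
  refine liminf_le_liminf (.of_forall fun k => ?_)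
  have := ofReal_neg_integral_le_interfaceEnergy hW (hε k) hΩ (h𝓔 k) hg hg1
  simpa only [Function.comp_apply, mul_comm (divergence g _)] using this

lemma perimeter_mono {U Ω E : Set (Rn n)} (h : U ⊆ Ω) : perimeter U E ≤ perimeter Ω E :=
  iSup₂_le fun g hg => le_iSup₂_of_le (f := fun (g : Rn n → Rn n)
    (_ : IsTest Ω g ∧ ∀ x, ‖g x‖ ≤ 1) => ENNReal.ofReal (∫ x in E, divergence g x)) g
    ⟨⟨hg.1.contDiff, hg.1.hasCompactSupport, hg.1.tsupport_subset.trans h⟩, hg.2⟩ le_rfl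

lemma liminf_add_liminf_le (u w : ℕ → ℝ≥0∞) :
    liminf u atTop + liminf w atTop ≤ liminf (fun k => u k + w k) atTop := by
  simp_rw [liminf_eq_iSup_iInf_of_nat]
  rw [ENNReal.iSup_add_iSup_of_monotone]
  · exact iSup_mono fun i => le_iInf₂ fun j hj => add_le_add (iInf₂_le j hj) (iInf₂_le j hj)
  · exact fun i j hij => le_iInf₂ fun l hl => iInf₂_le l (hij.trans hl)
  · exact fun i j hij => le_iInf₂ fun l hl => iInf₂_le l (hij.trans hl)

/-- Lower semicontinuity of the energies, and admissibility of limits of bounded energy. -/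
theorem lowerSemicontinuity {W : ℝ → ℝ} (hW : IsDoubleWell W) {Ω : Set (Rn n)} (hΩ : IsOpen Ω)
    {ε : ℕ → ℝ} {v𝓔 : ℕ → (Rn n → ℝ) × (Rn n → ℝ)} {v : Rn n → ℝ} {E : Set (Rn n)}
    (hε : ∀ k, 0 < ε k) (hadm : ∀ k, Admissible Ω (v𝓔 k).1 (v𝓔 k).2)
    (hv : MemLp v 2 (volume.restrict Ω)) (hE : NullMeasurableSet E) (hEΩ : E ⊆ Ω)
    (hconv : ConvergesTo Ω v𝓔 v E) :
    I W Ω v E ≤ liminf (fun k => J W (ε k) Ω (v𝓔 k).1 (v𝓔 k).2) atTop ∧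
      (liminf (fun k => J W (ε k) Ω (v𝓔 k).1 (v𝓔 k).2) atTop < ⊤ → Admissible₀ Ω v E) := by
  obtain ⟨hc1, hc2⟩ := hconv
  have hJ : ∀ k, J W (ε k) Ω (v𝓔 k).1 (v𝓔 k).2 =
      dirichletEnergy Ω (v𝓔 k).1 + interfaceEnergy W (ε k) Ω (v𝓔 k).2 := fun k =>
    J_eq_add hW (hε k) hΩ (hadm k).memH1_left
  simp_rw [hJ]
  have hP := perimeter_le_liminf_interfaceEnergy hW hΩ hε (fun k => (hadm k).memH1_right) hE hEΩ hc2
  -- Any finite $c$ above the liminf bounds the energy for infinitely many indices, which is the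
  -- form of hypothesis that the Hilbert space argument uses.
  have hD' : ∀ c, liminf (fun k => dirichletEnergy Ω (v𝓔 k).1) atTop < c → c ≠ ⊤ →
      MemH1 Ω v ∧ dirichletEnergy Ω v ≤ c := fun c hc hct =>
    dirichletEnergy_le_of_frequently hΩ (fun k => (hadm k).memH1_left) hv hc1 hct
      ((frequently_lt_of_liminf_lt (by isBoundedDefault) hc).mono fun _ h => h.le)
  have hD : dirichletEnergy Ω v ≤ liminf (fun k => dirichletEnergy Ω (v𝓔 k).1) atTop := by
    refine le_of_forall_gt fun c hc => ?_
    obtain ⟨c', h1, h2⟩ := exists_between hc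
    exact (hD' c' h1 (h2.trans_le le_top).ne).2.trans_lt h2
  have hsum := le_trans (add_le_add hD hP) (liminf_add_liminf_le _ _)
  refine ⟨hsum, fun hfin => ?_⟩
  have hI : I W Ω v E < ⊤ := hsum.trans_lt hfin
  have hH : MemH1 Ω v := by
    by_contra h
    simp [I, dirichletEnergy, h] at hI
  have hper : perimeter Ω E < ⊤ := by
    have h1 : ENNReal.ofReal (c₀ W) * perimeter Ω E < ⊤ := (le_add_self).trans_lt hI
    rw [lt_top_iff_ne_top]
    intro h
    rw [h, ENNReal.mul_top (by simpa using hW.c₀_pos)] at h1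
    exact lt_irrefl _ h1
  have hphase : AEStronglyMeasurable (phase E) (volume.restrict Ω) :=
    ((aestronglyMeasurable_const.indicator₀ hE.compl).sub
      (aestronglyMeasurable_const.indicator₀ hE)).restrict
  -- The two convergences hold in different spaces, so a subsequence is taken for $v_k$ and then a
  -- further one for $\mathcal E_k$; along the latter both hold almost everywhere.
  obtain ⟨ns, hns, hns'⟩ := (tendstoInMeasure_of_tendsto_eLpNorm two_ne_zero
    (fun k => (hadm k).memH1_left.1.1) hv.1 hc1).exists_seq_tendsto_ae
  obtain ⟨ms, hms, hms'⟩ := (tendstoInMeasure_of_tendsto_eLpNorm one_ne_zero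
    (fun k => (hadm (ns k)).memH1_right.1.1) hphase
    (hc2.comp hns.tendsto_atTop)).exists_seq_tendsto_ae
  have hnn := ae_all_iff.2 fun k => (hadm k).nonneg
  have hone := ae_all_iff.2 fun k => (hadm k).eq_one
  refine ⟨hH, ⟨hEΩ, hE, fun U _ _ hU =>
    (perimeter_mono (subset_closure.trans hU)).trans_lt hper⟩, ?_, ?_⟩
  · filter_upwards [hns', hnn] with x h1 h2
    exact ge_of_tendsto h1 (.of_forall fun k => h2 _)
  · filter_upwards [hns', hms', hnn, hone] with x h1 h2 h3 h4 hx
    rw [phase_of_mem hx] at h2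
    -- On $E$ the phases tend to $-1$, hence are eventually below $1$, and a positive $v_k$ would
    -- force the phase to equal $1$.
    have h5 : ∀ᶠ k in atTop, (v𝓔 (ns (ms k))).1 x = 0 := by
      filter_upwards [h2.eventually (gt_mem_nhds (show (-1 : ℝ) < 1 by norm_num))] with k hk
      by_contra hne
      exact hk.ne (h4 _ (lt_of_le_of_ne (h3 _) (Ne.symm hne)))
    exact tendsto_nhds_unique (h1.comp hms.tendsto_atTop)
      (tendsto_const_nhds.congr' (h5.mono fun _ h => h.symm))

end ACKS

/-! ### Almost optimal one-dimensional profiles -/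

namespace ACKS

/-- The hat function of mass one on each side of the origin. -/
noncomputable def hat (x : ℝ) : ℝ := 2 * max 0 (1 - |x|)

/-- The primitive of the hat function: a `C¹` transition from `-1` to `1`. -/
noncomputable def hatPrimitive (t : ℝ) : ℝ := ∫ x in (0 : ℝ)..t, hat x

lemma continuous_hat : Continuous hat := by unfold hat; fun_prop

lemma hat_nonneg (x : ℝ) : 0 ≤ hat x := by unfold hat; positivity

lemma hat_le_two (x : ℝ) : hat x ≤ 2 := by
  have : max 0 (1 - |x|) ≤ 1 := max_le zero_le_one (by linarith [abs_nonneg x])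
  unfold hat; linarith

lemma hat_eq_zero {x : ℝ} (hx : 1 ≤ |x|) : hat x = 0 := by
  rw [hat, max_eq_left (by linarith), mul_zero]

lemma hasDerivAt_hatPrimitive (t : ℝ) : HasDerivAt hatPrimitive (hat t) t :=
  (continuous_hat.integral_hasStrictDerivAt _ _).hasDerivAt

lemma continuous_hatPrimitive : Continuous hatPrimitive :=
  continuous_iff_continuousAt.2 fun t => (hasDerivAt_hatPrimitive t).continuousAt

lemma monotone_hatPrimitive : Monotone hatPrimitive :=
  monotone_of_hasDerivAt_nonneg hasDerivAt_hatPrimitive fun t => hat_nonneg t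

lemma hatPrimitive_neg (t : ℝ) : hatPrimitive (-t) = -hatPrimitive t := by
  have h := intervalIntegral.integral_comp_neg (a := 0) (b := t) hat
  have h2 : ∀ x, hat (-x) = hat x := fun x => by simp [hat]
  simp_rw [h2, neg_zero] at h
  rw [hatPrimitive, hatPrimitive, h, intervalIntegral.integral_symm]

lemma hatPrimitive_one : hatPrimitive 1 = 1 := by
  have : hatPrimitive 1 = ∫ x in (0 : ℝ)..1, (2 - 2 * x) := by
    refine intervalIntegral.integral_congr fun x hx => ?_
    rw [uIcc_of_le zero_le_one] at hx
    simp only [hat]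
    rw [abs_of_nonneg hx.1, max_eq_right (by linarith [hx.2])]
    ring
  rw [this, intervalIntegral.integral_sub (by simp) (by
    apply Continuous.intervalIntegrable; fun_prop), intervalIntegral.integral_const_mul, integral_id]
  norm_num

lemma hatPrimitive_of_one_le {t : ℝ} (ht : 1 ≤ t) : hatPrimitive t = 1 := by
  have h := intervalIntegral.integral_add_adjacent_intervals (a := 0) (b := 1) (c := t)
    (continuous_hat.intervalIntegrable (μ := volume) _ _) (continuous_hat.intervalIntegrable _ _)
  have h0 : ∫ x in (1 : ℝ)..t, hat x = 0 := by
    rw [intervalIntegral.integral_congr (g := fun _ => (0 : ℝ))]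
    · simp
    · intro x hx
      rw [uIcc_of_le ht] at hx
      exact hat_eq_zero (hx.1.trans (le_abs_self x))
  rw [hatPrimitive, ← h, h0, add_zero]
  exact hatPrimitive_one

lemma hatPrimitive_of_le_neg_one {t : ℝ} (ht : t ≤ -1) : hatPrimitive t = -1 := by
  rw [← neg_neg t, hatPrimitive_neg, hatPrimitive_of_one_le (by linarith)]

lemma abs_hatPrimitive_le (t : ℝ) : |hatPrimitive t| ≤ 1 := by
  rw [abs_le]
  constructor
  · rcases le_total t (-1) with h | h
    · rw [hatPrimitive_of_le_neg_one h]
    · rw [← hatPrimitive_of_le_neg_one le_rfl]; exact monotone_hatPrimitive h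
  · rcases le_total 1 t with h | h
    · rw [hatPrimitive_of_one_le h]
    · exact (monotone_hatPrimitive h).trans hatPrimitive_one.le

/-- The flow of a continuous speed bounded above and below, as the inverse of a primitive. -/
lemma exists_flow {g : ℝ → ℝ} (hg : Continuous g) {σ B : ℝ} (hσ : 0 < σ) (hl : ∀ x, σ ≤ g x)
    (hu : ∀ x, g x ≤ B) : ∃ θ ψ : ℝ → ℝ, (∀ s, HasDerivAt θ (g (θ s)) s) ∧ Monotone θ ∧
      ∀ x, θ (ψ x) = x := by
  have hB : 0 < B := hσ.trans_le ((hl 0).trans (hu 0))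
  have hg0 : ∀ x, 0 < g x := fun x => hσ.trans_le (hl x)
  have hgi : Continuous fun x => (g x)⁻¹ := hg.inv₀ fun x => (hg0 x).ne'
  let ψ : ℝ → ℝ := fun t => ∫ x in (0 : ℝ)..t, (g x)⁻¹
  have hψ : ∀ t, HasDerivAt ψ (g t)⁻¹ t := fun t =>
    (hgi.integral_hasStrictDerivAt _ _).hasDerivAt
  have hmono : StrictMono ψ := strictMono_of_hasDerivAt_pos hψ fun t => inv_pos.2 (hg0 t)
  have hcont : Continuous ψ := continuous_iff_continuousAt.2 fun t => (hψ t).continuousAt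
  -- From $1/g\ge1/B$ the primitive grows at least linearly, so it is onto and its inverse is
  -- defined on the whole line.
  have hlin : Monotone fun t => ψ t - B⁻¹ * t := by
    refine monotone_of_hasDerivAt_nonneg (f' := fun t => (g t)⁻¹ - B⁻¹ * 1) (fun t =>
      (hψ t).sub ((hasDerivAt_id t).const_mul _)) fun t => ?_
    have := inv_anti₀ (hg0 t) (hu t)
    simp only [Pi.zero_apply]
    linarith
  have hψ0 : ψ 0 = 0 := intervalIntegral.integral_same
  have hsurj : Function.Surjective ψ := by
    refine hcont.surjective ?_ ?_
    · refine tendsto_atTop_mono' _ ?_ ((tendsto_const_mul_atTop_of_pos (inv_pos.2 hB)).2 tendsto_id)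
      filter_upwards [eventually_ge_atTop 0] with t ht
      have := hlin ht
      simp only [hψ0] at this
      simp only [id]; linarith
    · refine tendsto_atBot_mono' _ ?_ ((tendsto_const_mul_atBot_of_pos (inv_pos.2 hB)).2 tendsto_id)
      filter_upwards [eventually_le_atBot 0] with t ht
      have := hlin ht
      simp only [hψ0] at this
      simp only [id]; linarith
  let e := hmono.orderIsoOfSurjective ψ hsurj
  have he : ∀ s, ψ (e.symm s) = s := fun s => e.apply_symm_apply s
  refine ⟨e.symm, ψ, fun s => ?_, e.symm.monotone, fun x => e.symm_apply_apply x⟩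
  have := HasDerivAt.of_local_left_inverse (f := ψ) (g := e.symm) (a := s)
    e.symm.continuous.continuousAt (hψ _) (inv_pos.2 (hg0 _)).ne' (.of_forall he)
  rwa [inv_inv] at this

/-- Almost optimal transition profiles. -/
theorem exists_profile {W : ℝ → ℝ} (hW : IsDoubleWell W) {τ : ℝ} (hτ : 0 < τ) :
    ∃ (Q Q' : ℝ → ℝ) (L : ℝ), 0 < L ∧ (∀ s, HasDerivAt Q (Q' s) s) ∧ Continuous Q' ∧
      (∀ s, |Q s| ≤ 1) ∧ (∀ s, s ≤ -L → Q s = -1) ∧ (∀ s, L ≤ s → Q s = 1) ∧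
      (∀ s, L ≤ |s| → Q' s = 0) ∧ ∫ s, (Q' s ^ 2 / 2 + W (Q s)) ≤ c₀ W + τ := by
  obtain ⟨M, hM0, hM⟩ := hW.exists_bound
  -- Write $h$ for the hat function and $H$ for its primitive. The profile is $Q=H\circ\theta$ with
  -- $\theta'=g(\theta)$; since $h$ vanishes at $\pm1$, it joins the constants $\pm1$ in a $C^1$
  -- way.
  set r : ℝ → ℝ := fun t => √(2 * W (hatPrimitive t))
  have hr : Continuous r := hW.continuous_sqrt.comp continuous_hatPrimitive
  have hr0 : ∀ t, 0 ≤ r t := fun t => Real.sqrt_nonneg _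
  have hr2 : ∀ t, W (hatPrimitive t) = r t ^ 2 / 2 := fun t => by
    have := hW.nonneg (hatPrimitive t)
    simp only [r]; rw [Real.sq_sqrt (by positivity)]; ring
  -- The excess of the energy density is at most $\sigma(2+M/2)$, over an interval of length two.
  set σ := τ / (4 + M)
  have hσ : 0 < σ := by positivity
  -- The ideal speed $r/h$ would give $Q'=\sqrt{2W(Q)}$ exactly. The two added $\sigma$ keep the
  -- speed bounded above and away from zero, so the transition takes finite time.
  set g : ℝ → ℝ := fun t => r t / (hat t + σ) + σ
  have hk : ∀ t, 0 < hat t + σ := fun t => add_pos_of_nonneg_of_pos (hat_nonneg t) hσ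
  have hg : Continuous g := (hr.div (continuous_hat.add continuous_const)
    fun t => (hk t).ne').add continuous_const
  have hgl : ∀ t, σ ≤ g t := fun t => le_add_of_nonneg_left (div_nonneg (hr0 t) (hk t).le)
  have hgu : ∀ t, g t ≤ M / σ + σ := fun t => by
    simp only [g]
    gcongr
    · exact hM _
    · linarith [hat_nonneg t]
  obtain ⟨θ, ψ, hθ, hmono, hψ⟩ := exists_flow hg hσ hgl hgu
  have hθc : Continuous θ := continuous_iff_continuousAt.2 fun t => (hθ t).continuousAt
  have hψmono : ψ (-1) < ψ 1 := hmono.reflect_lt (by rw [hψ, hψ]; norm_num)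
  have hge : ∀ s, ψ 1 ≤ s → 1 ≤ θ s := fun s hs => by simpa [hψ] using hmono hs
  have hle : ∀ s, s ≤ ψ (-1) → θ s ≤ -1 := fun s hs => by simpa [hψ] using hmono hs
  set L := max 1 (max (ψ 1) (-ψ (-1)))
  have hL1 : ψ 1 ≤ L := (le_max_left _ _).trans (le_max_right _ _)
  have hL2 : -ψ (-1) ≤ L := (le_max_right _ _).trans (le_max_right _ _)
  set Q' : ℝ → ℝ := fun s => hat (θ s) * g (θ s)
  have hQ' : ∀ s, (s ≤ ψ (-1) ∨ ψ 1 ≤ s) → Q' s = 0 := by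
    rintro s (h | h)
    · have := hle s h
      simp [Q', hat_eq_zero (x := θ s) (by rw [abs_of_nonpos (by linarith)]; linarith)]
    · have := hge s h
      simp [Q', hat_eq_zero (x := θ s) (by rw [abs_of_nonneg (by linarith)]; linarith)]
  have hQ'c : Continuous Q' := (continuous_hat.comp hθc).mul (hg.comp hθc)
  refine ⟨fun s => hatPrimitive (θ s), Q', L, by positivity, fun s => ?_, hQ'c,
    fun s => abs_hatPrimitive_le _, fun s hs => hatPrimitive_of_le_neg_one (hle s (by linarith)),
    fun s hs => hatPrimitive_of_one_le (hge s (by linarith)), fun s hs => ?_, ?_⟩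
  · exact (hasDerivAt_hatPrimitive (θ s)).comp s (hθ s)
  · rcases le_abs.1 hs with h | h
    · exact hQ' s (.inr (by linarith))
    · exact hQ' s (.inl (by linarith))
  -- The energy density after the substitution $t=\theta(s)$, $dt=g\,ds$. At the ideal speed it
  -- would be $hr$, whose integral is $c_0$.
  set G : ℝ → ℝ := fun t => hat t ^ 2 * g t / 2 + W (hatPrimitive t) / g t
  have hg0 : ∀ t, 0 < g t := fun t => hσ.trans_le (hgl t)
  have hGc : Continuous G := (((continuous_hat.pow 2).mul hg).div_const 2).add
    ((hW.continuous.comp continuous_hatPrimitive).div hg fun t => (hg0 t).ne')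
  have hF : ∀ s, Q' s ^ 2 / 2 + W (hatPrimitive (θ s)) = (G ∘ θ) s * g (θ s) := by
    intro s
    have := (hg0 (θ s)).ne'
    simp only [Q', G, Function.comp_apply]
    field_simp
  have hGle : ∀ t, G t ≤ hat t * r t + σ * (2 + M / 2) := by
    intro t
    have h1 : r t / (hat t + σ) * (hat t + σ) = r t := div_mul_cancel₀ _ (hk t).ne'
    set q := r t / (hat t + σ)
    have hq : 0 ≤ q := div_nonneg (hr0 t) (hk t).le
    have h2 := hat_nonneg t
    have h3 := hat_le_two t
    have h4 : W (hatPrimitive t) / g t ≤ r t * (hat t + σ) / 2 := by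
      rw [div_le_iff₀ (hg0 t), hr2]
      have : r t * (hat t + σ) / 2 * g t = r t * (q * (hat t + σ)) / 2 + r t * (hat t + σ) / 2 * σ := by
        simp only [g, q]; ring
      rw [this, h1]
      have := hr0 t
      have := hk t
      nlinarith [mul_nonneg (mul_nonneg this.le (hr0 t)) hσ.le]
    have h5 : hat t ^ 2 * g t / 2 ≤ hat t * r t / 2 + 2 * σ := by
      have e : hat t ^ 2 * g t / 2 = hat t * (hat t * q) / 2 + hat t ^ 2 * σ / 2 := by
        simp only [g, q]; ring
      have e2 : hat t * q ≤ r t := by nlinarith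
      have e3 : hat t ^ 2 ≤ 4 := by nlinarith
      rw [e]
      nlinarith [mul_le_mul_of_nonneg_left e2 h2, mul_le_mul_of_nonneg_right e3 hσ.le]
    have h6 : r t ≤ M := hM _
    simp only [G]
    nlinarith [mul_le_mul_of_nonneg_right h6 hσ.le]
  have hsupp : Function.support (fun s => Q' s ^ 2 / 2 + W (hatPrimitive (θ s))) ⊆
      Ioc (ψ (-1)) (ψ 1) := by
    intro s hs
    by_contra h
    refine hs ?_
    rw [mem_Ioc, not_and_or, not_lt, not_le] at h
    have h' : s ≤ ψ (-1) ∨ ψ 1 ≤ s := h.imp_right le_of_lt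
    have hz : W (hatPrimitive (θ s)) = 0 := by
      rcases h' with h | h
      · rw [hatPrimitive_of_le_neg_one (hle s h), hW.left_zero]
      · rw [hatPrimitive_of_one_le (hge s h), hW.right_zero]
    simp [hQ' s h', hz]
  rw [← intervalIntegral.integral_eq_integral_of_support_subset hsupp]
  simp_rw [hF]
  rw [intervalIntegral.integral_comp_mul_deriv (fun s _ => hθ s) (hg.comp hθc).continuousOn hGc,
    hψ, hψ]
  have hc0 : ∫ t in (-1 : ℝ)..1, hat t * r t = c₀ W := by
    have := intervalIntegral.integral_comp_mul_deriv (a := -1) (b := 1)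
      (fun s _ => hasDerivAt_hatPrimitive s) continuous_hat.continuousOn hW.continuous_sqrt
    rw [hatPrimitive_one, hatPrimitive_of_le_neg_one le_rfl] at this
    rw [c₀, ← this]
    simp only [Function.comp_apply, mul_comm (hat _)]
    rfl
  calc ∫ t in (-1 : ℝ)..1, G t ≤ ∫ t in (-1 : ℝ)..1, (hat t * r t + σ * (2 + M / 2)) :=
        intervalIntegral.integral_mono_on (by norm_num) (hGc.intervalIntegrable _ _)
          (((continuous_hat.mul hr).add continuous_const).intervalIntegrable _ _)
          fun t _ => hGle t
    _ = c₀ W + τ := by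
        have hi : Continuous fun t => hat t * r t := continuous_hat.mul hr
        rw [intervalIntegral.integral_add (hi.intervalIntegrable _ _) (by simp), hc0, intervalIntegral.integral_const, smul_eq_mul]
        simp only [σ]
        field_simp
        ring

end ACKS

/-! ### Cutoffs and total variation by duality -/

namespace ACKS

open Metric
open scoped Manifold

variable {n : ℕ}

lemma exists_cutoff {K Ω : Set (Rn n)} (hK : IsCompact K) (hΩ : IsOpen Ω) (hKΩ : K ⊆ Ω) :
    ∃ ψ : Rn n → ℝ, IsTest Ω ψ ∧ (∀ x, 0 ≤ ψ x ∧ ψ x ≤ 1) ∧ ∀ x ∈ K, ψ x = 1 := by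
  obtain ⟨δ, hδ, hδΩ⟩ := hK.exists_cthickening_subset_open hΩ hKΩ
  obtain ⟨f, hf, hr, hs, h1⟩ := exists_contMDiff_support_eq_eq_one_iff 𝓘(ℝ, Rn n) (n := (⊤ : ℕ∞))
    (isOpen_thickening (δ := δ) (E := K)) hK.isClosed (self_subset_thickening hδ K)
  have hsub : Function.support f ⊆ cthickening δ K := hs.subset.trans (thickening_subset_cthickening _ _)
  exact ⟨f, ⟨hf.contDiff, HasCompactSupport.of_support_subset_isCompact hK.cthickening hsub,
    (closure_minimal hsub isClosed_cthickening).trans hδΩ⟩, fun x => hr (mem_range_self x),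
    fun x hx => (h1 x).1 hx⟩

lemma contDiff_grad {u : Rn n → ℝ} (hu : ContDiff ℝ ∞ u) : ContDiff ℝ ∞ (grad u) :=
  (contDiff_piLp 2).2 fun _ => (hu.fderiv_right (m := ∞) (by simp)).clm_apply contDiff_const

lemma hasCompactSupport_grad {u : Rn n → ℝ} (hu : HasCompactSupport u) :
    HasCompactSupport (grad u) :=
  HasCompactSupport.intro hu.isCompact fun x hx => by
    ext i
    change pderiv i u x = 0
    exact image_eq_zero_of_notMem_tsupport fun h => hx (tsupport_pderiv_subset i h)

/-- The regularised modulus of the gradient. -/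
noncomputable def regNorm (η : ℝ) (u : Rn n → ℝ) (x : Rn n) : ℝ := √(‖grad u x‖ ^ 2 + η ^ 2)

section regNorm

variable {η : ℝ} {u : Rn n → ℝ}

lemma contDiff_regNorm (hη : 0 < η) (hu : ContDiff ℝ ∞ u) : ContDiff ℝ ∞ (regNorm η u) :=
  (((contDiff_grad hu).norm_sq ℝ).add contDiff_const).sqrt fun x => by positivity

lemma le_regNorm (x : Rn n) : η ≤ regNorm η u x :=
  Real.le_sqrt_of_sq_le (le_add_of_nonneg_left (by positivity))

lemma regNorm_pos (hη : 0 < η) (x : Rn n) : 0 < regNorm η u x := hη.trans_le (le_regNorm x)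

lemma norm_grad_le_regNorm (x : Rn n) : ‖grad u x‖ ≤ regNorm η u x :=
  Real.le_sqrt_of_sq_le (le_add_of_nonneg_right (by positivity))

lemma regNorm_le (hη : 0 < η) (x : Rn n) : regNorm η u x ≤ ‖grad u x‖ + η := by
  refine Real.sqrt_le_iff.2 ⟨by positivity, ?_⟩
  nlinarith [norm_nonneg (grad u x)]

end regNorm

/-- The total variation of a smooth function is controlled by duality. -/
lemma setIntegral_norm_grad_le {Ω : Set (Rn n)} (hΩ : IsOpen Ω) (hvol : volume Ω ≠ ⊤)
    {u : Rn n → ℝ} (hu : ContDiff ℝ ∞ u) (huc : HasCompactSupport u) {B : ℝ}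
    (hB : ∀ g : Rn n → Rn n, IsTest Ω g → (∀ x, ‖g x‖ ≤ 1) →
      -∫ x in Ω, u x * divergence g x ≤ B) : ∫ x in Ω, ‖grad u x‖ ≤ B := by
  obtain ⟨M, hM⟩ := (hasCompactSupport_grad huc).exists_bound_of_continuous (contDiff_grad hu).continuous
  have hM0 : 0 ≤ M := (norm_nonneg _).trans (hM 0)
  have hgi : Integrable (fun x => ‖grad u x‖) :=
    ((contDiff_grad hu).continuous.integrable_of_hasCompactSupport (hasCompactSupport_grad huc)).norm
  refine le_of_forall_pos_le_add fun τ hτ => ?_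
  set V := (volume Ω).toReal
  have hV : 0 ≤ V := ENNReal.toReal_nonneg
  set η := τ / (2 * (V + 1))
  have hη : 0 < η := by positivity
  -- The optimal field $\nabla u/|\nabla u|$ is neither smooth nor compactly supported in $\Omega$.
  -- It is regularised by $\eta$ and cut off outside $K$; each change costs at most $\tau/2$.
  obtain ⟨K, hKΩ, hK, hKd⟩ := hΩ.measurableSet.exists_isCompact_sdiff_lt (μ := volume) hvol
    (ε := ENNReal.ofReal (τ / (2 * (M + 1)))) (by simpa using by positivity)
  obtain ⟨ψ, hψ, hψ01, hψ1⟩ := exists_cutoff hK hΩ hKΩ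
  set ρ := regNorm η u
  have hρ : ∀ x, 0 < ρ x := regNorm_pos hη
  set g : Rn n → Rn n := fun x => (ψ x / ρ x) • grad u x
  have hg : IsTest Ω g := by
    refine ⟨(hψ.contDiff.div (contDiff_regNorm hη hu) fun x => (hρ x).ne').smul
      (contDiff_grad hu), ?_, ?_⟩
    · refine HasCompactSupport.intro hψ.hasCompactSupport.isCompact fun x hx => ?_
      simp [g, image_eq_zero_of_notMem_tsupport hx]
    · have hsub : Function.support g ⊆ Function.support ψ := fun x hx h => hx (by simp [g, h])
      exact (closure_mono hsub).trans hψ.tsupport_subset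
  have hg1 : ∀ x, ‖g x‖ ≤ 1 := by
    intro x
    simp only [g, norm_smul, norm_div, Real.norm_of_nonneg (hψ01 x).1, Real.norm_of_nonneg (hρ x).le]
    rw [div_mul_eq_mul_div, div_le_one (hρ x)]
    exact (mul_le_of_le_one_left (norm_nonneg _) (hψ01 x).2).trans (norm_grad_le_regNorm x)
  have h1 := hB g hg hg1
  rw [(hasWeakGradient_grad (hu.of_le (by simp)) Ω).integral_divergence hg, neg_neg] at h1
  have hpt : ∀ x, ‖grad u x‖ ≤ inner ℝ (grad u x) (g x) + η + (Kᶜ).indicator (fun _ => M) x := by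
    intro x
    have e : inner ℝ (grad u x) (g x) = ψ x * (‖grad u x‖ ^ 2 / ρ x) := by
      simp only [g]; rw [real_inner_smul_right, real_inner_self_eq_norm_sq]; ring
    have hnn : 0 ≤ ‖grad u x‖ ^ 2 / ρ x := div_nonneg (by positivity) (hρ x).le
    by_cases hx : x ∈ K
    · rw [e, hψ1 x hx, one_mul, indicator_of_notMem (by simpa using hx), add_zero,
        ← sub_le_iff_le_add, le_div_iff₀ (hρ x)]
      have hr := regNorm_le (u := u) hη x
      rcases le_total (‖grad u x‖) η with h | h
      · nlinarith [hρ x, sq_nonneg ‖grad u x‖]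
      · nlinarith [hρ x, sq_nonneg η]
    · rw [e, indicator_of_mem (by simpa using hx)]
      have := mul_nonneg (hψ01 x).1 hnn
      linarith [hM x]
  have hi1 : Integrable (fun x => inner ℝ (grad u x) (g x)) (volume.restrict Ω) := by
    have hc : Continuous fun x => inner ℝ (grad u x) (g x) :=
      (contDiff_grad hu).continuous.inner hg.contDiff.continuous
    refine (hc.integrable_of_hasCompactSupport ?_).integrableOn
    exact HasCompactSupport.intro hg.hasCompactSupport.isCompact fun x hx => by
      simp [image_eq_zero_of_notMem_tsupport hx]
  have : IsFiniteMeasure (volume.restrict Ω) := ⟨by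
    rw [Measure.restrict_apply_univ]; exact hvol.lt_top⟩
  have hi3 : Integrable (Kᶜ.indicator fun _ => M) (volume.restrict Ω) :=
    (integrable_const M).indicator hK.measurableSet.compl
  have h2 : ∫ x in Ω, ‖grad u x‖ ≤
      ∫ x in Ω, (inner ℝ (grad u x) (g x) + η + (Kᶜ).indicator (fun _ => M) x) :=
    integral_mono hgi.integrableOn ((hi1.add (integrable_const η)).add hi3) hpt
  have hs1 : Integrable (fun x => inner ℝ (grad u x) (g x) + η) (volume.restrict Ω) :=
    hi1.add (integrable_const η)
  rw [integral_add hs1 hi3, integral_add hi1 (integrable_const η),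
    integral_indicator hK.measurableSet.compl, setIntegral_const, setIntegral_const] at h2
  have hmeas : (volume.restrict Ω).real Kᶜ ≤ τ / (2 * (M + 1)) := by
    rw [Measure.real, Measure.restrict_apply hK.measurableSet.compl, inter_comm, ← sdiff_eq]
    exact ENNReal.toReal_le_of_le_ofReal (by positivity) hKd.le
  rw [show volume.real Ω = V from rfl, smul_eq_mul, smul_eq_mul] at h2
  have e1 : V * η ≤ τ / 2 := by
    simp only [η]
    rw [← mul_div_assoc, div_le_div_iff₀ (by positivity) (by positivity)]
    nlinarith
  have e2 : (volume.restrict Ω).real Kᶜ * M ≤ τ / 2 := by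
    refine (mul_le_mul_of_nonneg_right hmeas hM0).trans ?_
    rw [div_mul_eq_mul_div, div_le_div_iff₀ (by positivity) (by positivity)]
    nlinarith
  linarith

/-! ### Interior cones of Lipschitz domains -/

/-- The uniform interior cone condition near a point of the closure of a Lipschitz domain. -/
lemma HasLipschitzBoundary.exists_cone {Ω : Set (Rn n)} (hL : HasLipschitzBoundary Ω)
    (hΩ : IsOpen Ω) {x : Rn n} (hx : x ∈ closure Ω) :
    ∃ e : Rn n, ‖e‖ ≤ 1 ∧ ∃ R > 0, ∃ c > 0, ∃ s₀ > 0, ∀ y ∈ ball x R, y ∈ Ω →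
      ∀ s, 0 < s → s < s₀ → closedBall (y + s • e) (c * s) ⊆ Ω := by
  by_cases hxΩ : x ∈ Ω
  · obtain ⟨r, hr, hb⟩ := Metric.isOpen_iff.1 hΩ x hxΩ
    refine ⟨0, by simp, r / 2, by positivity, 1, one_pos, r / 2, by positivity,
      fun y hy _ s hs hs' z hz => hb ?_⟩
    rw [smul_zero, add_zero, one_mul] at hz
    calc dist z x ≤ dist z y + dist y x := dist_triangle _ _ _
      _ < r / 2 + r / 2 := add_lt_add_of_le_of_lt ((mem_closedBall.1 hz).trans hs'.le) (mem_ball.1 hy)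
      _ = r := add_halves r
  · have hfr : x ∈ frontier Ω := by rw [frontier, hΩ.interior_eq]; exact ⟨hx, hxΩ⟩
    obtain ⟨e, he, r, hr, K, γ, hγ, H⟩ := hL x hfr
    -- A displacement $w$ with $|w|\le cs$ lowers the height by at most $cs$ and raises the graph by
    -- at most $Kcs$, so $(K+1)c<1$ leaves the gain $s$ dominant. The radii $r/2$ and $r/4$ keep the
    -- moved point in the chart, as $r/2+s+cs<r$.
    set c : ℝ := 1 / (2 * (K + 2))
    have hc : 0 < c := by positivity
    have hcK : (K + 1) * c < 1 := by
      simp only [c]; rw [mul_one_div, div_lt_one (by positivity)]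
      linarith [K.coe_nonneg]
    have hc1 : c ≤ 1 := by nlinarith [K.coe_nonneg]
    refine ⟨e, he.le, r / 2, by positivity, c, hc, r / 4, by positivity,
      fun y hy hyΩ s hs hs' z hz => ?_⟩
    have hzy : ‖z - (y + s • e)‖ ≤ c * s := by rw [← dist_eq_norm]; exact hz
    set w := z - (y + s • e)
    have hzw : z = y + s • e + w := by simp [w]
    have hyr : y ∈ ball x r := ball_subset_ball (by linarith) hy
    have hzr : z ∈ ball x r := by
      have h1 : z - x = (y - x) + s • e + w := by rw [hzw]; abel
      rw [mem_ball, dist_eq_norm, h1]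
      have h2 : ‖y - x‖ < r / 2 := by rw [← dist_eq_norm]; exact hy
      have h3 : ‖s • e‖ = s := by rw [norm_smul, he, mul_one, Real.norm_of_nonneg hs.le]
      have h4 := norm_add₃_le (a := y - x) (b := s • e) (c := w)
      nlinarith
    rw [H z hzr]
    have hy' := (H y hyr).1 hyΩ
    have hee : inner ℝ e e = (1 : ℝ) := by rw [real_inner_self_eq_norm_sq, he, one_pow]
    have hze : inner ℝ e z = inner ℝ e y + s + inner ℝ e w := by
      rw [hzw, inner_add_right, inner_add_right, real_inner_smul_right, hee, mul_one]
    have hperp : (z - inner ℝ e z • e) - (y - inner ℝ e y • e) = w - inner ℝ e w • e := by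
      rw [hze, hzw]; module
    have hwe : |inner ℝ e w| ≤ c * s := by
      refine (abs_real_inner_le_norm _ _).trans ?_
      rw [he, one_mul]; exact hzy
    have hwp : ‖w - inner ℝ e w • e‖ ≤ c * s := by
      refine le_trans ?_ hzy
      refine (sq_le_sq₀ (norm_nonneg _) (norm_nonneg _)).1 ?_
      rw [norm_sub_sq_real, norm_smul, he, real_inner_smul_right, real_inner_comm, mul_one,
        Real.norm_eq_abs, sq_abs]
      nlinarith [sq_nonneg (inner ℝ e w : ℝ)]
    have hγ' := hγ.dist_le_mul (z - inner ℝ e z • e) (y - inner ℝ e y • e)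
    rw [dist_eq_norm (z - _), hperp, Real.dist_eq] at hγ'
    have h5 := (abs_le.1 hγ').2
    have h6 := (abs_le.1 hwe).1
    have h7 : (K : ℝ) * ‖w - inner ℝ e w • e‖ ≤ K * (c * s) := by gcongr
    have h8 : (K + 1) * c * s < 1 * s := by gcongr
    linarith

/-- A partition of unity adapted to the interior cones of a bounded Lipschitz domain. -/
lemma exists_cone_partition {Ω : Set (Rn n)} (hL : HasLipschitzBoundary Ω)
    (hΩ : IsOpen Ω) (hb : Bornology.IsBounded Ω) :
    ∃ (t : Finset (Rn n)) (η : t → Rn n → ℝ) (e : t → Rn n) (c s₀ : ℝ), 0 < c ∧ c ≤ 1 ∧ 0 < s₀ ∧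
      (∀ i, IsTest univ (η i)) ∧ (∀ i x, 0 ≤ η i x) ∧ (∀ x, ∑ i, η i x ≤ 1) ∧
      (∀ x ∈ Ω, ∑ i, η i x = 1) ∧ (∀ i, ‖e i‖ ≤ 1) ∧
      ∀ i, ∀ y ∈ Ω, y ∈ tsupport (η i) → ∀ s, 0 < s → s < s₀ →
        closedBall (y + s • e i) (c * s) ⊆ Ω := by
  have hK : IsCompact (closure Ω) := hb.isCompact_closure
  have hcone : ∀ x : Rn n, ∃ e : Rn n, ‖e‖ ≤ 1 ∧ ∃ R > 0, ∃ c > 0, ∃ s₀ > 0, x ∈ closure Ω →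
      ∀ y ∈ ball x R, y ∈ Ω → ∀ s, 0 < s → s < s₀ → closedBall (y + s • e) (c * s) ⊆ Ω := by
    intro x
    by_cases hx : x ∈ closure Ω
    · obtain ⟨e, h1, R, h2, c, h3, s, h4, h5⟩ := hL.exists_cone hΩ hx
      exact ⟨e, h1, R, h2, c, h3, s, h4, fun _ => h5⟩
    · exact ⟨0, by simp, 1, one_pos, 1, one_pos, 1, one_pos, fun h => absurd h hx⟩
  choose e he R hR c hc s₀ hs₀ H using hcone
  obtain ⟨t, htK, ht⟩ := hK.elim_nhds_subcover (fun x => ball x (R x)) fun x _ => ball_mem_nhds x (hR x)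
  obtain ⟨f, hf⟩ := SmoothPartitionOfUnity.exists_isSubordinate 𝓘(ℝ, Rn n) isClosed_closure
    (fun i : t => ball (i : Rn n) (R i)) (fun i => isOpen_ball) (by simpa [iUnion_subtype] using ht)
  -- Inserting $1$ keeps the minimum meaningful when the cover is empty.
  obtain ⟨c', hc', hc'1, hc'le⟩ : ∃ c', 0 < c' ∧ c' ≤ 1 ∧ ∀ i : t, c' ≤ c i := by
    refine ⟨min 1 ((insert 1 (t.image c)).min' (by simp)), ?_, min_le_left _ _, fun i =>
      (min_le_right _ _).trans (Finset.min'_le _ _ (by simp; exact Or.inr ⟨i, i.2, rfl⟩))⟩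
    refine lt_min one_pos ((Finset.lt_min'_iff _ _).2 fun y hy => ?_)
    rcases Finset.mem_insert.1 hy with rfl | hy
    · exact one_pos
    · obtain ⟨x, -, rfl⟩ := Finset.mem_image.1 hy
      exact hc x
  obtain ⟨s', hs', hs'le⟩ : ∃ s', 0 < s' ∧ ∀ i : t, s' ≤ s₀ i := by
    refine ⟨(insert 1 (t.image s₀)).min' (by simp), ?_, fun i =>
      Finset.min'_le _ _ (by simp; exact Or.inr ⟨i, i.2, rfl⟩)⟩
    refine (Finset.lt_min'_iff _ _).2 fun y hy => ?_
    rcases Finset.mem_insert.1 hy with rfl | hy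
    · exact one_pos
    · obtain ⟨x, -, rfl⟩ := Finset.mem_image.1 hy
      exact hs₀ x
  refine ⟨t, fun i => f i, fun i => e i, c', s', hc', hc'1, hs', fun i => ⟨(f i).contMDiff.contDiff,
    ?_, subset_univ _⟩, fun i x => f.nonneg i x, fun x => ?_, fun x hx => ?_, fun i => he i, ?_⟩
  · exact (isCompact_closedBall (i : Rn n) (R i)).of_isClosed_subset (isClosed_tsupport _)
      ((hf i).trans ball_subset_closedBall)
  · rw [← finsum_eq_sum_of_fintype]; exact f.sum_le_one x
  · rw [← finsum_eq_sum_of_fintype]; exact f.sum_eq_one (subset_closure hx)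
  · intro i y hyΩ hy s hs hss
    refine (closedBall_subset_closedBall ?_).trans
      (H i (htK i i.2) y (hf i hy) hyΩ s hs (hss.trans_le (hs'le i)))
    exact mul_le_mul_of_nonneg_right (hc'le i) hs.le

end ACKS

/-! ### Adjoint convolutions and the calculus of divergences -/

namespace ACKS

open Metric ContinuousLinearMap
open scoped Pointwise

variable {n : ℕ}

/-- The adjoint of a convolution. -/
lemma IsKernel.integral_moll_mul {k : Rn n → ℝ} {c : Rn n} {r : ℝ} (hk : IsKernel k c r)
    {f h : Rn n → ℝ} (hf : Integrable f) (hh : Continuous h) (hhc : HasCompactSupport h) :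
    ∫ x, moll k f x * h x = ∫ x, f x * moll (fun t => k (-t)) h x := by
  obtain ⟨M, hM⟩ := hhc.exists_bound_of_continuous hh
  have i1 : Integrable (Function.uncurry fun x t : Rn n => k t * f (x - t) * h x)
      (volume.prod volume) :=
    (hk.integrable.convolution_integrand (lsmul ℝ ℝ) hf).mul_bdd (c := M)
      (hh.comp continuous_fst).aestronglyMeasurable (.of_forall fun p => hM _)
  have i2 : Integrable (Function.uncurry fun t x : Rn n => k t * f x * h (x + t))
      (volume.prod volume) :=
    (hk.integrable.mul_prod hf).mul_bdd (c := M)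
      (hh.comp (continuous_snd.add continuous_fst)).aestronglyMeasurable (.of_forall fun p => hM _)
  calc ∫ x, moll k f x * h x = ∫ x, ∫ t, k t * f (x - t) * h x := by
        congr 1; ext x
        rw [moll_apply, ← integral_mul_const]; rfl
    _ = ∫ t, ∫ x, k t * f (x - t) * h x := integral_integral_swap i1
    _ = ∫ t, ∫ x, k t * f x * h (x + t) := by
        congr 1; ext t
        rw [← integral_add_right_eq_self _ t]
        simp
    _ = ∫ x, ∫ t, k t * f x * h (x + t) := integral_integral_swap i2
    _ = ∫ x, f x * moll (fun t => k (-t)) h x := by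
        congr 1; ext x
        rw [moll_apply, ← integral_const_mul, ← integral_neg_eq_self]
        congr 1; ext t
        simp only [smul_eq_mul, ← sub_eq_add_neg]
        ring

lemma IsKernel.integrable_smul {k : Rn n → ℝ} {c : Rn n} {r : ℝ} (hk : IsKernel k c r)
    {F : Type*} [NormedAddCommGroup F] [NormedSpace ℝ F] {Ω : Set (Rn n)} {g : Rn n → F}
    (hg : IsTest Ω g) (x : Rn n) :
    Integrable fun t => k t • g (x - t) :=
  hk.hasCompactSupport.convolutionExists_left (lsmul ℝ ℝ) hk.contDiff.continuous
    hg.locallyIntegrable x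

lemma IsKernel.moll_eval {k : Rn n → ℝ} {c : Rn n} {r : ℝ} (hk : IsKernel k c r)
    {Ω : Set (Rn n)} {g : Rn n → Rn n} (hg : IsTest Ω g) (i : Fin n) (x : Rn n) :
    moll k g x i = moll k (fun y => g y i) x := by
  have := (EuclideanSpace.proj (𝕜 := ℝ) i).integral_comp_comm (hk.integrable_smul hg x)
  simp only [EuclideanSpace.coe_proj, PiLp.smul_apply] at this
  rw [moll_apply, moll_apply, ← this]

lemma IsKernel.divergence_moll {k : Rn n → ℝ} {c : Rn n} {r : ℝ} (hk : IsKernel k c r)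
    {Ω : Set (Rn n)} {g : Rn n → Rn n} (hg : IsTest Ω g) (x : Rn n) :
    divergence (moll k g) x = moll k (divergence g) x := by
  have h1 : ∀ i, pderiv i (fun y => moll k g y i) x = moll k (pderiv i fun y => g y i) x := by
    intro i
    simp_rw [hk.moll_eval hg i]
    exact hk.pderiv_moll_right (isTest_apply hg i) i x
  simp_rw [divergence, h1, moll_apply]
  rw [← integral_finsetSum]
  · simp_rw [divergence, Finset.smul_sum]
  · exact fun i _ => hk.integrable_smul ((isTest_apply hg i).pderiv i) x

/-- Smoothing a test field by a kernel that keeps its support in `Ω`. -/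
lemma IsKernel.isTest_moll {k : Rn n → ℝ} {c : Rn n} {r : ℝ} (hk : IsKernel k c r)
    {Ω : Set (Rn n)} {g : Rn n → Rn n} (hg : IsTest Ω g)
    (hs : ∀ y ∈ tsupport g, closedBall (y + c) r ⊆ Ω) : IsTest Ω (moll k g) := by
  refine isTest_of_apply (K := tsupport g + closedBall c r) ?_ ?_ ?_ ?_
  · exact hk.hasCompactSupport.contDiff_convolution_left (lsmul ℝ ℝ) hk.contDiff
      hg.locallyIntegrable
  · exact hg.hasCompactSupport.isCompact.add (isCompact_closedBall c r)
  · rintro z ⟨y, hy, w, hw, rfl⟩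
    refine hs y hy ?_
    simpa using hw
  · refine (MeasureTheory.support_convolution_subset_swap _).trans ?_
    exact add_subset_add (subset_tsupport g) hk.support_subset

lemma IsTest.const_smul {Ω : Set (Rn n)} {g : Rn n → Rn n} (hg : IsTest Ω g) (a : ℝ) :
    IsTest Ω fun x => a • g x where
  contDiff := (contDiff_const : ContDiff ℝ ∞ fun _ : Rn n => a).smul hg.contDiff
  hasCompactSupport := HasCompactSupport.intro hg.hasCompactSupport.isCompact fun x hx => by
    simp [image_eq_zero_of_notMem_tsupport hx]
  tsupport_subset := by
    have hsub : Function.support (fun x => a • g x) ⊆ Function.support g :=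
      fun x hx h => hx (by simp [h])
    exact (closure_mono hsub).trans hg.tsupport_subset

lemma IsTest.sum {ι : Type*} {Ω : Set (Rn n)} (s : Finset ι) {g : ι → Rn n → Rn n}
    (hg : ∀ i, IsTest Ω (g i)) : IsTest Ω fun x => ∑ i ∈ s, g i x := by
  refine isTest_of_apply (K := ⋃ i ∈ s, tsupport (g i)) ?_ ?_ ?_ ?_
  · exact ContDiff.sum fun i _ => (hg i).contDiff
  · exact s.isCompact_biUnion fun i _ => (hg i).hasCompactSupport.isCompact
  · exact iUnion₂_subset fun i _ => (hg i).tsupport_subset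
  · intro x hx
    by_contra h
    simp only [mem_iUnion, not_exists] at h
    exact hx (Finset.sum_eq_zero fun i hi => image_eq_zero_of_notMem_tsupport (h i hi))

lemma divergence_const_smul {Ω : Set (Rn n)} {g : Rn n → Rn n} (hg : IsTest Ω g) (a : ℝ)
    (x : Rn n) : divergence (fun x => a • g x) x = a * divergence g x := by
  simp_rw [divergence, Finset.mul_sum]
  refine Finset.sum_congr rfl fun i _ => ?_
  simp only [PiLp.smul_apply, pderiv]
  rw [fderiv_fun_const_smul ((isTest_apply hg i).contDiff.differentiable (by simp) x)]
  rfl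

lemma divergence_sum {ι : Type*} {Ω : Set (Rn n)} (s : Finset ι) {g : ι → Rn n → Rn n}
    (hg : ∀ i, IsTest Ω (g i)) (x : Rn n) :
    divergence (fun x => ∑ i ∈ s, g i x) x = ∑ i ∈ s, divergence (g i) x := by
  simp_rw [divergence]
  rw [Finset.sum_comm]
  refine Finset.sum_congr rfl fun j _ => ?_
  simp only [WithLp.ofLp_sum, Finset.sum_apply, pderiv]
  rw [fderiv_fun_sum fun i _ => (isTest_apply (hg i) j).contDiff.differentiable (by simp) x]
  simp

lemma divergence_smul {Ω : Set (Rn n)} {φ : Rn n → ℝ} (hφ : ContDiff ℝ ∞ φ) {g : Rn n → Rn n}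
    (hg : IsTest Ω g) (x : Rn n) :
    divergence (fun x => φ x • g x) x = φ x * divergence g x + inner ℝ (grad φ x) (g x) := by
  rw [inner_eq_sum]
  simp_rw [divergence, Finset.mul_sum]
  rw [← Finset.sum_add_distrib]
  refine Finset.sum_congr rfl fun i _ => ?_
  simp only [PiLp.smul_apply, smul_eq_mul, pderiv, grad]
  rw [fderiv_fun_mul (hφ.differentiable (by simp) x)
    ((isTest_apply hg i).contDiff.differentiable (by simp) x)]
  simp [mul_comm]

lemma isTest_smul {Ω : Set (Rn n)} {φ : Rn n → ℝ} (hφ : ContDiff ℝ ∞ φ) {g : Rn n → Rn n}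
    (hg : IsTest Ω g) : IsTest Ω fun x => φ x • g x where
  contDiff := hφ.smul hg.contDiff
  hasCompactSupport := HasCompactSupport.intro hg.hasCompactSupport.isCompact fun x hx => by
    simp [image_eq_zero_of_notMem_tsupport hx]
  tsupport_subset := by
    have hsub : Function.support (fun x => φ x • g x) ⊆ Function.support g :=
      fun x hx h => hx (by simp [h])
    exact (closure_mono hsub).trans hg.tsupport_subset

/-- Rescale the field to $-g/C$, an admissible competitor in the definition of the perimeter. -/
lemma neg_setIntegral_divergence_le {Ω E : Set (Rn n)} (hper : perimeter Ω E ≠ ⊤)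
    {g : Rn n → Rn n} (hg : IsTest Ω g) {C : ℝ} (hC : 0 < C) (hgC : ∀ x, ‖g x‖ ≤ C) :
    -∫ x in E, divergence g x ≤ C * (perimeter Ω E).toReal := by
  have h1 : IsTest Ω fun x => (-C⁻¹) • g x := hg.const_smul _
  have h2 : ∀ x, ‖(-C⁻¹) • g x‖ ≤ 1 := fun x => by
    rw [norm_smul, norm_neg, norm_inv, Real.norm_of_nonneg hC.le, inv_mul_le_one₀ hC]
    exact hgC x
  have h3 : ENNReal.ofReal (∫ x in E, divergence (fun x => (-C⁻¹) • g x) x) ≤ perimeter Ω E :=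
    le_iSup₂_of_le (f := fun (g : Rn n → Rn n)
      (_ : IsTest Ω g ∧ ∀ x, ‖g x‖ ≤ 1) => ENNReal.ofReal (∫ x in E, divergence g x)) _ ⟨h1, h2⟩ le_rfl
  rw [ENNReal.ofReal_le_iff_le_toReal hper] at h3
  simp_rw [divergence_const_smul hg] at h3
  rw [integral_const_mul] at h3
  have := mul_le_mul_of_nonneg_left h3 hC.le
  rwa [← mul_assoc, mul_neg, mul_inv_cancel₀ hC.ne', neg_one_mul] at this

end ACKS

/-! ### Strict approximation of sets of finite perimeter -/

namespace ACKS

open Metric ContinuousLinearMap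

variable {n : ℕ}

lemma exists_pos_mul_le (a : ℝ) {τ : ℝ} (hτ : 0 < τ) : ∃ κ > 0, a * κ ≤ τ := by
  refine ⟨τ / (|a| + 1), by positivity, ?_⟩
  rw [mul_div_assoc', div_le_iff₀ (by positivity)]
  nlinarith [le_abs_self a]

/-- Moduli of continuity of finitely many test functions. -/
lemma exists_uniform_modulus {ι : Type*} [Fintype ι] {η : ι → Rn n → ℝ}
    (hη : ∀ i, IsTest univ (η i)) {κ : ℝ} (hκ : 0 < κ) :
    ∃ δ > 0, ∀ i x t, ‖t‖ ≤ δ → η i (x - t) ≤ η i x + κ := by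
  have h : ∀ i, ∀ᶠ δ in 𝓝[>] (0 : ℝ), ∀ x t, ‖t‖ ≤ δ → η i (x - t) ≤ η i x + κ := by
    intro i
    obtain ⟨δ, hδ, H⟩ := Metric.uniformContinuous_iff.1
      ((hη i).hasCompactSupport.uniformContinuous_of_continuous (hη i).contDiff.continuous) κ hκ
    filter_upwards [Ioo_mem_nhdsGT hδ] with δ' hδ' x t ht
    have := H (a := x - t) (b := x) (by simpa [dist_eq_norm] using ht.trans_lt hδ'.2)
    rw [Real.dist_eq] at this
    linarith [(abs_lt.1 this).2]
  obtain ⟨δ, hδ, hδ0⟩ := ((eventually_all.2 h).and self_mem_nhdsWithin).exists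
  exact ⟨δ, hδ0, hδ⟩

/-- The duality estimate for the smoothed function. -/
lemma neg_setIntegral_sum_moll_le {Ω E : Set (Rn n)} (hE : NullMeasurableSet E) (hEΩ : E ⊆ Ω)
    (hΩ : IsOpen Ω) (hEv : volume E ≠ ⊤)
    (hper : perimeter Ω E ≠ ⊤) {ι : Type*} [Fintype ι] {η : ι → Rn n → ℝ}
    (hη : ∀ i, IsTest univ (η i)) (hη0 : ∀ i x, 0 ≤ η i x) (hη1 : ∀ x, ∑ i, η i x ≤ 1)
    (hηΩ : ∀ x ∈ Ω, ∑ i, η i x = 1) {k : ι → Rn n → ℝ} {c : ι → Rn n} {r δ κ τ₁ M : ℝ}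
    (hκ : 0 < κ) (hmod : ∀ i x t, ‖t‖ ≤ δ → η i (x - t) ≤ η i x + κ)
    (hk : ∀ i, IsKernel (k i) (-c i) r) (hkδ : ∀ i, closedBall (-c i) r ⊆ closedBall 0 δ)
    (hcone : ∀ i, ∀ y ∈ Ω, y ∈ tsupport (η i) → closedBall (y + c i) r ⊆ Ω)
    (hτ : ∀ i, ∫ x, |moll (k i) (E.indicator 1) x - E.indicator 1 x| ≤ τ₁)
    (hM : ∀ i x, ‖grad (η i) x‖ ≤ M) {g : Rn n → Rn n} (hg : IsTest Ω g)
    (hg1 : ∀ x, ‖g x‖ ≤ 1) :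
    -∫ x in Ω, (∑ i, η i x * moll (k i) (E.indicator 1) x) * divergence g x ≤
      (1 + Fintype.card ι * κ) * (perimeter Ω E).toReal + Fintype.card ι * (M * τ₁) := by
  set f : Rn n → ℝ := E.indicator 1
  have hf : Integrable f := (integrableOn_const hEv).integrable_indicator₀ hE
  set w : ι → Rn n → ℝ := fun i => moll (k i) f
  have hwc : ∀ i, Continuous (w i) := fun i => ((hk i).contDiff_moll hf.locallyIntegrable).continuous
  have hwi : ∀ i, Integrable (w i) := fun i => (hk i).integrable.integrable_convolution (lsmul ℝ ℝ) hf
  have hηg : ∀ i, IsTest Ω fun x => η i x • g x := fun i => isTest_smul (hη i).contDiff hg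
  -- Moving the convolution to the test field produces a reflected kernel centred at $c_i$. It
  -- shifts the support of $\eta_ig$ inwards along the cone, so $G_i$ is again a test field in
  -- $\Omega$.
  set G : ι → Rn n → Rn n := fun i => moll (fun t => k i (-t)) fun x => η i x • g x
  have hk' : ∀ i, IsKernel (fun t => k i (-t)) (c i) r := fun i => by
    simpa using (hk i).neg
  have hG : ∀ i, IsTest Ω (G i) := by
    refine fun i => (hk' i).isTest_moll (hηg i) fun y hy => hcone i y ?_ ?_
    · exact (hηg i).tsupport_subset hy
    · exact tsupport_smul_subset_left (η i) g hy
  have hGn : ∀ i x, ‖G i x‖ ≤ η i x + κ := by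
    intro i x
    calc ‖G i x‖ ≤ ∫ t, k i (-t) * (η i x + κ) := by
          refine norm_integral_le_of_norm_le ((hk' i).integrable.mul_const _) (.of_forall fun t => ?_)
          by_cases ht : k i (-t) = 0
          · simp [ht]
          · have h1 : ‖-t‖ ≤ δ := by
              simpa using hkδ i ((hk i).support_subset (show -t ∈ Function.support (k i) from ht))
            rw [norm_neg] at h1
            have h2 := hmod i x t h1
            have h0 := (hk i).nonneg (-t)
            rw [lsmul_apply, norm_smul, norm_smul, Real.norm_of_nonneg h0,
              Real.norm_of_nonneg (hη0 i _)]
            gcongr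
            exact (mul_le_of_le_one_right (hη0 i _) (hg1 _)).trans h2
      _ = η i x + κ := by rw [integral_mul_const, (hk' i).integral_eq_one, one_mul]
  -- The pieces are bounded by $\eta_i+\kappa$ pointwise, so their sum stays near one instead of
  -- growing like the number of pieces.
  have hGsum : ∀ x, ‖∑ i, G i x‖ ≤ 1 + Fintype.card ι * κ := by
    intro x
    calc ‖∑ i, G i x‖ ≤ ∑ i, (η i x + κ) := norm_sum_le_of_le _ fun i _ => hGn i x
      _ ≤ 1 + Fintype.card ι * κ := by
        rw [Finset.sum_add_distrib, Finset.sum_const, Finset.card_univ, nsmul_eq_mul]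
        gcongr; exact hη1 x
  have hper1 := neg_setIntegral_divergence_le hper (IsTest.sum Finset.univ hG)
    (C := 1 + Fintype.card ι * κ) (by positivity) hGsum
  simp_rw [divergence_sum Finset.univ hG] at hper1
  rw [integral_finsetSum _ fun i _ => (hG i).divergence_integrable.integrableOn] at hper1
  -- each term
  have hgradc : ∀ i, Continuous fun x => inner ℝ (grad (η i) x) (g x) := fun i =>
    (contDiff_grad (hη i).contDiff).continuous.inner hg.contDiff.continuous
  have hgradb : ∀ i x, |inner ℝ (grad (η i) x) (g x)| ≤ M := fun i x =>
    (abs_real_inner_le_norm _ _).trans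
      ((mul_le_of_le_one_right (norm_nonneg _) (hg1 x)).trans (hM i x))
  have hI1 : ∀ i, Integrable fun x => w i x * inner ℝ (grad (η i) x) (g x) := fun i =>
    (hwi i).mul_bdd (hgradc i).aestronglyMeasurable (.of_forall (hgradb i))
  have hI2 : ∀ i, Integrable fun x => f x * inner ℝ (grad (η i) x) (g x) := fun i =>
    hf.mul_bdd (hgradc i).aestronglyMeasurable (.of_forall (hgradb i))
  have hI3 : ∀ i, Integrable fun x => w i x * divergence (fun x => η i x • g x) x := fun i => by
    obtain ⟨M', hM'⟩ := (hηg i).divergence_bound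
    exact (hwi i).mul_bdd (hηg i).divergence_continuous.aestronglyMeasurable (.of_forall hM')
  have hterm : ∀ i, ∫ x, η i x * w i x * divergence g x =
      (∫ x in E, divergence (G i) x) - ∫ x, w i x * inner ℝ (grad (η i) x) (g x) := by
    intro i
    have h1 : ∀ x, η i x * w i x * divergence g x =
        w i x * divergence (fun x => η i x • g x) x - w i x * inner ℝ (grad (η i) x) (g x) := by
      intro x
      rw [divergence_smul (hη i).contDiff hg]; ring
    simp_rw [h1]
    rw [integral_sub (hI3 i) (hI1 i)]
    congr 1
    have hdc : HasCompactSupport (divergence fun x => η i x • g x) := by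
      refine HasCompactSupport.intro (hηg i).hasCompactSupport.isCompact fun x hx => ?_
      refine Finset.sum_eq_zero fun j _ => image_eq_zero_of_notMem_tsupport fun h => hx ?_
      have hsub : Function.support (fun y => (η i y • g y) j) ⊆
          Function.support fun y => η i y • g y := fun y hy h =>
        hy (by simp only [h]; simp)
      exact closure_mono hsub (tsupport_pderiv_subset j h)
    rw [(hk i).integral_moll_mul hf (hηg i).divergence_continuous hdc,
      ← integral_indicator₀ hE]
    congr 1; ext x
    by_cases hx : x ∈ E
    · simp only [f, indicator_of_mem hx, Pi.one_apply, one_mul]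
      exact ((hk' i).divergence_moll (hηg i) x).symm
    · simp [f, indicator_of_notMem hx]
  -- In $\Omega$ the partition sums to one, so the gradients of its members cancel where $f$ lives.
  -- The product rule remainder may thus be compared with zero, at a cost of only the $L^1$
  -- mollification error.
  have hzero : ∑ i, ∫ x, f x * inner ℝ (grad (η i) x) (g x) = 0 := by
    rw [← integral_finsetSum _ fun i _ => hI2 i]
    refine integral_eq_zero_of_ae (.of_forall fun x => ?_)
    simp only [Pi.zero_apply, ← Finset.mul_sum, ← sum_inner]
    by_cases hx : x ∈ Ω
    · have h0 : ∑ i, grad (η i) x = 0 := by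
        ext j
        simp only [WithLp.ofLp_sum, Finset.sum_apply, grad_apply, pderiv]
        rw [← _root_.sum_apply, ← fderiv_fun_sum fun i _ =>
          (hη i).contDiff.differentiable (by simp) x]
        have : (fun y => ∑ i, η i y) =ᶠ[𝓝 x] fun _ => 1 := by
          filter_upwards [hΩ.mem_nhds hx] with y hy using hηΩ y hy
        rw [this.fderiv_eq]
        simp
      simp [h0]
    · have : f x = 0 := indicator_of_notMem (fun h => hx (hEΩ h)) _
      simp [this]
  have hdiff : ∀ i, (∫ x, w i x * inner ℝ (grad (η i) x) (g x)) ≤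
      (∫ x, f x * inner ℝ (grad (η i) x) (g x)) + M * τ₁ := by
    intro i
    rw [← sub_le_iff_le_add', ← integral_sub (hI1 i) (hI2 i)]
    have hM0 : 0 ≤ M := (norm_nonneg _).trans (hM i 0)
    calc ∫ x, (w i x * inner ℝ (grad (η i) x) (g x) - f x * inner ℝ (grad (η i) x) (g x))
        ≤ ∫ x, M * |w i x - f x| := by
          refine integral_mono ((hI1 i).sub (hI2 i)) (((hwi i).sub hf).abs.const_mul M) fun x => ?_
          simp only [← sub_mul]
          refine (le_abs_self _).trans ?_
          rw [abs_mul, mul_comm]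
          exact mul_le_mul_of_nonneg_right (hgradb i x) (abs_nonneg _)
      _ ≤ M * τ₁ := by
          rw [integral_const_mul]
          exact mul_le_mul_of_nonneg_left (hτ i) hM0
  have hmain : ∫ x in Ω, (∑ i, η i x * w i x) * divergence g x =
      ∑ i, ((∫ x in E, divergence (G i) x) - ∫ x, w i x * inner ℝ (grad (η i) x) (g x)) := by
    rw [setIntegral_eq_integral_of_forall_compl_eq_zero]
    · simp_rw [← hterm, Finset.sum_mul]
      rw [integral_finsetSum]
      intro i _
      have h1 : ∀ x, η i x * w i x * divergence g x =
          w i x * divergence (fun x => η i x • g x) x - w i x * inner ℝ (grad (η i) x) (g x) := by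
        intro x
        rw [divergence_smul (hη i).contDiff hg]; ring
      simp_rw [h1]
      exact (hI3 i).sub (hI1 i)
    · intro x hx
      have : divergence g x = 0 := by
        refine Finset.sum_eq_zero fun j _ => image_eq_zero_of_notMem_tsupport fun h => hx ?_
        exact (isTest_apply hg j).tsupport_subset (tsupport_pderiv_subset j h)
      simp [this]
  have hs := Finset.sum_le_sum fun i (_ : i ∈ Finset.univ) => hdiff i
  rw [Finset.sum_add_distrib, hzero, zero_add, Finset.sum_const, Finset.card_univ,
    nsmul_eq_mul] at hs
  change -∫ x in Ω, (∑ i, η i x * w i x) * divergence g x ≤ _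
  rw [hmain, Finset.sum_sub_distrib]
  linarith

/-- Strict approximation of a set of finite perimeter in a bounded Lipschitz domain by functions
which are smooth up to the boundary. -/
theorem exists_smooth_approx {Ω E : Set (Rn n)} (hΩ : IsOpen Ω) (hb : Bornology.IsBounded Ω)
    (hL : HasLipschitzBoundary Ω) (hE : NullMeasurableSet E) (hEΩ : E ⊆ Ω) {δ τ : ℝ}
    (hδ : 0 < δ) (hτ : 0 < τ) : ∃ u : Rn n → ℝ, ContDiff ℝ ∞ u ∧ HasCompactSupport u ∧
      ∫⁻ x in Ω, ‖u x - E.indicator 1 x‖ₑ ≤ ENNReal.ofReal τ ∧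
      (∀ x, volume (ball x δ ∩ E) = 0 → u x = 0) ∧
      ENNReal.ofReal (∫ x in Ω, ‖grad u x‖) ≤ perimeter Ω E + ENNReal.ofReal τ := by
  have hΩv : volume Ω ≠ ⊤ := hb.measure_lt_top.ne
  have hEv : volume E ≠ ⊤ := ((measure_mono hEΩ).trans_lt hb.measure_lt_top).ne
  obtain ⟨t, η, e, c, s₀, hc, hc1, hs₀, hη, hη0, hη1, hηΩ, he, hcone⟩ :=
    exists_cone_partition hL hΩ hb
  set f : Rn n → ℝ := E.indicator 1
  have hf : Integrable f := (integrableOn_const hEv).integrable_indicator₀ hE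
  set N : ℝ := (Fintype.card t : ℝ)
  set P := (perimeter Ω E).toReal
  obtain ⟨M, hM0, hM⟩ : ∃ M, 0 ≤ M ∧ ∀ i x, ‖grad (η i) x‖ ≤ M := by
    have : ∀ i, ∃ M, ∀ x, ‖grad (η i) x‖ ≤ M := fun i =>
      (hasCompactSupport_grad (hη i).hasCompactSupport).exists_bound_of_continuous
        (contDiff_grad (hη i).contDiff).continuous
    choose m hm using this
    have hm0 : ∀ i, 0 ≤ m i := fun i => (norm_nonneg _).trans (hm i 0)
    exact ⟨∑ i, m i, Finset.sum_nonneg fun i _ => hm0 i, fun i x => (hm i x).trans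
      (Finset.single_le_sum (fun i _ => hm0 i) (Finset.mem_univ i))⟩
  obtain ⟨κ, hκ, hκP⟩ := exists_pos_mul_le (N * P) (half_pos hτ)
  -- The factor $M+1$ makes one choice serve both the $L^1$ error $N\tau_1$ and the gradient error
  -- $NM\tau_1$.
  obtain ⟨τ₁, hτ₁, hτ₁N⟩ := exists_pos_mul_le (N * (M + 1)) (half_pos hτ)
  have hN : 0 ≤ N := Nat.cast_nonneg _
  have hNτ : N * τ₁ ≤ τ := by nlinarith [mul_nonneg (mul_nonneg hN hM0) hτ₁.le]
  have hNMτ : N * (M * τ₁) ≤ τ / 2 := by nlinarith [mul_nonneg hN hτ₁.le]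
  obtain ⟨δ₁, hδ₁, hmod⟩ := exists_uniform_modulus hη hκ
  obtain ⟨δ₂, hδ₂, hmoll⟩ := exists_lintegral_moll_sub_le hf (τ := ENNReal.ofReal τ₁) (by simpa)
  -- The bounds serve, in this order, the vanishing of $u$ away from $E$, the modulus of the
  -- partition and the $L^1$ approximation. The choice of $s$ gives $s+cs\le 2s\le d$, so the
  -- shifted kernels live in the ball of radius $d$.
  set d := min (δ / 2) (min δ₁ δ₂)
  have hd : 0 < d := by positivity
  set s := min (s₀ / 2) (d / 2)
  have hs : 0 < s := by positivity
  have hss₀ : s < s₀ := (min_le_left _ _).trans_lt (half_lt_self hs₀)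
  have hsd : 2 * s ≤ d := by have := min_le_right (s₀ / 2) (d / 2); simp only [s]; linarith
  choose k hk using fun i => exists_isKernel (-(s • e i)) (mul_pos hc hs)
  have hball : ∀ i, closedBall (-(s • e i)) (c * s) ⊆ closedBall 0 d := by
    intro i
    refine closedBall_subset_closedBall' ?_
    rw [dist_zero_right, norm_neg, norm_smul, Real.norm_of_nonneg hs.le]
    nlinarith [he i]
  have hk0 : ∀ i, IsKernel (k i) 0 d := fun i => (hk i).mono (hball i)
  have hwm : ∀ i, ∫⁻ x, ‖moll (k i) f x - f x‖ₑ ≤ ENNReal.ofReal τ₁ := fun i =>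
    hmoll _ ((hk0 i).mono (closedBall_subset_closedBall ((min_le_right _ _).trans (min_le_right _ _))))
  have hws : ∀ i, ContDiff ℝ ∞ (moll (k i) f) := fun i => (hk i).contDiff_moll hf.locallyIntegrable
  have hus : ContDiff ℝ ∞ fun x => ∑ i, η i x * moll (k i) f x :=
    ContDiff.sum fun i _ => (hη i).contDiff.mul (hws i)
  have huc : HasCompactSupport fun x => ∑ i, η i x * moll (k i) f x := by
    refine HasCompactSupport.intro (K := ⋃ i, tsupport (η i))
      (isCompact_iUnion fun i => (hη i).hasCompactSupport.isCompact) fun x hx => ?_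
    simp only [mem_iUnion, not_exists] at hx
    exact Finset.sum_eq_zero fun i _ => by rw [image_eq_zero_of_notMem_tsupport (hx i), zero_mul]
  refine ⟨fun x => ∑ i, η i x * moll (k i) f x, hus, huc, ?_, ?_, ?_⟩
  · calc ∫⁻ x in Ω, ‖(∑ i, η i x * moll (k i) f x) - f x‖ₑ
        ≤ ∫⁻ x in Ω, ∑ i, ‖moll (k i) f x - f x‖ₑ := by
          refine setLIntegral_mono' hΩ.measurableSet fun x hx => ?_
          have e1 : (∑ i, η i x * moll (k i) f x) - f x = ∑ i, η i x * (moll (k i) f x - f x) := by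
            simp_rw [mul_sub]
            rw [Finset.sum_sub_distrib, ← Finset.sum_mul, hηΩ x hx, one_mul]
          rw [e1]
          refine (enorm_sum_le _ _).trans (Finset.sum_le_sum fun i _ => ?_)
          rw [← ofReal_norm, ← ofReal_norm, norm_mul, Real.norm_of_nonneg (hη0 i x)]
          refine ENNReal.ofReal_le_ofReal (mul_le_of_le_one_left (norm_nonneg _) ?_)
          exact (Finset.single_le_sum (fun i _ => hη0 i x) (Finset.mem_univ i)).trans (hη1 x)
      _ ≤ ∫⁻ x, ∑ i, ‖moll (k i) f x - f x‖ₑ := setLIntegral_le_lintegral _ _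
      _ = ∑ i, ∫⁻ x, ‖moll (k i) f x - f x‖ₑ := by
          refine lintegral_finsetSum' _ fun i _ => ?_
          exact ((hws i).continuous.aestronglyMeasurable.sub hf.aestronglyMeasurable).enorm
      _ ≤ ∑ i : t, ENNReal.ofReal τ₁ := Finset.sum_le_sum fun i _ => hwm i
      _ ≤ ENNReal.ofReal τ := by
          rw [Finset.sum_const, Finset.card_univ, nsmul_eq_mul, ← ENNReal.ofReal_natCast,
            ← ENNReal.ofReal_mul (Nat.cast_nonneg _)]
          exact ENNReal.ofReal_le_ofReal hNτ
  · intro x hx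
    refine Finset.sum_eq_zero fun i _ => ?_
    have hz : moll (k i) f x = 0 := by
      rw [moll_apply]
      refine integral_eq_zero_of_ae ?_
      have hn := (quasiMeasurePreserving_sub_left_of_right_invariant volume x).preimage_null hx
      filter_upwards [measure_eq_zero_iff_ae_notMem.1 hn] with t ht
      by_cases hkt : k i t = 0
      · simp [hkt]
      · have h1 : ‖t‖ ≤ d := by simpa using (hk0 i).support_subset hkt
        have h2 : x - t ∉ E := fun h => ht ⟨by
          rw [mem_ball, dist_eq_norm]
          have : d ≤ δ / 2 := min_le_left _ _
          simp only [sub_sub_cancel_left, norm_neg]; linarith, h⟩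
        simp [f, indicator_of_notMem h2]
    rw [hz, mul_zero]
  · by_cases hper : perimeter Ω E = ⊤
    · simp [hper]
    · rw [← ENNReal.ofReal_toReal hper, ← ENNReal.ofReal_add ENNReal.toReal_nonneg hτ.le]
      refine ENNReal.ofReal_le_ofReal (setIntegral_norm_grad_le hΩ hΩv hus huc fun g hg hg1 => ?_)
      have := neg_setIntegral_sum_moll_le (τ₁ := τ₁) hE hEΩ hΩ hEv hper hη hη0 hη1 hηΩ hκ
        (fun i x t ht => hmod i x t (ht.trans ((min_le_right _ _).trans (min_le_left _ _)))) hk hball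
        (fun i y hy hyη => hcone i y hy hyη s hs hss₀) (fun i => ?_) hM hg hg1
      · refine this.trans ?_
        change (1 + N * κ) * P + N * (M * τ₁) ≤ P + τ
        nlinarith
      · have h1 : Integrable fun x => moll (k i) f x - f x :=
          ((hk i).integrable.integrable_convolution (lsmul ℝ ℝ) hf).sub hf
        have h2 := hwm i
        rw [← ofReal_integral_norm_eq_lintegral_enorm h1,
          ENNReal.ofReal_le_ofReal_iff hτ₁.le] at h2
        exact h2

end ACKS

/-! ### Truncation and phase fields from smooth functions -/

namespace ACKS

open Metric

variable {n : ℕ}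

/-- A `C¹` truncation near the origin. -/
lemma exists_truncation {δ : ℝ} (hδ : 0 < δ) : ∃ β β' : ℝ → ℝ, (∀ s, HasDerivAt β (β' s) s) ∧
    Continuous β' ∧ (∀ s, |β' s| ≤ 1) ∧ (∀ s, s ≤ δ → β s = 0) ∧ (∀ s, 0 ≤ β s) ∧
    ∀ s, 0 ≤ s → |β s - s| ≤ 2 * δ := by
  -- The slope rises from $0$ at $\delta$ to $1$ at $2\delta$, so its primitive trails the identity
  -- by at most $2\delta$ on the positive axis.
  set b : ℝ → ℝ := fun x => min 1 (max 0 ((x - δ) / δ))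
  have hb : Continuous b := by fun_prop
  have hb0 : ∀ x, 0 ≤ b x := fun x => le_min zero_le_one (le_max_left _ _)
  have hb1 : ∀ x, b x ≤ 1 := fun x => min_le_left _ _
  have hd : ∀ s, HasDerivAt (fun s => ∫ x in δ..s, b x) (b s) s := fun s =>
    (hb.integral_hasStrictDerivAt _ _).hasDerivAt
  have hmono : Monotone fun s => ∫ x in δ..s, b x :=
    monotone_of_hasDerivAt_nonneg hd fun s => hb0 s
  have hz : ∀ s, s ≤ δ → ∫ x in δ..s, b x = 0 := by
    intro s hs
    rw [intervalIntegral.integral_congr (g := fun _ => (0 : ℝ))]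
    · simp
    · intro x hx
      rw [uIcc_of_ge hs] at hx
      have : (x - δ) / δ ≤ 0 := div_nonpos_of_nonpos_of_nonneg (by linarith [hx.2]) hδ.le
      simp [b, max_eq_left this]
  have hnn : ∀ s, 0 ≤ ∫ x in δ..s, b x := by
    intro s
    rcases le_total s δ with h | h
    · exact (hz s h).ge
    · exact intervalIntegral.integral_nonneg h fun x _ => hb0 x
  refine ⟨_, b, hd, hb, fun s => by rw [abs_of_nonneg (hb0 s)]; exact hb1 s, hz, hnn, fun s hs => ?_⟩
  have hle : ∫ x in δ..s, b x ≤ s := by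
    rcases le_total s δ with h | h
    · rw [hz s h]; exact hs
    · have := intervalIntegral.integral_mono_on h (hb.intervalIntegrable (μ := volume) _ _)
        (continuous_const.intervalIntegrable _ _) fun x _ => hb1 x
      rw [intervalIntegral.integral_const, smul_eq_mul, mul_one] at this
      linarith
  rw [abs_le]
  refine ⟨?_, by linarith⟩
  rcases le_total s (2 * δ) with h | h
  · linarith [hnn s]
  · have e1 := intervalIntegral.integral_add_adjacent_intervals (a := δ) (b := 2 * δ) (c := s)
      (hb.intervalIntegrable (μ := volume) _ _) (hb.intervalIntegrable _ _)
    have e2 : ∫ x in (2 * δ)..s, b x = s - 2 * δ := by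
      rw [intervalIntegral.integral_congr (g := fun _ => (1 : ℝ))]
      · simp
      · intro x hx
        rw [uIcc_of_le h] at hx
        have : 1 ≤ (x - δ) / δ := by rw [le_div_iff₀ hδ]; linarith [hx.1]
        simp only [b]
        rw [max_eq_right (by linarith), min_eq_left this]
    linarith [hnn (2 * δ)]

lemma memH1_of_contDiff {Ω : Set (Rn n)} (hΩ : IsOpen Ω) (hb : Bornology.IsBounded Ω)
    {f : Rn n → ℝ} (hf : ContDiff ℝ 1 f) : MemH1 Ω f := by
  have : IsFiniteMeasure (volume.restrict Ω) := ⟨by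
    rw [Measure.restrict_apply_univ]; exact hb.measure_lt_top⟩
  have key : ∀ {F : Type} [NormedAddCommGroup F] [SecondCountableTopology F] {g : Rn n → F},
      Continuous g → MemLp g 2 (volume.restrict Ω) := by
    intro F _ _ g hg
    obtain ⟨C, hC⟩ := hb.isCompact_closure.exists_bound_of_continuousOn hg.continuousOn
    exact MemLp.of_bound hg.aestronglyMeasurable C
      ((ae_restrict_iff' hΩ.measurableSet).2 (.of_forall fun x hx => hC x (subset_closure hx)))
  exact ⟨key hf.continuous, grad f, hasWeakGradient_grad hf Ω, key (continuous_grad hf)⟩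

/-- The Riesz isometry; the lower bound comes from evaluating the derivative at the gradient itself.
-/
lemma norm_fderiv_eq_norm_grad (f : Rn n → ℝ) (x : Rn n) : ‖fderiv ℝ f x‖ = ‖grad f x‖ := by
  refine le_antisymm (ContinuousLinearMap.opNorm_le_bound _ (norm_nonneg _) fun z => ?_) ?_
  · rw [← inner_grad]; exact norm_inner_le_norm _ _
  · rcases (norm_nonneg (grad f x)).eq_or_lt with h | h
    · rw [← h]; positivity
    · have h1 := (fderiv ℝ f x).le_opNorm (grad f x)
      rw [← inner_grad, real_inner_self_eq_norm_sq, Real.norm_of_nonneg (by positivity), sq] at h1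
      exact le_of_mul_le_mul_right h1 h

/-- Pointwise energy bound for a profile of a rescaled function. -/
lemma norm_grad_profile_le {Q Q' : ℝ → ℝ} {L : ℝ} (hL : 0 < L) (hQ : ∀ s, HasDerivAt Q (Q' s) s)
    (hQ0 : ∀ s, L ≤ |s| → Q' s = 0) {u : Rn n → ℝ} (hu : ContDiff ℝ ∞ u) {η ε t D : ℝ}
    (hη : 0 < η) (hε : 0 < ε) (hD : ∀ x, ‖fderiv ℝ (regNorm η u) x‖ ≤ D) (x : Rn n) :
    ‖grad (fun x => Q ((t - u x) / (ε * regNorm η u x))) x‖ ≤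
      |Q' ((t - u x) / (ε * regNorm η u x))| * (1 / ε * (1 + L * ε * D / η)) := by
  set ρ := regNorm η u
  have hρ : 0 < ρ x := regNorm_pos hη x
  set q : Rn n → ℝ := fun x => (t - u x) / (ε * ρ x)
  have hd1 : HasFDerivAt (fun x => t - u x) (-fderiv ℝ u x) x :=
    (hu.differentiable (by simp) x).hasFDerivAt.const_sub t
  have hd2 : HasFDerivAt (fun x => ε * ρ x) (ε • fderiv ℝ ρ x) x :=
    ((contDiff_regNorm hη hu).differentiable (by simp) x).hasFDerivAt.const_mul ε
  have hne : ε * ρ x ≠ 0 := by positivity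
  -- $\nabla q=-\nabla u/(\epsilon\rho)-(q/\rho)\nabla\rho$: the first term is at most $1/\epsilon$
  -- because $|\nabla u|\le\rho$. The second is of lower order, since $|q|\le L$ wherever
  -- $Q'(q)\ne0$ and $\rho\ge\eta$.
  have hq : HasFDerivAt q ((ε * ρ x)⁻¹ • (-fderiv ℝ u x) - (q x / ρ x) • fderiv ℝ ρ x) x := by
    have h := hd1.mul ((hasDerivAt_inv hne).comp_hasFDerivAt x hd2)
    have : q = (fun x => t - u x) * (fun y => y⁻¹) ∘ fun x => ε * ρ x := by
      ext y; simp [q, div_eq_mul_inv]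
    rw [← this] at h
    refine h.congr_fderiv ?_
    have e1 : (((fun y : ℝ => y⁻¹) ∘ fun x => ε * ρ x) x) = (ε * ρ x)⁻¹ := rfl
    have e2 : (t - u x) * (-((ε * ρ x) ^ 2)⁻¹ * ε) = -(q x / ρ x) := by
      simp only [q]; field_simp
    rw [e1, smul_smul, smul_smul, mul_assoc, e2, neg_smul]
    abel
  have hcomp : HasFDerivAt (fun x => Q (q x))
      (Q' (q x) • ((ε * ρ x)⁻¹ • (-fderiv ℝ u x) - (q x / ρ x) • fderiv ℝ ρ x)) x :=
    (hQ _).comp_hasFDerivAt x hq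
  rw [← norm_fderiv_eq_norm_grad, hcomp.fderiv, norm_smul, Real.norm_eq_abs]
  by_cases hz : Q' (q x) = 0
  · simp [q] at hz; simp [hz, q]
  refine mul_le_mul_of_nonneg_left ?_ (abs_nonneg _)
  have hqL : |q x| ≤ L := by
    by_contra h
    exact hz (hQ0 _ (not_le.1 h).le)
  refine (norm_sub_le _ _).trans ?_
  rw [norm_smul, norm_smul, norm_neg, norm_inv, Real.norm_of_nonneg (by positivity : 0 ≤ ε * ρ x),
    norm_div, Real.norm_of_nonneg hρ.le, Real.norm_eq_abs, norm_fderiv_eq_norm_grad u]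
  have h1 : (ε * ρ x)⁻¹ * ‖grad u x‖ ≤ 1 / ε := by
    rw [inv_mul_le_iff₀ (by positivity)]
    have := norm_grad_le_regNorm (η := η) (u := u) x
    calc ‖grad u x‖ ≤ ρ x := this
      _ = ε * ρ x * (1 / ε) := by field_simp
  have h2 : |q x| / ρ x * ‖fderiv ℝ ρ x‖ ≤ L / η * D := by
    have : η ≤ ρ x := le_regNorm x
    gcongr
    exact hD x
  calc _ ≤ 1 / ε + L / η * D := add_le_add h1 h2
    _ = 1 / ε * (1 + L * ε * D / η) := by field_simp

/-- Averaging over the levels: a good level exists. -/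
lemma exists_good_level {F : ℝ → ℝ} (hF : Continuous F) (hFi : Integrable F) (hF0 : ∀ s, 0 ≤ F s)
    {Ω : Set (Rn n)} {u ρ : Rn n → ℝ} (hu : Continuous u) (hρ : Continuous ρ) (hρ0 : ∀ x, 0 < ρ x)
    (hρi : IntegrableOn ρ Ω) {ε a : ℝ} (hε : 0 < ε) (ha : a < 1 / 2) :
    ∃ t ∈ Icc a (1 - a), ∫⁻ x in Ω, ENNReal.ofReal (F ((t - u x) / (ε * ρ x)) / ε) ≤
      ENNReal.ofReal ((∫ s, F s) * (∫ x in Ω, ρ x) / (1 - 2 * a)) := by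
  have hFI : 0 ≤ ∫ s, F s := integral_nonneg hF0
  have hρI : 0 ≤ ∫ x in Ω, ρ x := integral_nonneg fun x => (hρ0 x).le
  have hm : Measurable (Function.uncurry fun (t : ℝ) (x : Rn n) =>
      ENNReal.ofReal (F ((t - u x) / (ε * ρ x)) / ε)) := by
    refine Continuous.measurable ?_
    refine ENNReal.continuous_ofReal.comp ((hF.comp ?_).div_const ε)
    exact (continuous_fst.sub (hu.comp continuous_snd)).div
      (continuous_const.mul (hρ.comp continuous_snd)) fun p => (mul_pos hε (hρ0 _)).ne'
  -- For fixed $x$ the change of variables in $t$ has Jacobian $\epsilon\rho(x)$, so each point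
  -- contributes $\rho(x)$ times the profile energy.
  have hinner : ∀ x, ∫⁻ t, ENNReal.ofReal (F ((t - u x) / (ε * ρ x)) / ε) =
      ENNReal.ofReal ((∫ s, F s) * ρ x) := by
    intro x
    have hc : 0 < ε * ρ x := mul_pos hε (hρ0 x)
    have hi : Integrable fun t => F ((t - u x) / (ε * ρ x)) / ε :=
      ((hFi.comp_div hc.ne').comp_sub_right (u x)).div_const ε
    rw [← ofReal_integral_eq_lintegral_ofReal hi (.of_forall fun t => div_nonneg (hF0 _) hε.le),
      integral_div, integral_sub_right_eq_self (fun t => F (t / (ε * ρ x))),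
      Measure.integral_comp_div, abs_of_pos hc, smul_eq_mul]
    congr 1
    field_simp
  have hvol : volume (Icc a (1 - a)) = ENNReal.ofReal (1 - 2 * a) := by
    rw [Real.volume_Icc]; congr 1; ring
  have hint : ∫⁻ t in Icc a (1 - a), ∫⁻ x in Ω, ENNReal.ofReal (F ((t - u x) / (ε * ρ x)) / ε) ≤
      ENNReal.ofReal ((∫ s, F s) * ∫ x in Ω, ρ x) := by
    calc _ ≤ ∫⁻ t, ∫⁻ x in Ω, ENNReal.ofReal (F ((t - u x) / (ε * ρ x)) / ε) :=
          setLIntegral_le_lintegral _ _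
      _ = ∫⁻ x in Ω, ∫⁻ t, ENNReal.ofReal (F ((t - u x) / (ε * ρ x)) / ε) :=
          lintegral_lintegral_swap hm.aemeasurable
      _ = ENNReal.ofReal ((∫ s, F s) * ∫ x in Ω, ρ x) := by
          simp_rw [hinner]
          rw [← integral_const_mul, ofReal_integral_eq_lintegral_ofReal (hρi.const_mul _)
            (.of_forall fun x => mul_nonneg hFI (hρ0 x).le)]
  obtain ⟨t, ht, hle⟩ := exists_le_setLAverage (μ := volume) (s := Icc a (1 - a))
    (f := fun t => ∫⁻ x in Ω, ENNReal.ofReal (F ((t - u x) / (ε * ρ x)) / ε))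
    (by rw [hvol]; simpa using by linarith) (by rw [hvol]; exact ENNReal.ofReal_ne_top)
    (hm.lintegral_prod_right').aemeasurable
  refine ⟨t, ht, hle.trans ?_⟩
  rw [setLAverage_eq, hvol, ENNReal.ofReal_div_of_pos (by linarith)]
  gcongr

/-- Phase fields built on a smooth function with almost optimal interfacial energy. -/
theorem exists_phaseField {W : ℝ → ℝ} (hW : IsDoubleWell W) {Ω : Set (Rn n)} (hΩ : IsOpen Ω)
    (hb : Bornology.IsBounded Ω) {u : Rn n → ℝ} (hu : ContDiff ℝ ∞ u) (huc : HasCompactSupport u)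
    {a τ : ℝ} (ha : 0 < a) (ha2 : a < 1 / 2) (hτ : 0 < τ) :
    ∃ ε₀ > 0, ∀ ε, 0 < ε → ε < ε₀ → ∃ 𝓔 : Rn n → ℝ, MemH1 Ω 𝓔 ∧ (∀ x, |𝓔 x| ≤ 1) ∧
      (∀ x, u x ≤ a / 2 → 𝓔 x = 1) ∧ (∀ x, 1 - a / 2 ≤ u x → 𝓔 x = -1) ∧
      interfaceEnergy W ε Ω 𝓔 ≤
        ENNReal.ofReal (c₀ W * (∫ x in Ω, ‖grad u x‖) / (1 - 2 * a) + τ) := by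
  set B := ∫ x in Ω, ‖grad u x‖
  set V := volume.real Ω
  have hB : 0 ≤ B := integral_nonneg fun x => norm_nonneg _
  have hV : 0 ≤ V := measureReal_nonneg
  have hc0 := hW.c₀_pos
  have h2a : 0 < 1 - 2 * a := by linarith
  -- One parameter $z$ bounds the profile excess, the regularisation of $|\nabla u|$ and the error
  -- from $\nabla\rho$; the left side is continuous in $z$ and below the target at $z=0$.
  obtain ⟨z, hz, hzτ⟩ : ∃ z : ℝ, 0 < z ∧
      (1 + z) ^ 2 * ((c₀ W + z) * (B + z * V) / (1 - 2 * a)) ≤ c₀ W * B / (1 - 2 * a) + τ := by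
    have hcont : Continuous fun z : ℝ => (1 + z) ^ 2 * ((c₀ W + z) * (B + z * V) / (1 - 2 * a)) := by
      fun_prop
    have h0 : (1 + (0 : ℝ)) ^ 2 * ((c₀ W + 0) * (B + 0 * V) / (1 - 2 * a)) <
        c₀ W * B / (1 - 2 * a) + τ := by
      simp only [add_zero, one_pow, one_mul, zero_mul]; linarith
    have h := (hcont.tendsto 0).eventually (Iic_mem_nhds h0)
    have h' : ∀ᶠ z in 𝓝[>] (0 : ℝ), (1 + z) ^ 2 * ((c₀ W + z) * (B + z * V) / (1 - 2 * a)) ≤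
        c₀ W * B / (1 - 2 * a) + τ := nhdsWithin_le_nhds h
    obtain ⟨z, h1, h2⟩ := (h'.and self_mem_nhdsWithin).exists
    exact ⟨z, h2, h1⟩
  obtain ⟨Q, Q', L, hL, hQ, hQ'c, hQ1, hQm, hQp, hQ0, hQF⟩ := exists_profile hW hz
  set ρ := regNorm z u
  have hρs : ContDiff ℝ ∞ ρ := contDiff_regNorm hz hu
  have hρ0 : ∀ x, 0 < ρ x := regNorm_pos hz
  have hgc := hasCompactSupport_grad huc
  obtain ⟨M, hM⟩ := hgc.exists_bound_of_continuous (contDiff_grad hu).continuous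
  have hM0 : 0 ≤ M := (norm_nonneg _).trans (hM 0)
  obtain ⟨D, hD⟩ : ∃ D, ∀ x, ‖fderiv ℝ ρ x‖ ≤ D := by
    have : HasCompactSupport (fderiv ℝ fun x => ρ x - z) := by
      refine HasCompactSupport.fderiv ℝ (HasCompactSupport.intro hgc.isCompact fun x hx => ?_)
      simp [ρ, regNorm, image_eq_zero_of_notMem_tsupport hx, Real.sqrt_sq hz.le]
    rw [show (fderiv ℝ fun x => ρ x - z) = fderiv ℝ ρ from funext fun x => fderiv_sub_const _] at this
    exact this.exists_bound_of_continuous (hρs.continuous_fderiv (by simp))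
  have hD0 : 0 ≤ D := (norm_nonneg _).trans (hD 0)
  -- Below $\epsilon_1$ the transition occupies only values of $u$ within $a/2$ of the level
  -- $t\in[a,1-a]$; below $\epsilon_2$ the contribution of $\nabla\rho$ is at most a relative error
  -- $z$.
  obtain ⟨ε₁, hε₁, hε₁'⟩ := exists_pos_mul_le (L * (M + z)) (half_pos ha)
  obtain ⟨ε₂, hε₂, hε₂'⟩ := exists_pos_mul_le (L * D / z) hz
  refine ⟨min ε₁ ε₂, lt_min hε₁ hε₂, fun ε hε hεlt => ?_⟩
  set F : ℝ → ℝ := fun s => Q' s ^ 2 / 2 + W (Q s)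
  have hQc : Continuous Q := continuous_iff_continuousAt.2 fun s => (hQ s).continuousAt
  have hF : Continuous F := ((hQ'c.pow 2).div_const 2).add (hW.continuous.comp hQc)
  have hF0 : ∀ s, 0 ≤ F s := fun s => add_nonneg (by positivity) (hW.nonneg _)
  have hFi : Integrable F := by
    refine hF.integrable_of_hasCompactSupport (HasCompactSupport.intro
      (isCompact_Icc (a := -L) (b := L)) fun s hs => ?_)
    have h1 : L ≤ |s| := by
      by_contra h
      exact hs (abs_le.1 (not_le.1 h).le)
    have h2 : W (Q s) = 0 := by
      rcases le_abs.1 h1 with h | h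
      · rw [hQp s h, hW.right_zero]
      · rw [hQm s (by linarith), hW.left_zero]
    simp [F, hQ0 s h1, h2]
  have hfin : IsFiniteMeasure (volume.restrict Ω) := ⟨by
    rw [Measure.restrict_apply_univ]; exact hb.measure_lt_top⟩
  have hgi : Integrable (fun x => ‖grad u x‖) :=
    ((contDiff_grad hu).continuous.integrable_of_hasCompactSupport hgc).norm
  have hρi : IntegrableOn ρ Ω := by
    refine Integrable.mono' (hgi.integrableOn.add (integrable_const z))
      hρs.continuous.aestronglyMeasurable (.of_forall fun x => ?_)
    rw [Real.norm_of_nonneg (hρ0 x).le]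
    exact regNorm_le hz x
  obtain ⟨t, ht, hgood⟩ := exists_good_level hF hFi hF0 hu.continuous hρs.continuous hρ0 hρi hε ha2
  set 𝓔 : Rn n → ℝ := fun x => Q ((t - u x) / (ε * ρ x))
  have hQ1' : ContDiff ℝ 1 Q := by
    rw [contDiff_one_iff_deriv]
    exact ⟨fun s => (hQ s).differentiableAt, by
      rwa [show deriv Q = Q' from funext fun s => (hQ s).deriv]⟩
  have h𝓔 : ContDiff ℝ 1 𝓔 := hQ1'.comp (((contDiff_const.sub hu).div (contDiff_const.mul hρs)
    fun x => (mul_pos hε (hρ0 x)).ne').of_le (by simp))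
  have hρM : ∀ x, L * (ε * ρ x) ≤ a / 2 := by
    intro x
    have h1 : ρ x ≤ M + z := (regNorm_le hz x).trans (by linarith [hM x])
    have h2 : ε ≤ ε₁ := (hεlt.trans_le (min_le_left _ _)).le
    calc L * (ε * ρ x) ≤ L * (ε₁ * (M + z)) := by
          have := (hρ0 x).le
          gcongr
      _ ≤ a / 2 := by linarith
  refine ⟨𝓔, memH1_of_contDiff hΩ hb h𝓔, fun x => hQ1 _, fun x hx => hQp _ ?_,
    fun x hx => hQm _ ?_, ?_⟩
  · rw [le_div_iff₀ (mul_pos hε (hρ0 x))]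
    linarith [hρM x, ht.1]
  · rw [div_le_iff₀ (mul_pos hε (hρ0 x))]
    linarith [hρM x, ht.2]
  have hpt : ∀ x, ε * (‖grad 𝓔 x‖ ^ 2 / 2) + 1 / ε * W (𝓔 x) ≤
      (1 + z) ^ 2 * (F ((t - u x) / (ε * ρ x)) / ε) := by
    intro x
    have h1 := norm_grad_profile_le (t := t) hL hQ hQ0 hu hz hε hD x
    change ‖grad 𝓔 x‖ ≤ |Q' ((t - u x) / (ε * ρ x))| * _ at h1
    set q := (t - u x) / (ε * ρ x)
    have h2 : L * ε * D / z ≤ z := by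
      have : ε ≤ ε₂ := (hεlt.trans_le (min_le_right _ _)).le
      calc L * ε * D / z = L * D / z * ε := by ring
        _ ≤ L * D / z * ε₂ := by gcongr
        _ ≤ z := hε₂'
    have h3 : ‖grad 𝓔 x‖ ≤ |Q' q| * (1 / ε * (1 + z)) := h1.trans (by gcongr)
    have h4 : ‖grad 𝓔 x‖ ^ 2 ≤ Q' q ^ 2 * ((1 + z) ^ 2 / ε ^ 2) := by
      calc ‖grad 𝓔 x‖ ^ 2 ≤ (|Q' q| * (1 / ε * (1 + z))) ^ 2 := by gcongr
        _ = Q' q ^ 2 * ((1 + z) ^ 2 / ε ^ 2) := by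
          rw [mul_pow, sq_abs, mul_pow, one_div, inv_pow]; ring
    have h5 := hW.nonneg (Q q)
    calc ε * (‖grad 𝓔 x‖ ^ 2 / 2) + 1 / ε * W (𝓔 x)
        ≤ ε * (Q' q ^ 2 * ((1 + z) ^ 2 / ε ^ 2) / 2) + 1 / ε * ((1 + z) ^ 2 * W (Q q)) := by
          gcongr
          exact le_mul_of_one_le_left h5 (by nlinarith)
      _ = (1 + z) ^ 2 * (F q / ε) := by
          simp only [F]; field_simp
  have hwg := (hasWeakGradient_grad h𝓔 Ω).weakGradient_ae_eq hΩ
  calc interfaceEnergy W ε Ω 𝓔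
      ≤ ∫⁻ x in Ω, ENNReal.ofReal ((1 + z) ^ 2) *
          ENNReal.ofReal (F ((t - u x) / (ε * ρ x)) / ε) := by
        refine lintegral_mono_ae (hwg.mono fun x hx => ?_)
        rw [hx, ← ENNReal.ofReal_mul (by positivity)]
        exact ENNReal.ofReal_le_ofReal (hpt x)
    _ = ENNReal.ofReal ((1 + z) ^ 2) *
          ∫⁻ x in Ω, ENNReal.ofReal (F ((t - u x) / (ε * ρ x)) / ε) :=
        lintegral_const_mul' _ _ ENNReal.ofReal_ne_top
    _ ≤ ENNReal.ofReal ((1 + z) ^ 2) *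
          ENNReal.ofReal ((∫ s, F s) * (∫ x in Ω, ρ x) / (1 - 2 * a)) := by gcongr
    _ ≤ ENNReal.ofReal (c₀ W * B / (1 - 2 * a) + τ) := by
        rw [← ENNReal.ofReal_mul (by positivity)]
        refine ENNReal.ofReal_le_ofReal (le_trans ?_ hzτ)
        have hρI : ∫ x in Ω, ρ x ≤ B + z * V := by
          have h1 : ∫ x in Ω, ρ x ≤ ∫ x in Ω, (‖grad u x‖ + z) :=
            integral_mono hρi (hgi.integrableOn.add (integrable_const z)) fun x => regNorm_le hz x
          rw [integral_add hgi.integrableOn (integrable_const z), setIntegral_const, smul_eq_mul,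
            mul_comm _ z] at h1
          exact h1
        have : 0 ≤ ∫ x in Ω, ρ x := integral_nonneg fun x => (hρ0 x).le
        gcongr

end ACKS

/-! ### Recovery pairs and recovery sequences -/

namespace ACKS

open Metric

variable {n : ℕ}

/-- Truncating near the origin does not increase the Dirichlet energy. -/
lemma memH1_comp_le {Ω : Set (Rn n)} (hΩ : IsOpen Ω) {v : Rn n → ℝ} (hv : MemH1 Ω v)
    {β β' : ℝ → ℝ} (hd : ∀ s, HasDerivAt β (β' s) s) (hc : Continuous β') (h1 : ∀ s, |β' s| ≤ 1)
    (h0 : β 0 = 0) : MemH1 Ω (fun x => β (v x)) ∧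
      dirichletEnergy Ω (fun x => β (v x)) ≤ dirichletEnergy Ω v := by
  obtain ⟨hG, hG2⟩ := hv.memLp_weakGradient hΩ
  have hβ := hG.comp hΩ hd hc h1
  have hβc : Continuous β := continuous_iff_continuousAt.2 fun s => (hd s).continuousAt
  have hle : ∀ x, ‖β' (v x) • weakGradient Ω v x‖ ≤ ‖weakGradient Ω v x‖ := fun x => by
    rw [norm_smul, Real.norm_eq_abs]
    exact mul_le_of_le_one_left (norm_nonneg _) (h1 _)
  have hmem : MemH1 Ω (fun x => β (v x)) := by
    refine ⟨hv.1.mono (hβc.comp_aestronglyMeasurable hv.1.1) (.of_forall fun x => ?_), _, hβ,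
      hG2.mono ((hc.comp_aestronglyMeasurable hv.1.1).smul hG2.1) (.of_forall hle)⟩
    simpa [h0, Real.norm_eq_abs] using abs_sub_le_of_hasDerivAt hd h1 (v x) 0
  refine ⟨hmem, ?_⟩
  rw [dirichletEnergy, dirichletEnergy, if_pos hmem, if_pos hv]
  refine lintegral_mono_ae ((hβ.weakGradient_ae_eq hΩ).mono fun x hx => ?_)
  rw [hx]
  have := hle x
  gcongr

/-- Recovery pairs for all small parameters. -/
theorem exists_recovery {W : ℝ → ℝ} (hW : IsDoubleWell W) {Ω : Set (Rn n)} (hΩ : IsOpen Ω)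
    (hb : Bornology.IsBounded Ω) (hL : HasLipschitzBoundary Ω) {v : Rn n → ℝ} {E : Set (Rn n)}
    (hA : Admissible₀ Ω v E) (hv : ContinuousOn v (closure Ω)) {τ : ℝ} (hτ : 0 < τ) :
    ∃ ε₀ > 0, ∀ ε, 0 < ε → ε < ε₀ → ∃ v' 𝓔 : Rn n → ℝ, Admissible Ω v' 𝓔 ∧
      eLpNorm (v' - v) 2 (volume.restrict Ω) ≤ ENNReal.ofReal τ ∧
      eLpNorm (𝓔 - phase E) 1 (volume.restrict Ω) ≤ ENNReal.ofReal τ ∧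
      J W ε Ω v' 𝓔 ≤ I W Ω v E + ENNReal.ofReal τ := by
  have hfin : IsFiniteMeasure (volume.restrict Ω) := ⟨by
    rw [Measure.restrict_apply_univ]; exact hb.measure_lt_top⟩
  have hc0 := hW.c₀_pos
  set p := (perimeter Ω E).toReal
  have hp : 0 ≤ p := ENNReal.toReal_nonneg
  obtain ⟨δ, hδ, hδτ⟩ := exists_pos_mul_le
    ((volume.restrict Ω univ ^ (2 : ℝ≥0∞).toReal⁻¹).toReal * 2) hτ
  obtain ⟨β, β', hd, hc, h1, hβ0, hβn, hβδ⟩ := exists_truncation hδ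
  obtain ⟨hv'1, hv'2⟩ := memH1_comp_le hΩ hA.memH1 hd hc h1 (hβ0 0 hδ.le)
  obtain ⟨r, hr, hvr⟩ := Metric.uniformContinuousOn_iff.1
    (hb.isCompact_closure.uniformContinuousOn_of_continuous hv) δ hδ
  obtain ⟨a, ha, ha2, hap⟩ : ∃ a : ℝ, 0 < a ∧ a < 1 / 2 ∧
      c₀ W * (p + a) / (1 - 2 * a) + a ≤ c₀ W * p + τ := by
    have hcont : ContinuousAt (fun a : ℝ => c₀ W * (p + a) / (1 - 2 * a) + a) 0 := by
      have : (1 - 2 * (0 : ℝ)) ≠ 0 := by norm_num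
      fun_prop (disch := assumption)
    have h0 : c₀ W * (p + (0 : ℝ)) / (1 - 2 * 0) + 0 < c₀ W * p + τ := by
      simp only [add_zero, mul_zero, sub_zero, div_one]; linarith
    have h : ∀ᶠ a in 𝓝[>] (0 : ℝ), c₀ W * (p + a) / (1 - 2 * a) + a ≤ c₀ W * p + τ :=
      nhdsWithin_le_nhds (hcont.tendsto.eventually (Iic_mem_nhds h0))
    have h' : ∀ᶠ a in 𝓝[>] (0 : ℝ), a < 1 / 2 :=
      nhdsWithin_le_nhds (Iio_mem_nhds (by norm_num))
    obtain ⟨a, ⟨h2, h3⟩, h4⟩ := ((h.and h').and self_mem_nhdsWithin).exists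
    exact ⟨a, h4, h3, h2⟩
  -- The tolerance $a$ is for the total variation, $a\tau/4$ for the $L^1$ distance, which is
  -- multiplied by $4/a$ below.
  obtain ⟨u, hu, huc, hu1, hu0, hup⟩ := exists_smooth_approx hΩ hb hL hA.caccioppoli.measurable
    hA.caccioppoli.subset hr (τ := min a (a / 4 * τ)) (by positivity)
  obtain ⟨ε₀, hε₀, hε⟩ := exists_phaseField hW hΩ hb hu huc ha ha2 ha
  refine ⟨ε₀, hε₀, fun ε hε0 hεlt => ?_⟩
  obtain ⟨𝓔, h𝓔, h𝓔1, h𝓔p, h𝓔m, hen⟩ := hε ε hε0 hεlt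
  refine ⟨fun x => β (v x), 𝓔, ⟨hv'1, h𝓔, .of_forall fun x => hβn _,
    .of_forall fun x => abs_le.1 (h𝓔1 x), ?_⟩, ?_, ?_, ?_⟩
  · refine (ae_restrict_iff' hΩ.measurableSet).2 (.of_forall fun x hx hpos => h𝓔p x ?_)
    have hvx : δ < v x := by
      by_contra h
      rw [hβ0 _ (not_lt.1 h)] at hpos
      exact hpos.false
    rw [hu0 x]
    · positivity
    -- Within distance $r$ of a point with $v>\delta$, $v$ cannot vanish in $\Omega$, whereas it
    -- vanishes almost everywhere in $E$.
    refine measure_mono_null ?_ (ae_iff.1 ((ae_restrict_iff' hΩ.measurableSet).1 hA.eq_zero))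
    rintro y ⟨hy, hyE⟩ h
    have hyΩ := hA.caccioppoli.subset hyE
    have := hvr y (subset_closure hyΩ) x (subset_closure hx) hy
    rw [h hyΩ hyE, Real.dist_eq, zero_sub, abs_neg] at this
    linarith [le_abs_self (v x)]
  · refine (eLpNorm_le_of_ae_bound (C := 2 * δ) (hA.nonneg.mono fun x hx => hβδ _ hx)).trans ?_
    have htop : volume.restrict Ω univ ^ (2 : ℝ≥0∞).toReal⁻¹ ≠ ⊤ :=
      ENNReal.rpow_ne_top_of_nonneg (by positivity) (measure_ne_top _ _)
    rw [← ENNReal.ofReal_toReal htop, ← ENNReal.ofReal_mul ENNReal.toReal_nonneg]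
    refine ENNReal.ofReal_le_ofReal ?_
    linarith
  · rw [eLpNorm_one_eq_lintegral_enorm]
    -- The phases agree unless $u$ is at least $a/2$ away from $\chi_E$, and they never differ by
    -- more than $2$.
    have hpt : ∀ x, ‖(𝓔 - phase E) x‖ₑ ≤
        ENNReal.ofReal (4 / a) * ‖u x - E.indicator 1 x‖ₑ := by
      intro x
      rw [← ofReal_norm, ← ofReal_norm, ← ENNReal.ofReal_mul (by positivity),
        Real.norm_eq_abs, Real.norm_eq_abs, Pi.sub_apply]
      refine ENNReal.ofReal_le_ofReal ?_
      have hb1 := abs_le.1 (h𝓔1 x)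
      have key : ∀ s : ℝ, a / 2 ≤ s → 2 ≤ 4 / a * s := fun s hs => by
        calc (2 : ℝ) = 4 / a * (a / 2) := by field_simp; norm_num
          _ ≤ 4 / a * s := by gcongr
      by_cases hx : x ∈ E
      · rw [phase_of_mem hx, indicator_of_mem hx, Pi.one_apply]
        rcases le_or_gt (1 - a / 2) (u x) with h | h
        · rw [h𝓔m x h]; simp; positivity
        · refine le_trans ?_ (key _ (le_trans ?_ (neg_le_abs _)))
          · rw [abs_le]; constructor <;> linarith
          · linarith
      · rw [phase_of_notMem hx, indicator_of_notMem hx]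
        rcases le_or_gt (u x) (a / 2) with h | h
        · rw [h𝓔p x h]; simp; positivity
        · refine le_trans ?_ (key _ (le_trans ?_ (le_abs_self _)))
          · rw [abs_le]; constructor <;> linarith
          · linarith
    calc _ ≤ ∫⁻ x in Ω, ENNReal.ofReal (4 / a) * ‖u x - E.indicator 1 x‖ₑ := lintegral_mono hpt
      _ = ENNReal.ofReal (4 / a) * ∫⁻ x in Ω, ‖u x - E.indicator 1 x‖ₑ :=
        lintegral_const_mul' _ _ ENNReal.ofReal_ne_top
      _ ≤ ENNReal.ofReal (4 / a) * ENNReal.ofReal (a / 4 * τ) := by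
        gcongr
        exact hu1.trans (ENNReal.ofReal_le_ofReal (min_le_right _ _))
      _ = ENNReal.ofReal τ := by
        rw [← ENNReal.ofReal_mul (by positivity)]
        congr 1
        field_simp
  · rw [J_eq_add hW hε0 hΩ hv'1, I, add_assoc]
    refine add_le_add hv'2 ?_
    -- A Caccioppoli set has only locally finite perimeter in $\Omega$, so the limit energy may be
    -- infinite; the bound is then trivial.
    by_cases htop : perimeter Ω E = ⊤
    · rw [htop, ENNReal.mul_top (by simpa using hc0), top_add]
      exact le_top
    have hB : ∫ x in Ω, ‖grad u x‖ ≤ p + a := by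
      have h2 := hup.trans (add_le_add_right (ENNReal.ofReal_le_ofReal (min_le_left _ _)) _)
      rw [← ENNReal.ofReal_toReal htop, ← ENNReal.ofReal_add hp ha.le] at h2
      exact (ENNReal.ofReal_le_ofReal_iff (by positivity)).1 h2
    rw [← ENNReal.ofReal_toReal htop, ← ENNReal.ofReal_mul hc0.le,
      ← ENNReal.ofReal_add (by positivity) hτ.le]
    refine hen.trans (ENNReal.ofReal_le_ofReal (le_trans ?_ hap))
    have : 0 < 1 - 2 * a := by linarith
    gcongr

/-- Recovery sequences. -/
theorem exists_recovery_sequence {W : ℝ → ℝ} (hW : IsDoubleWell W) {Ω : Set (Rn n)}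
    (hΩ : IsOpen Ω) (hb : Bornology.IsBounded Ω) (hL : HasLipschitzBoundary Ω) {ε : ℕ → ℝ}
    {v : Rn n → ℝ} {E : Set (Rn n)} (hε : ∀ k, 0 < ε k) (hε0 : Tendsto ε atTop (𝓝 0))
    (hA : Admissible₀ Ω v E) (hv : ContinuousOn v (closure Ω)) :
    ∃ v𝓔 : ℕ → (Rn n → ℝ) × (Rn n → ℝ), (∀ k, Admissible Ω (v𝓔 k).1 (v𝓔 k).2) ∧
      ConvergesTo Ω v𝓔 v E ∧
      Tendsto (fun k => J W (ε k) Ω (v𝓔 k).1 (v𝓔 k).2) atTop (𝓝 (I W Ω v E)) := by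
  set S := {q : (Rn n → ℝ) × (Rn n → ℝ) // Admissible Ω q.1 q.2}
  have hS : Nonempty S := ⟨⟨(fun _ => 0, fun _ => 1), memH1_of_contDiff hΩ hb contDiff_const,
    memH1_of_contDiff hΩ hb contDiff_const, by simp, by simp, by simp⟩⟩
  -- The subtraction in `ℝ≥0∞` is truncated, so only an excess of energy counts as error. A deficit
  -- is excluded in the limit by lower semicontinuity, and an infinite limit energy needs no
  -- separate case.
  set e : ℕ → S → ℝ≥0∞ := fun k q => eLpNorm (q.1.1 - v) 2 (volume.restrict Ω) +
    eLpNorm (q.1.2 - phase E) 1 (volume.restrict Ω) + (J W (ε k) Ω q.1.1 q.1.2 - I W Ω v E)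
  have hinf : Tendsto (fun k => ⨅ q, e k q) atTop (𝓝 0) := by
    refine ENNReal.tendsto_nhds_zero.2 fun η hη => ?_
    obtain ⟨τ, hτ, hτη⟩ : ∃ τ : ℝ, 0 < τ ∧ ENNReal.ofReal τ + ENNReal.ofReal τ +
        ENNReal.ofReal τ ≤ η := by
      obtain ⟨s, hs, hsη⟩ := ENNReal.lt_iff_exists_nnreal_btwn.1 hη
      refine ⟨s / 3, by have := ENNReal.coe_pos.1 hs; positivity, ?_⟩
      rw [← ENNReal.ofReal_add (by positivity) (by positivity),
        ← ENNReal.ofReal_add (by positivity) (by positivity), add_thirds]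
      simpa using hsη.le
    obtain ⟨ε₀, hε₀, hrec⟩ := exists_recovery hW hΩ hb hL hA hv hτ
    filter_upwards [hε0.eventually (Iio_mem_nhds hε₀)] with k hk
    obtain ⟨v', 𝓔, hadm, h1, h2, h3⟩ := hrec (ε k) (hε k) hk
    refine (iInf_le _ (⟨(v', 𝓔), hadm⟩ : S)).trans (le_trans ?_ hτη)
    exact add_le_add (add_le_add h1 h2) (tsub_le_iff_left.2 h3)
  have hinv : Tendsto (fun k : ℕ => ((k : ℝ≥0∞))⁻¹) atTop (𝓝 0) := ENNReal.tendsto_inv_nat_nhds_zero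
  -- At $k=0$ the inverse is `⊤`, so the condition is vacuous there. Almost minimising at each $k$
  -- replaces a diagonal choice of tolerances.
  have hex : ∀ k : ℕ, ∃ q, e k q ≤ (⨅ q, e k q) + (k : ℝ≥0∞)⁻¹ := by
    intro k
    by_cases h : (⨅ q, e k q) = ⊤
    · exact ⟨hS.some, by rw [h, top_add]; exact le_top⟩
    · obtain ⟨q, hq⟩ := iInf_lt_iff.1
        (ENNReal.lt_add_right h (b := (k : ℝ≥0∞)⁻¹) (by simp))
      exact ⟨q, hq.le⟩
  choose q hq using hex
  have he : Tendsto (fun k => e k (q k)) atTop (𝓝 0) := by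
    refine tendsto_of_tendsto_of_tendsto_of_le_of_le tendsto_const_nhds ?_ (fun _ => zero_le) hq
    simpa using hinf.add hinv
  have hconv : ConvergesTo Ω (fun k => (q k).1) v E := by
    refine ⟨tendsto_of_tendsto_of_tendsto_of_le_of_le tendsto_const_nhds he (fun _ => zero_le)
        fun k => ?_, tendsto_of_tendsto_of_tendsto_of_le_of_le tendsto_const_nhds he
        (fun _ => zero_le) fun k => ?_⟩
    · exact le_self_add.trans le_self_add
    · exact le_add_self.trans le_self_add
  refine ⟨fun k => (q k).1, fun k => (q k).2, hconv, tendsto_of_le_liminf_of_limsup_le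
    (lowerSemicontinuity hW hΩ hε (fun k => (q k).2) hA.memH1.1 hA.caccioppoli.measurable
      hA.caccioppoli.subset hconv).1 ?_⟩
  have hup : Tendsto (fun k => I W Ω v E + e k (q k)) atTop (𝓝 (I W Ω v E)) := by
    simpa using he.const_add (I W Ω v E)
  rw [← hup.limsup_eq]
  refine limsup_le_limsup (.of_forall fun k => ?_)
  exact tsub_le_iff_left.1 le_add_self

end ACKS


theorem mainTheorem3 {n : ℕ} (hn : 1 ≤ n) (W : ℝ → ℝ) (hW : ACKS.IsDoubleWell W)
    (Ω : Set (ACKS.Rn n)) (hΩ : IsOpen Ω) :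
    -- lower semicontinuity; the limit pair is automatically admissible when the liminf is finite
    (∀ (ε : ℕ → ℝ) (v𝓔 : ℕ → (ACKS.Rn n → ℝ) × (ACKS.Rn n → ℝ))
        (v : ACKS.Rn n → ℝ) (E : Set (ACKS.Rn n)),
      (∀ k, 0 < ε k) → Tendsto ε atTop (𝓝 0) →
      (∀ k, ACKS.Admissible Ω (v𝓔 k).1 (v𝓔 k).2) →
      MemLp v 2 (volume.restrict Ω) → NullMeasurableSet E → E ⊆ Ω →
      ACKS.ConvergesTo Ω v𝓔 v E →
      ACKS.I W Ω v E ≤ liminf (fun k => ACKS.J W (ε k) Ω (v𝓔 k).1 (v𝓔 k).2) atTop ∧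
      (liminf (fun k => ACKS.J W (ε k) Ω (v𝓔 k).1 (v𝓔 k).2) atTop < ⊤ →
        ACKS.Admissible₀ Ω v E)) ∧
    -- approximation
    (Bornology.IsBounded Ω → ACKS.HasLipschitzBoundary Ω →
      ∀ (ε : ℕ → ℝ) (v : ACKS.Rn n → ℝ) (E : Set (ACKS.Rn n)),
      (∀ k, 0 < ε k) → Tendsto ε atTop (𝓝 0) →
      ACKS.Admissible₀ Ω v E → ContinuousOn v (closure Ω) →
      ∃ v𝓔 : ℕ → (ACKS.Rn n → ℝ) × (ACKS.Rn n → ℝ),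
        (∀ k, ACKS.Admissible Ω (v𝓔 k).1 (v𝓔 k).2) ∧
        ACKS.ConvergesTo Ω v𝓔 v E ∧
        Tendsto (fun k => ACKS.J W (ε k) Ω (v𝓔 k).1 (v𝓔 k).2) atTop
          (𝓝 (ACKS.I W Ω v E))) := by
  exact ⟨fun ε v𝓔 v E hε _ hadm hv hE hEΩ hconv =>
      ACKS.lowerSemicontinuity hW hΩ hε hadm hv hE hEΩ hconv,
    fun hb hL ε v E hε hε0 hA hv => ACKS.exists_recovery_sequence hW hΩ hb hL hε hε0 hA hv⟩
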